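/- Let $\mathrm{PA}$ be first-order Peano arithmetic (in the language $0, S, +, \cdot$, with the induction scheme for all formulas of this language), and let $\vdash$ denote provability in classical first-order logic with equality. Each ordinal $\alpha<\varepsilon_0$ is represented by a natural number that codes its complete Cantor normal form: $0$, or $\alpha=\omega^{\alpha_1}k_1+\dots+\omega^{\alpha_n}k_n$ with $\alpha_1>\dots>\alpha_n$, $0<k_1,\dots,k_n<\omega$ and the exponents $\alpha_i$ again in this form; such forms are compared lexicographically, from the leading term on. Primitive recursive functions $\mathbb N\to\mathbb N$ are represented by codes for their generation, so that quantification over all primitive recursive functions is quantification over codes. For $c\ge b\ge 2$ let $S^b_c(m)$ be the number that results from $m$ if the base $b$ is replaced by $c$ everywhere in the complete $b$-representation of $m$, where $S^b_c(0)=0$. A primitive recursive Goodstein sequence is a sequence $(m^f_i)_{i\in\mathbb N}$ with $m^f_0=m$ and $m^f_{i+1}=\max\bigl(S^{f(i)}_{f(i+1)}(m^f_i)-1,\,0\bigr)$, where $m\in\mathbb N$ is arbitrary and $f:\mathbb N\to\mathbb N$ is a non-decreasing primitive recursive function with $f(0)\ge 2$. Let (i) and (ii) be the following statements, each formalized as a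 single sentence of the language of $\mathrm{PA}$ by means of these codes. (i) Every primitive recursive Goodstein sequence terminates: for all such $f$ and $m$ there is $k$ such that $m^f_i=0$ for all $i\ge k$. (ii) There is no primitive recursive infinite strictly descending sequence $\varepsilon_0>\alpha_0>\alpha_1>\alpha_2>\dots$ of ordinals (in complete Cantor normal form). Then $\mathrm{PA}\vdash \text{(i)}\leftrightarrow\text{(ii)}$. -/

import Mathlib

namespace GoodsteinPA

open FirstOrder.Language

/-! ## First-order provability

A natural deduction calculus for classical first-order logic with equality.  Formulas are
Mathlib's (the primitive connectives are `⊥`, `=`, relations, `→` and `∀`), with the natural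
numbers as names of the free variables. -/

section Provability

variable {L : FirstOrder.Language.{0, 0}}

/-- `inst φ t` is `φ(t)`: the term `t` is put for the single unbound de Bruijn variable of `φ`. -/
def inst (φ : L.BoundedFormula ℕ 1) (t : L.Term ℕ) : L.Formula ℕ :=
  φ.toFormula.subst (Sum.elim Term.var (fun _ => t))

/-- A sentence, seen as a formula over the variables `ℕ` in which none of them is free. -/
def embed (φ : L.Sentence) : L.Formula ℕ :=
  φ.relabel (Empty.elim : Empty → ℕ)

/-- `Derives T Γ φ`: there is a natural deduction derivation of `φ` from the axioms `T`
and the open assumptions `Γ`. -/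
inductive Derives (T : L.Theory) : List (L.Formula ℕ) → L.Formula ℕ → Prop
  | axm {Γ} (ψ : L.Sentence) : ψ ∈ T → Derives T Γ (embed ψ)
  | hyp {Γ} (φ : L.Formula ℕ) : φ ∈ Γ → Derives T Γ φ
  | imp_intro {Γ} (φ ψ : L.Formula ℕ) : Derives T (φ :: Γ) ψ → Derives T Γ (φ.imp ψ)
  | imp_elim {Γ} (φ ψ : L.Formula ℕ) :
      Derives T Γ (φ.imp ψ) → Derives T Γ φ → Derives T Γ ψ
  | raa {Γ} (φ : L.Formula ℕ) : Derives T (φ.not :: Γ) ⊥ → Derives T Γ φ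
  | all_intro {Γ} (φ : L.BoundedFormula ℕ 1) (a : ℕ) :
      (∀ ψ ∈ Γ, a ∉ ψ.freeVarFinset) → a ∉ φ.freeVarFinset →
      Derives T Γ (inst φ (Term.var a)) → Derives T Γ φ.all
  | all_elim {Γ} (φ : L.BoundedFormula ℕ 1) (t : L.Term ℕ) :
      Derives T Γ φ.all → Derives T Γ (inst φ t)
  | eq_refl {Γ} (t : L.Term ℕ) : Derives T Γ (t.equal t)
  | eq_subst {Γ} (φ : L.BoundedFormula ℕ 1) (s t : L.Term ℕ) :
      Derives T Γ (s.equal t) → Derives T Γ (inst φ s) → Derives T Γ (inst φ t)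

/-- `Provable T φ`, usually written `T ⊢ φ`. -/
def Provable (T : L.Theory) (φ : L.Sentence) : Prop :=
  Derives T [] (embed φ)

end Provability

/-! ## The language of arithmetic -/

/-- The function symbols `0`, `S`, `+`, `·`. -/
inductive ArithFunc : ℕ → Type
  | zero : ArithFunc 0
  | succ : ArithFunc 1
  | add : ArithFunc 2
  | mul : ArithFunc 2

/-- The language `0, S, +, ·` of Peano arithmetic; equality is logical. -/
def LA : FirstOrder.Language.{0, 0} where
  Functions := ArithFunc
  Relations := fun _ => Empty

instance {α : Type} : Zero (LA.Term α) := ⟨Term.func (L := LA) ArithFunc.zero ![]⟩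

/-- The successor term `S t`. -/
def sc {α : Type} (t : LA.Term α) : LA.Term α := Term.func (L := LA) ArithFunc.succ ![t]

instance {α : Type} : One (LA.Term α) := ⟨sc 0⟩

instance {α : Type} : Add (LA.Term α) :=
  ⟨fun s t => Term.func (L := LA) ArithFunc.add ![s, t]⟩

instance {α : Type} : Mul (LA.Term α) :=
  ⟨fun s t => Term.func (L := LA) ArithFunc.mul ![s, t]⟩

/-! ## Writing formulas

To write formulas with readable bound variables, a term (a formula) is given at every depth `d`,
that is, in the scope of `d` quantifiers, whose variables are numbered `0, …, d - 1` from the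
outermost to the innermost one, as in Mathlib.  The elements of `α` are free variables. -/

abbrev Tm (α : Type) : Type := (d : ℕ) → LA.Term (α ⊕ Fin d)

abbrev Fm (α : Type) : Type := (d : ℕ) → LA.BoundedFormula α d

section Combinators

variable {α : Type}

/-- The variable bound by the `i`-th enclosing quantifier (it is only used in its scope, where
`i < d`). -/
def bvar (i : ℕ) : Tm α := fun d => if h : i < d then Term.var (Sum.inr ⟨i, h⟩) else 0

/-- A free variable. -/
def fvar (x : α) : Tm α := fun _ => Term.var (Sum.inl x)

/-- The successor. -/
def S (x : Tm α) : Tm α := fun d => sc (x d)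

/-- The numeral of `n`. -/
def num : ℕ → Tm α
  | 0 => 0
  | n + 1 => S (num n)

def eqF (x y : Tm α) : Fm α := fun d => (x d).bdEqual (y d)
def andF (A B : Fm α) : Fm α := fun d => A d ⊓ B d
def orF (A B : Fm α) : Fm α := fun d => A d ⊔ B d
def impF (A B : Fm α) : Fm α := fun d => (A d).imp (B d)
def notF (A : Fm α) : Fm α := fun d => (A d).not
def all (A : Tm α → Fm α) : Fm α := fun d => (A (bvar d) (d + 1)).all
def ex (A : Tm α → Fm α) : Fm α := fun d => (A (bvar d) (d + 1)).ex

end Combinators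

local infix:50 " ≐ " => eqF
local infixr:35 " ⋏ " => andF
local infixr:30 " ⋎ " => orF
local infixr:25 " ⇛ " => impF

/-- A relation symbol with `k` arguments, introduced by a defining formula. -/
def define {k : ℕ} (A : (Fin k → Tm (Fin k)) → Fm (Fin k)) : LA.Formula (Fin k) := A fvar 0

/-- The formula `R(t 0, …, t (k - 1))`. -/
def app {k : ℕ} {α : Type} (R : LA.Formula (Fin k)) (t : Fin k → Tm α) : Fm α := fun d =>
  BoundedFormula.relabel (k := 0) (id : α ⊕ Fin d → α ⊕ Fin d) (R.subst (fun i => t i d))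

/-- A formula without free variables, as a sentence. -/
def sentence (A : Fm Empty) : LA.Sentence := A 0

/-! ## Peano arithmetic -/

/-- The induction axiom for `φ(p₀, …, pₙ₋₁, x)`: the universal closure of
`φ(0) → ∀ x (φ(x) → φ(S x)) → ∀ x φ(x)`. -/
def induction {n : ℕ} (φ : LA.Formula (Fin (n + 1))) : LA.Sentence :=
  let Φ : Tm Empty → Fm Empty := fun x => app φ (Fin.snoc (fun i : Fin n => bvar i) x)
  BoundedFormula.alls (n := n)
    ((Φ 0 ⇛ (all fun x => Φ x ⇛ Φ (S x)) ⇛ all fun x => Φ x) n)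

/-- First-order Peano arithmetic. -/
inductive PA : LA.Theory
  | succ_ne_zero : PA (sentence (all fun x => notF (S x ≐ 0)))
  | succ_inj : PA (sentence (all fun x => all fun y => S x ≐ S y ⇛ x ≐ y))
  | add_zero : PA (sentence (all fun x => x + 0 ≐ x))
  | add_succ : PA (sentence (all fun x => all fun y => x + S y ≐ S (x + y)))
  | mul_zero : PA (sentence (all fun x => x * 0 ≐ 0))
  | mul_succ : PA (sentence (all fun x => all fun y => x * S y ≐ x * y + x))
  | induction {n : ℕ} (φ : LA.Formula (Fin (n + 1))) : PA (induction φ)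

/-! ## Order, pairs, finite sets and recursive definitions in arithmetic -/

section Arithmetic

variable {α : Type}

def leR : LA.Formula (Fin 2) := define fun v => ex fun z => v 0 + z ≐ v 1

/-- `x ≤ y`. -/
def le (x y : Tm α) : Fm α := app leR ![x, y]

def ltR : LA.Formula (Fin 2) := define fun v => ex fun z => v 0 + S z ≐ v 1

/-- `x < y`. -/
def lt (x y : Tm α) : Fm α := app ltR ![x, y]

/-- An injective pairing, used for codes: `⟨x, y⟩ = (x + y)² + x`. -/
def pr (x y : Tm α) : Tm α := (x + y) * (x + y) + x

/-- Triples. -/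
def tr (x y z : Tm α) : Tm α := pr x (pr y z)

/-- The triple `(a, b, c)` codes the finite set of all `x < c` such that `(x + 1) b + 1` divides
`a`.  Every set of numbers below `c` has such a code: let `b` be a multiple of `c!`, so that the
numbers `(x + 1) b + 1` with `x < c` are pairwise coprime, and let `a` be the product of those that
belong to elements of the set. -/
def memR : LA.Formula (Fin 4) :=
  define fun v => lt (v 0) (v 3) ⋏ ex fun q => q * S (S (v 0) * v 2) ≐ v 1

/-- `x` belongs to the finite set with the code `(a, b, c)`. -/
def mem (x a b c : Tm α) : Fm α := app memR ![x, a, b, c]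

/-- Inductive definitions.  `J X u` says that `u` is the conclusion of a rule, the premises of
which belong to `X`.  `derivable J t` says that `t` has a derivation by these rules: it belongs to
a finite set each element of which is the conclusion of a rule with all premises in this set.
(The rules considered below are well-founded: no conclusion is used in order to get itself.) -/
def derivable (J : (Tm α → Fm α) → Tm α → Fm α) (t : Tm α) : Fm α :=
  ex fun a => ex fun b => ex fun c =>
    mem t a b c ⋏ all fun u => mem u a b c ⇛ J (fun x => mem x a b c) u

end Arithmetic

/-! ## Primitive recursive functions in arithmetic

The primitive recursive functions `ℕ → ℕ` are generated as in Mathlib's `Nat.Primrec`, by means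
of the bijective pairing `Nat.pair`. -/

section PrimitiveRecursion

variable {α : Type}

def natPairR : LA.Formula (Fin 3) := define fun v =>
  (lt (v 0) (v 1) ⋏ v 2 ≐ v 1 * v 1 + v 0) ⋎ (le (v 1) (v 0) ⋏ v 2 ≐ v 0 * v 0 + v 0 + v 1)

/-- `z = Nat.pair x y`. -/
def natPair (x y z : Tm α) : Fm α := app natPairR ![x, y, z]

/-- The code of the constant function `0`. -/
def cZero : Tm α := tr (num 0) 0 0
/-- The code of the successor function. -/
def cSucc : Tm α := tr (num 1) 0 0
/-- The code of `Nat.pair x y ↦ x`. -/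
def cLeft : Tm α := tr (num 2) 0 0
/-- The code of `Nat.pair x y ↦ y`. -/
def cRight : Tm α := tr (num 3) 0 0
/-- The code of `x ↦ Nat.pair (f x) (g x)`. -/
def cPair (f g : Tm α) : Tm α := tr (num 4) f g
/-- The code of `x ↦ f (g x)`. -/
def cComp (f g : Tm α) : Tm α := tr (num 5) f g
/-- The code of the function `h` with `h (Nat.pair z 0) = f z` and
`h (Nat.pair z (n + 1)) = g (Nat.pair z (Nat.pair n (h (Nat.pair z n))))`. -/
def cPrec (f g : Tm α) : Tm α := tr (num 6) f g

def codeR : LA.Formula (Fin 1) := define fun v =>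
  derivable (fun X u =>
    u ≐ cZero ⋎ u ≐ cSucc ⋎ u ≐ cLeft ⋎ u ≐ cRight ⋎
    (ex fun f => ex fun g => X f ⋏ X g ⋏ (u ≐ cPair f g ⋎ u ≐ cComp f g ⋎ u ≐ cPrec f g)))
  (v 0)

/-- `e` is the code of a primitive recursive function. -/
def code (e : Tm α) : Fm α := app codeR ![e]

def evalR : LA.Formula (Fin 3) := define fun v =>
  derivable (fun X u =>
    (ex fun x => u ≐ tr cZero x 0) ⋎
    (ex fun x => u ≐ tr cSucc x (S x)) ⋎
    (ex fun x => ex fun y => ex fun z => natPair x y z ⋏ (u ≐ tr cLeft z x ⋎ u ≐ tr cRight z y)) ⋎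
    (ex fun f => ex fun g => ex fun x => ex fun y => ex fun z => ex fun w =>
      X (tr f x y) ⋏ X (tr g x z) ⋏ natPair y z w ⋏ u ≐ tr (cPair f g) x w) ⋎
    (ex fun f => ex fun g => ex fun x => ex fun y => ex fun z =>
      X (tr g x y) ⋏ X (tr f y z) ⋏ u ≐ tr (cComp f g) x z) ⋎
    (ex fun f => ex fun g => ex fun z => ex fun w => ex fun y =>
      natPair z 0 w ⋏ X (tr f z y) ⋏ u ≐ tr (cPrec f g) w y) ⋎
    (ex fun f => ex fun g => ex fun z => ex fun n => ex fun w => ex fun w' =>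
      ex fun i => ex fun p => ex fun q => ex fun y =>
        natPair z n w ⋏ natPair z (S n) w' ⋏ X (tr (cPrec f g) w i) ⋏
        natPair n i p ⋏ natPair z p q ⋏ X (tr g q y) ⋏ u ≐ tr (cPrec f g) w' y))
  (tr (v 0) (v 1) (v 2))

/-- The primitive recursive function with the code `e` takes the value `y` at `x`. -/
def eval (e x y : Tm α) : Fm α := app evalR ![e, x, y]

end PrimitiveRecursion

/-! ## Goodstein sequences in arithmetic -/

section Goodstein

variable {α : Type}

def powR : LA.Formula (Fin 3) := define fun v =>
  derivable (fun X u =>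
    u ≐ pr 0 (S 0) ⋎
    (ex fun n => ex fun y => X (pr n y) ⋏ u ≐ pr (S n) (y * v 0)))
  (pr (v 1) (v 2))

/-- `b ^ n = y`. -/
def pow (b n y : Tm α) : Fm α := app powR ![b, n, y]

/-- If `m = b ^ n * k + m'` with `0 < k < b` and `m' < b ^ n`, and if the base change takes `n` to
`n'` and `m'` to `r'`, then it takes `m` to `c ^ n' * k + r'`. -/
def baseChangeR : LA.Formula (Fin 4) := define fun v =>
  derivable (fun X u =>
    u ≐ pr 0 0 ⋎
    (ex fun n => ex fun k => ex fun m' => ex fun p => ex fun n' => ex fun r' => ex fun q =>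
      pow (v 0) n p ⋏ lt 0 k ⋏ lt k (v 0) ⋏ lt m' p ⋏
      X (pr n n') ⋏ X (pr m' r') ⋏ pow (v 1) n' q ⋏
      u ≐ pr (p * k + m') (q * k + r')))
  (pr (v 2) (v 3))

/-- `r` results from `m` if the base `b` is everywhere replaced by `c` in the complete
`b`-representation of `m`. -/
def baseChange (b c m r : Tm α) : Fm α := app baseChangeR ![b, c, m, r]

def goodsteinR : LA.Formula (Fin 4) := define fun v =>
  derivable (fun X u =>
    u ≐ pr 0 (v 1) ⋎
    (ex fun i => ex fun x => ex fun b => ex fun c => ex fun z => ex fun y =>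
      X (pr i x) ⋏ eval (v 0) i b ⋏ eval (v 0) (S i) c ⋏ baseChange b c x z ⋏
      (z ≐ S y ⋎ (z ≐ 0 ⋏ y ≐ 0)) ⋏ u ≐ pr (S i) y))
  (pr (v 2) (v 3))

/-- The `i`-th term of the Goodstein sequence that starts with `m` and uses the bases
`f 0, f 1, …`, where `f` is the primitive recursive function with the code `e`, is `y`. -/
def goodstein (e m i y : Tm α) : Fm α := app goodsteinR ![e, m, i, y]

/-- `e` is the code of a primitive recursive function `f` which is non-decreasing and has
`f 0 ≥ 2`. -/
def admissible (e : Tm α) : Fm α :=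
  code e ⋏ (all fun x => eval e 0 x ⇛ le (num 2) x) ⋏
    all fun i => all fun x => all fun y => (eval e i x ⋏ eval e (S i) y) ⇛ le x y

end Goodstein

/-! ## Ordinals below `ε₀` in arithmetic -/

section Ordinals

variable {α : Type}

/-- The code of `ω ^ e * k + r`; the code of the ordinal `0` is `0`. -/
def cnf (e k r : Tm α) : Tm α := S (tr e k r)

def ordLtR : LA.Formula (Fin 2) := define fun v =>
  derivable (fun X u =>
    (ex fun e => ex fun k => ex fun r => u ≐ pr 0 (cnf e k r)) ⋎
    (ex fun e => ex fun k => ex fun r => ex fun e' => ex fun k' => ex fun r' =>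
      (X (pr e e') ⋎ (e ≐ e' ⋏ lt k k') ⋎ (e ≐ e' ⋏ k ≐ k' ⋏ X (pr r r'))) ⋏
      u ≐ pr (cnf e k r) (cnf e' k' r')))
  (pr (v 0) (v 1))

/-- The order of ordinals in complete Cantor normal form: lexicographic comparison of the
exponents and coefficients, from the leading term on. -/
def ordLt (x y : Tm α) : Fm α := app ordLtR ![x, y]

def ordR : LA.Formula (Fin 1) := define fun v =>
  derivable (fun X u =>
    u ≐ 0 ⋎
    (ex fun e => ex fun k => ex fun r =>
      X e ⋏ lt 0 k ⋏ X r ⋏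
      (r ≐ 0 ⋎ ex fun e' => ex fun k' => ex fun r' => r ≐ cnf e' k' r' ⋏ ordLt e' e) ⋏
      u ≐ cnf e k r))
  (v 0)

/-- `x` is the code of an ordinal below `ε₀` in complete Cantor normal form. -/
def ord (x : Tm α) : Fm α := app ordR ![x]

end Ordinals

/-! ## The two statements -/

/-- Every primitive recursive Goodstein sequence terminates: for every primitive recursive
non-decreasing `f` with `f 0 ≥ 2` and every starting point `m` there is `k` such that the
`i`-th term is `0` for all `i ≥ k`. -/
def goodsteinTermination : LA.Sentence := sentence (
  all fun e => admissible e ⇛ all fun m => ex fun k => all fun i => le k i ⇛ goodstein e m i 0)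

/-- There is no primitive recursive infinite strictly descending sequence of ordinals below
`ε₀`. -/
def noDescent : LA.Sentence := sentence (
  notF (ex fun e => code e ⋏ all fun n => ex fun x => ex fun y =>
    eval e n x ⋏ eval e (S n) y ⋏ ord x ⋏ ord y ⋏ ordLt y x))

end GoodsteinPA

/-!
The proof is semantic.  By the completeness of the calculus (`provable_of_models`, a Henkin
construction) it suffices to show the equivalence in an arbitrary model `M` of Peano arithmetic,
in which the only tool is induction for predicates definable with parameters (`pa_induction`).
Definability is established by instance search for the classes `Dfn` and `DfnFun`.

In `M`, bounded definable predicates are coded by finite sets (`coded_of_bounded`), hence the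
inductive definitions by which all notions are formalized have the expected fixed point property
(`BinaryRules.derivable_iff`).  Thus the codes evaluate to total functions
(`Code.exists_computes`), and the class `PR` of functions `M → M` with a code, which may be
nonstandard, contains the successor and the projections and is closed under composition and
primitive recursion.

The link between numbers and ordinals is `toOrd b m`, the ordinal that results from `m` if the base
`b` of the complete representation is replaced by `ω`.  It is strictly increasing in `m`
(`toOrd_lt_toOrd`), it does not change under a change of base (`toOrd_shift`), and every ordinal
below `ε₀` whose code is less than `b` is of this form (`exists_toOrd_eq`).  Both `toOrd` and the
change of base are primitive recursive (`exists_pr_base_recursion`).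

* If a Goodstein sequence with bases `f i` and terms `g i` never vanishes, then the ordinals
  `toOrd (f i) (g i)` form a primitive recursive descending sequence, since the step from `g i` to
  `g (i + 1)` keeps the ordinal and then subtracts one (`goodstein_terminates`).
* Conversely, let the ordinals `α i` descend primitive recursively.  With the bases
  `f i = 2 + α 0 + ⋯ + α i`, each `α i` is `toOrd (f i) a` for some `a`, and the Goodstein sequence
  that starts with this number for `i = 0` has `i`-th term at least `a`, by induction on `i`.  So
  when it reaches `0`, the ordinal `α i` is `0` and has no successor in the sequence
  (`no_descent`).
-/

namespace GoodsteinPA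

open FirstOrder.Language

/-! ### Completeness of the calculus -/

section Completeness

variable {L : FirstOrder.Language.{0, 0}}

/-- The number of connectives and quantifiers of a formula. -/
def complexity {α : Type} : ∀ {n}, L.BoundedFormula α n → ℕ
  | _, .falsum => 0
  | _, .equal _ _ => 0
  | _, .rel _ _ => 0
  | _, .imp φ ψ => complexity φ + complexity ψ + 1
  | _, .all φ => complexity φ + 1

theorem complexity_castLE {α : Type} {m n : ℕ} (h : m = n) (φ : L.BoundedFormula α m) :
    complexity (φ.castLE h.le) = complexity φ := by
  subst h; simp

theorem complexity_mapTermRel {α β : Type} {g : ℕ → ℕ}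
    (ft : ∀ n, L.Term (α ⊕ (Fin n)) → L.Term (β ⊕ (Fin (g n))))
    (fr : ∀ n, L.Relations n → L.Relations n)
    (h : ∀ n, L.BoundedFormula β (g (n + 1)) → L.BoundedFormula β (g n + 1))
    (hh : ∀ n φ, complexity (h n φ) = complexity φ) {n : ℕ} (φ : L.BoundedFormula α n) :
    complexity (φ.mapTermRel ft fr h) = complexity φ := by
  induction φ with
  | falsum => rfl
  | equal => rfl
  | rel => rfl
  | imp _ _ ih₁ ih₂ => simp [BoundedFormula.mapTermRel, complexity, ih₁, ih₂]
  | all _ ih => simp [BoundedFormula.mapTermRel, complexity, ih, hh]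

theorem complexity_toFormula {α : Type} {n : ℕ} (φ : L.BoundedFormula α n) :
    complexity φ.toFormula = complexity φ := by
  induction φ with
  | falsum => rfl
  | equal => rfl
  | rel => rfl
  | imp _ _ ih₁ ih₂ => exact congrArg₂ (fun a b => a + b + 1) ih₁ ih₂
  | all φ ih =>
    exact congrArg (· + 1) ((complexity_mapTermRel _ _ _
      (fun n φ => complexity_castLE (by omega : 1 + (n + 1) = 1 + n + 1) φ) _).trans ih)

theorem complexity_inst (φ : L.BoundedFormula ℕ 1) (t : L.Term ℕ) :
    complexity (inst φ t) = complexity φ := by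
  unfold inst BoundedFormula.subst
  rw [complexity_mapTermRel (g := id) _ _ (fun _ => id) (fun _ _ => rfl)]
  exact complexity_toFormula φ

/-- The simultaneous substitution behind `inst`, on terms. -/
abbrev instTerm (s : L.Term (ℕ ⊕ Fin 1)) (t : L.Term ℕ) : L.Term ℕ :=
  s.subst (Sum.elim Term.var fun _ => t)

theorem relabel_subst_inl (s : L.Term (ℕ ⊕ Fin 1)) (t : L.Term ℕ) :
    (s.relabel Sum.inl).subst (Sum.elim (Term.relabel Sum.inl ∘
      (Sum.elim Term.var fun _ => t : ℕ ⊕ Fin 1 → L.Term ℕ)) (Term.var ∘ Sum.inr)) =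
      ((instTerm s t).relabel Sum.inl : L.Term (ℕ ⊕ Fin 0)) := by
  induction s with
  | var x => rcases x with x | x <;> rfl
  | func f ts ih => simp only [Term.relabel, Term.subst, ih]

theorem inst_equal (s₁ s₂ : L.Term (ℕ ⊕ Fin 1)) (t : L.Term ℕ) :
    inst (s₁.bdEqual s₂) t = (instTerm s₁ t).equal (instTerm s₂ t) := by
  refine congrArg₂ BoundedFormula.equal ?_ ?_ <;> exact relabel_subst_inl _ _

theorem inst_rel {n : ℕ} (R : L.Relations n) (ts : Fin n → L.Term (ℕ ⊕ Fin 1)) (t : L.Term ℕ) :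
    inst (R.boundedFormula ts) t = R.formula fun i => instTerm (ts i) t :=
  congrArg (BoundedFormula.rel R) (funext fun _ => relabel_subst_inl _ _)

theorem realize_inst {M : Type} [L.Structure M] (φ : L.BoundedFormula ℕ 1) (t : L.Term ℕ)
    (v : ℕ → M) : (inst φ t).Realize v ↔ φ.Realize v (fun _ => t.realize v) := by
  unfold inst Formula.Realize
  rw [BoundedFormula.realize_subst]
  exact (BoundedFormula.realize_toFormula φ _)

theorem realize_embed {M : Type} [L.Structure M] (φ : L.Sentence) (v : ℕ → M) :
    (embed φ).Realize v ↔ M ⊨ φ := by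
  unfold embed
  rw [Formula.realize_relabel]
  exact iff_of_eq (congrArg _ (Subsingleton.elim _ _))

/-- A list of assumptions from which no contradiction is derivable. -/
def Consistent (T : L.Theory) (Γ : List (L.Formula ℕ)) : Prop := ¬ Derives T Γ ⊥

theorem Consistent.cons_not {T : L.Theory} {Γ : List (L.Formula ℕ)} (h : Consistent T Γ)
    {ψ : L.Formula ℕ} (hψ : ¬ Consistent T (ψ :: Γ)) : Consistent T (ψ.not :: Γ) := fun h' =>
  h (.imp_elim _ _ (.imp_intro _ _ (not_not.1 hψ)) (.raa _ h'))

theorem Derives.absurd {T : L.Theory} {Γ : List (L.Formula ℕ)} {φ : L.Formula ℕ} (h : φ ∈ Γ)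
    (h' : φ.not ∈ Γ) : Derives T Γ ⊥ :=
  .imp_elim φ ⊥ (.hyp φ.not h') (.hyp φ h)

theorem exists_fresh (Γ : List (L.Formula ℕ)) : ∃ a, ∀ ψ ∈ Γ, a ∉ ψ.freeVarFinset := by
  classical
  obtain ⟨a, ha⟩ := Infinite.exists_notMem_finset (Γ.toFinset.biUnion fun ψ => ψ.freeVarFinset)
  exact ⟨a, fun ψ hψ h => ha (Finset.mem_biUnion.2 ⟨ψ, by simpa using hψ, h⟩)⟩

/-- One step of the Henkin construction decides `ψ` and, if `ψ` is a universal formula that gets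
refuted, adds a counterexample. -/
theorem exists_henkin_step {T : L.Theory} {Γ : List (L.Formula ℕ)} (h : Consistent T Γ)
    (ψ : L.Formula ℕ) : ∃ Δ, Γ ⊆ Δ ∧ Consistent T Δ ∧ (ψ ∈ Δ ∨ (ψ.not ∈ Δ ∧
      ∀ φ : L.BoundedFormula ℕ 1, ψ = φ.all → ∃ t, (inst φ t).not ∈ Δ)) := by
  by_cases hψ : Consistent T (ψ :: Γ)
  · exact ⟨ψ :: Γ, by simp, hψ, by simp⟩
  have h' := h.cons_not hψ
  by_cases hφ : ∃ φ : L.BoundedFormula ℕ 1, ψ = φ.all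
  · obtain ⟨φ, rfl⟩ := hφ
    obtain ⟨a, ha⟩ := exists_fresh (Formula.not φ.all :: Γ)
    refine ⟨(inst φ (Term.var a)).not :: Formula.not φ.all :: Γ, by simp, fun hd => h' ?_,
      Or.inr ⟨by simp, ?_⟩⟩
    · refine .imp_elim _ _ (.hyp (Formula.not φ.all) (by simp)) (.all_intro φ a ha ?_ (.raa _ hd))
      have := ha _ List.mem_cons_self
      intro h1
      exact this (Finset.mem_union_left _ h1)
    · intro φ' e
      cases e
      exact ⟨Term.var a, by simp⟩
  · exact ⟨ψ.not :: Γ, by simp, h', Or.inr ⟨by simp, fun φ e => (hφ ⟨φ, e⟩).elim⟩⟩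

/-- A complete set of formulas with counterexamples for refuted universal formulas, every finite
part of which is contained in a consistent list. -/
structure IsHenkin (T : L.Theory) (H : Set (L.Formula ℕ)) : Prop where
  fin : ∀ l : List (L.Formula ℕ), (∀ φ ∈ l, φ ∈ H) → ∃ Γ, l ⊆ Γ ∧ Consistent T Γ
  complete : ∀ φ, φ ∈ H ∨ φ.not ∈ H
  witness : ∀ φ : L.BoundedFormula ℕ 1, Formula.not φ.all ∈ H → ∃ t, (inst φ t).not ∈ H

theorem exists_isHenkin [Countable (L.Formula ℕ)] {T : L.Theory} {ψ : L.Formula ℕ}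
    (h : Consistent T [ψ]) : ∃ H, IsHenkin T H ∧ ψ ∈ H := by
  have : Nonempty (L.Formula ℕ) := ⟨ψ⟩
  obtain ⟨enum, henum⟩ := exists_surjective_nat (L.Formula ℕ)
  choose! step hsub hcons hdec using
    fun (Γ : List (L.Formula ℕ)) (h : Consistent T Γ) ψ => exists_henkin_step h ψ
  let chain : ℕ → List (L.Formula ℕ) := fun n => n.rec [ψ] fun n Γ => step Γ (enum n)
  have hchain : ∀ n, Consistent T (chain n) := fun n => by
    induction n with
    | zero => exact h
    | succ n ih => exact hcons _ ih _
  have hmono : Monotone fun n => {φ | φ ∈ chain n} :=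
    monotone_nat_of_le_succ fun n φ hφ => hsub _ (hchain n) _ hφ
  have hfin : ∀ l : List (L.Formula ℕ), (∀ φ ∈ l, ∃ n, φ ∈ chain n) → ∃ n, l ⊆ chain n := by
    intro l
    induction l with
    | nil => exact fun _ => ⟨0, by simp⟩
    | cons φ l ih =>
      intro hl
      obtain ⟨n, hn⟩ := ih fun φ hφ => hl φ (List.mem_cons_of_mem _ hφ)
      obtain ⟨m, hm⟩ := hl φ List.mem_cons_self
      refine ⟨max m n, List.cons_subset.2 ⟨hmono (le_max_left m n) hm, fun χ hχ =>
        hmono (le_max_right m n) (hn hχ)⟩⟩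
  have hcons : ∀ φ, ¬ ((∃ n, φ ∈ chain n) ∧ ∃ n, φ.not ∈ chain n) := by
    rintro φ ⟨h1, h2⟩
    obtain ⟨n, hn⟩ := hfin [φ, φ.not] (by simp [h1, h2])
    exact hchain n (.absurd (φ := φ) (hn (by simp)) (hn (by simp)))
  refine ⟨{φ | ∃ n, φ ∈ chain n}, ⟨fun l hl => ?_, fun φ => ?_, fun φ hφ => ?_⟩, 0, by
    simp [chain]⟩
  · obtain ⟨n, hn⟩ := hfin l hl
    exact ⟨_, hn, hchain n⟩
  · obtain ⟨n, rfl⟩ := henum φ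
    rcases hdec (chain n) (hchain n) (enum n) with h | ⟨h, -⟩
    exacts [Or.inl ⟨n + 1, h⟩, Or.inr ⟨n + 1, h⟩]
  · obtain ⟨n, hn⟩ := henum φ.all
    rcases hdec (chain n) (hchain n) (enum n) with h | ⟨h, h'⟩
    · exact (hcons φ.all ⟨⟨n + 1, hn ▸ h⟩, hφ⟩).elim
    · obtain ⟨t, ht⟩ := h' φ hn
      exact ⟨t, n + 1, ht⟩

namespace IsHenkin

variable {T : L.Theory} {H : Set (L.Formula ℕ)}

/-- `H` is closed under those derivations that can be carried out from every list of assumptions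
that contains given elements of `H`. -/
theorem closed (hH : IsHenkin T H) (l : List (L.Formula ℕ)) (hl : ∀ φ ∈ l, φ ∈ H)
    {ψ : L.Formula ℕ} (h : ∀ Γ, l ⊆ Γ → Derives T Γ ψ) : ψ ∈ H := by
  refine (hH.complete ψ).resolve_right fun hn => ?_
  obtain ⟨Γ, hΓ, hc⟩ := hH.fin (ψ.not :: l) (by simpa [hn] using hl)
  rw [List.cons_subset] at hΓ
  exact hc (.imp_elim ψ _ (.hyp _ hΓ.1) (h Γ hΓ.2))

theorem not_mem_iff (hH : IsHenkin T H) {φ : L.Formula ℕ} : φ.not ∈ H ↔ φ ∉ H := by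
  refine ⟨fun h1 h2 => ?_, (hH.complete φ).resolve_left⟩
  obtain ⟨Γ, hΓ, hc⟩ := hH.fin [φ, φ.not] (by simp [h1, h2])
  exact hc (.absurd (φ := φ) (hΓ (by simp)) (hΓ (by simp)))

theorem bot_notMem (hH : IsHenkin T H) : (⊥ : L.Formula ℕ) ∉ H := fun h => by
  obtain ⟨Γ, hΓ, hc⟩ := hH.fin [⊥] (by simp [h])
  exact hc (.hyp _ (hΓ (by simp)))

theorem imp_mem_iff (hH : IsHenkin T H) {φ ψ : L.Formula ℕ} :
    φ.imp ψ ∈ H ↔ (φ ∈ H → ψ ∈ H) := by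
  refine ⟨fun h1 h2 => hH.closed [φ.imp ψ, φ] (by simp [h1, h2]) fun Γ hΓ =>
    .imp_elim φ ψ (.hyp _ (hΓ (by simp))) (.hyp _ (hΓ (by simp))), fun h => ?_⟩
  by_cases hφ : φ ∈ H
  · exact hH.closed [ψ] (by simpa using h hφ) fun Γ hΓ =>
      .imp_intro _ _ (.hyp _ (List.mem_cons_of_mem _ (hΓ (by simp))))
  · exact hH.closed [φ.not] (by simpa using hH.not_mem_iff.2 hφ) fun Γ hΓ =>
      .imp_intro _ _ (.raa _ (.absurd (φ := φ) (by simp)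
        (List.mem_cons_of_mem _ (List.mem_cons_of_mem _ (hΓ (by simp))))))

theorem all_mem_iff (hH : IsHenkin T H) {φ : L.BoundedFormula ℕ 1} :
    (φ.all : L.Formula ℕ) ∈ H ↔ ∀ t, inst φ t ∈ H := by
  refine ⟨fun h t => hH.closed [φ.all] (by simpa using h) fun Γ hΓ =>
    .all_elim φ t (.hyp _ (hΓ (by simp))), fun h => (hH.complete _).resolve_right fun hn => ?_⟩
  obtain ⟨t, ht⟩ := hH.witness φ hn
  exact hH.not_mem_iff.1 ht (h t)

theorem subst_mem (hH : IsHenkin T H) (φ : L.BoundedFormula ℕ 1) {s t : L.Term ℕ}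
    (h : s.equal t ∈ H) (hs : inst φ s ∈ H) : inst φ t ∈ H :=
  hH.closed [s.equal t, inst φ s] (by simp [h, hs]) fun Γ hΓ =>
    .eq_subst φ s t (.hyp _ (hΓ (by simp))) (.hyp _ (hΓ (by simp)))

theorem instTerm_inl (s t : L.Term ℕ) : instTerm (s.relabel Sum.inl) t = s := by
  induction s with
  | var x => rfl
  | func f ts ih => simp only [instTerm, Term.relabel, Term.subst] at ih ⊢; simp [ih]

theorem equal_refl_mem (hH : IsHenkin T H) (t : L.Term ℕ) : t.equal t ∈ H :=
  hH.closed [] (by simp) fun _ _ => .eq_refl t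

/-- Provable equality in `H`, as a setoid on terms. -/
def setoid (hH : IsHenkin T H) : Setoid (L.Term ℕ) where
  r s t := s.equal t ∈ H
  iseqv := by
    have symm : ∀ {s t : L.Term ℕ}, s.equal t ∈ H → t.equal s ∈ H := fun {s t} h => by
      have := hH.subst_mem ((Term.var (Sum.inr 0)).bdEqual (s.relabel Sum.inl)) h
      rw [inst_equal, inst_equal, instTerm_inl, instTerm_inl] at this
      exact this (hH.equal_refl_mem s)
    refine ⟨hH.equal_refl_mem, symm, fun {s t u} h1 h2 => ?_⟩
    have := hH.subst_mem ((s.relabel Sum.inl).bdEqual (Term.var (Sum.inr 0))) h2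
    rw [inst_equal, inst_equal, instTerm_inl, instTerm_inl] at this
    exact this h1

/-- A property of tuples of terms that is stable under replacing one entry by an equal term is
stable under replacing all of them. -/
theorem congr_tuple (_ : IsHenkin T H) {n : ℕ} (Q : (Fin n → L.Term ℕ) → Prop)
    (hQ : ∀ ts i t, (ts i).equal t ∈ H → Q ts → Q (Function.update ts i t))
    {ts us : Fin n → L.Term ℕ} (h : ∀ i, (ts i).equal (us i) ∈ H) (hts : Q ts) : Q us := by
  have key : ∀ s : Finset (Fin n), Q (fun i => if i ∈ s then us i else ts i) := by
    intro s
    induction s using Finset.induction_on with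
    | empty => simpa using hts
    | insert i s hi ih =>
      have := hQ _ i (us i) (by simpa [hi] using h i) ih
      convert this using 1
      funext j
      by_cases hj : j = i
      · subst hj; simp
      · simp [hj, Function.update_of_ne]
  simpa using key Finset.univ

theorem instTerm_update {n : ℕ} (ts : Fin n → L.Term ℕ) (i : Fin n) (t : L.Term ℕ) :
    (fun j => instTerm (Function.update (fun j => (ts j).relabel Sum.inl) i
      (Term.var (Sum.inr 0)) j) t) = Function.update ts i t := by
  funext j
  by_cases hj : j = i
  · subst hj; simp
  · simp only [Function.update_of_ne hj, instTerm_inl]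

theorem rel_congr (hH : IsHenkin T H) {n : ℕ} (R : L.Relations n) {ts us : Fin n → L.Term ℕ}
    (h : ∀ i, (ts i).equal (us i) ∈ H) (hts : R.formula ts ∈ H) : R.formula us ∈ H := by
  refine hH.congr_tuple (fun ts => R.formula ts ∈ H) (fun ts i t h h' => ?_) h hts
  have := hH.subst_mem (R.boundedFormula (Function.update (fun j => (ts j).relabel Sum.inl) i
      (Term.var (Sum.inr 0)))) h
  rw [inst_rel, inst_rel, instTerm_update, instTerm_update, Function.update_eq_self] at this
  exact this h'

theorem func_congr (hH : IsHenkin T H) {n : ℕ} (f : L.Functions n) {ts us : Fin n → L.Term ℕ}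
    (h : ∀ i, (ts i).equal (us i) ∈ H) : (Term.func f ts).equal (Term.func f us) ∈ H := by
  refine hH.congr_tuple (fun us => (Term.func f ts).equal (Term.func f us) ∈ H)
    (fun us i t h h' => ?_) h (hH.equal_refl_mem _)
  have := hH.subst_mem (((Term.func f ts).relabel Sum.inl).bdEqual
    (Term.func f (Function.update (fun j => (us j).relabel Sum.inl) i
      (Term.var (Sum.inr 0))))) h
  rw [inst_equal, inst_equal, instTerm_inl, instTerm_inl] at this
  have e : ∀ t, instTerm (Term.func f (Function.update (fun j => (us j).relabel Sum.inl) i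
      (Term.var (Sum.inr 0)))) t = Term.func f (Function.update us i t) := fun t =>
    congrArg (Term.func f) (instTerm_update us i t)
  rw [e, e, Function.update_eq_self] at this
  exact this h'

/-- The term model of a Henkin set. -/
def Model (hH : IsHenkin T H) : Type := Quotient hH.setoid

/-- The class of a term. -/
def cls (hH : IsHenkin T H) (t : L.Term ℕ) : hH.Model := Quotient.mk hH.setoid t

/-- A representative. -/
noncomputable def rep (hH : IsHenkin T H) (x : hH.Model) : L.Term ℕ := Quotient.out x

/-- Every variable denotes its own class. -/
def val (hH : IsHenkin T H) (n : ℕ) : hH.Model := hH.cls (Term.var n)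

theorem cls_eq_cls (hH : IsHenkin T H) {s t : L.Term ℕ} : hH.cls s = hH.cls t ↔ s.equal t ∈ H :=
  Quotient.eq (r := hH.setoid)

theorem cls_rep (hH : IsHenkin T H) (x : hH.Model) : hH.cls (hH.rep x) = x := Quotient.out_eq x

noncomputable instance (hH : IsHenkin T H) : L.Structure hH.Model where
  funMap f xs := hH.cls (Term.func f fun i => hH.rep (xs i))
  RelMap R xs := R.formula (fun i => hH.rep (xs i)) ∈ H

theorem rep_cls_equal (hH : IsHenkin T H) (t : L.Term ℕ) : (hH.rep (hH.cls t)).equal t ∈ H :=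
  hH.cls_eq_cls.1 (hH.cls_rep _)

theorem realize_term (hH : IsHenkin T H) (t : L.Term ℕ) :
    t.realize hH.val = hH.cls t := by
  induction t with
  | var => rfl
  | func f ts ih =>
    rw [Term.realize_func]
    refine hH.cls_eq_cls.2 (hH.func_congr f fun i => ?_)
    simp only [ih]
    exact hH.rep_cls_equal _

/-- A formula is true in the term model if and only if it belongs to `H`. -/
theorem realize_iff_mem (hH : IsHenkin T H) (φ : L.Formula ℕ) :
    φ.Realize hH.val ↔ φ ∈ H := by
  have strip : ∀ t : L.Term (ℕ ⊕ Fin 0), ∃ s : L.Term ℕ, t = s.relabel Sum.inl := fun t =>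
    ⟨t.relabel (Sum.elim id finZeroElim), by
      rw [Term.relabel_relabel]
      conv_lhs => rw [← t.relabel_id]
      congr 1
      funext x
      rcases x with x | x
      exacts [rfl, x.elim0]⟩
  suffices ∀ k, ∀ φ : L.Formula ℕ, complexity φ ≤ k →
      (φ.Realize hH.val ↔ φ ∈ H) from
    this _ φ le_rfl
  intro k
  induction k with
  | zero =>
    intro φ hφ
    cases φ with
    | falsum => exact ⟨fun h => h.elim, fun h => (hH.bot_notMem h).elim⟩
    | equal t₁ t₂ =>
      obtain ⟨s₁, rfl⟩ := strip t₁
      obtain ⟨s₂, rfl⟩ := strip t₂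
      refine (Formula.realize_equal (t₁ := s₁) (t₂ := s₂) (x := hH.val)).trans ?_
      rw [realize_term, realize_term]
      exact hH.cls_eq_cls
    | rel R ts =>
      choose ss hss using fun i => strip (ts i)
      obtain rfl : ts = fun i => (ss i).relabel Sum.inl := funext hss
      refine (Formula.realize_rel (R := R) (ts := ss) (v := hH.val)).trans ?_
      simp only [realize_term]
      exact ⟨hH.rel_congr R fun i => hH.rep_cls_equal _, hH.rel_congr R fun i =>
        hH.cls_eq_cls.1 (hH.cls_rep _).symm⟩
    | imp _ _ => simp [complexity] at hφ
    | all _ => simp [complexity] at hφ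
  | succ k ih =>
    intro φ hφ
    rcases Nat.lt_or_ge (complexity φ) (k + 1) with hk | hk
    · exact ih φ (by omega)
    cases φ with
    | falsum => simp [complexity] at hk
    | equal _ _ => simp [complexity] at hk
    | rel _ _ => simp [complexity] at hk
    | imp φ ψ =>
      simp only [complexity] at hφ
      have := hH.imp_mem_iff (φ := φ) (ψ := ψ)
      refine Iff.trans ?_ this.symm
      rw [← ih φ (by omega), ← ih ψ (by omega)]
      exact Formula.realize_imp
    | all φ =>
      simp only [complexity] at hφ
      refine Iff.trans ?_ (hH.all_mem_iff (φ := φ)).symm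
      have hi : ∀ t, inst φ t ∈ H ↔ _ := fun t =>
        (ih (inst φ t) (by rw [complexity_inst]; omega)).symm.trans
          (realize_inst φ t _)
      have hsnoc : ∀ a : hH.Model,
          (Fin.snoc default a : Fin 1 → hH.Model) = fun _ => a := fun a => by
        funext i
        obtain rfl : i = Fin.last 0 := Subsingleton.elim (α := Fin 1) _ _
        exact Fin.snoc_last ..
      simp only [hi, realize_term]
      refine Iff.trans BoundedFormula.realize_all ⟨fun h t => ?_, fun h a => ?_⟩
      · rw [← hsnoc]
        exact h _
      · rw [hsnoc, ← hH.cls_rep a]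
        exact h _

end IsHenkin

/-- Gödel's completeness theorem for countable languages. -/
theorem provable_of_models [Countable (L.Formula ℕ)] {T : L.Theory} {φ : L.Sentence}
    (h : ∀ (M : Type) [L.Structure M] [Nonempty M], M ⊨ T → M ⊨ φ) : Provable T φ := by
  by_contra hφ
  obtain ⟨H, hH, hmem⟩ := exists_isHenkin (T := T) (ψ := (embed φ).not)
    fun hd => hφ (.raa _ hd)
  have : Nonempty hH.Model := ⟨hH.cls (Term.var 0)⟩
  have hT : hH.Model ⊨ T := Theory.model_iff _ |>.2 fun ψ hψ =>
    (realize_embed ψ _).1 ((hH.realize_iff_mem _).2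
      (hH.closed [] (by simp) fun Γ _ => .axm ψ hψ))
  have := (hH.realize_iff_mem _).2 hmem
  exact this ((realize_embed φ _).2 (h hH.Model hT))

end Completeness

instance : Countable (LA.Formula ℕ) := by
  have h1 : Countable (Σ n, LA.Functions n) := by
    refine (Function.Injective.countable (f := fun x : Σ n, LA.Functions n =>
      match x with
      | ⟨_, .zero⟩ => 0
      | ⟨_, .succ⟩ => 1
      | ⟨_, .add⟩ => 2
      | ⟨_, .mul⟩ => (3 : ℕ)) ?_)
    rintro ⟨_, _ | _⟩ ⟨_, _ | _⟩ h <;> simp at h ⊢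
  have h2 : Countable (Σ n, LA.Relations n) := ⟨fun x => x.2.elim, fun x => x.2.elim⟩
  have hL : LA.card ≤ Cardinal.aleph0 := by
    have : Countable LA.Symbols := by unfold FirstOrder.Language.Symbols; infer_instance
    exact Cardinal.mk_le_aleph0_iff.2 inferInstance
  have h3 : Countable (Σ n, LA.BoundedFormula ℕ n) := by
    rw [← Cardinal.mk_le_aleph0_iff]
    refine BoundedFormula.card_le.trans (max_le le_rfl ?_)
    simpa using hL
  exact Function.Injective.countable (f := fun φ : LA.Formula ℕ =>
    (⟨0, φ⟩ : Σ n, LA.BoundedFormula ℕ n)) fun _ _ h => by simpa using h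

/-! ### Definable predicates and functions of a model -/

section Definability

/-- A type `E` of environments: its elements assign values in `M` to the variables from `Idx`. -/
class Env (M : Type) (E : Type) where
  /-- The variables. -/
  Idx : Type
  /-- The value of a variable in an environment. -/
  get : Idx → E → M

instance Env.self (M : Type) : Env M M := ⟨Unit, fun _ => id⟩

instance Env.prod (M E : Type) [Env M E] : Env M (E × M) :=
  ⟨Option (Env.Idx M E), fun i e => i.elim e.2 fun j => Env.get j e.1⟩

variable {M : Type} [LA.Structure M]

variable (M) in
/-- The predicate `P` on environments is definable with parameters from `M`.  This is a class in
order that instance search can establish definability from the shape of `P`. -/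
class Dfn {E : Type} [Env M E] (P : E → Prop) : Prop where
  exists_formula : ∃ φ : LA.Formula (M ⊕ Env.Idx M E),
    ∀ e, P e ↔ φ.Realize (Sum.elim id fun i => Env.get i e)

/-- The function `f` on environments is definable with parameters: its graph is. -/
class DfnFun {E : Type} [Env M E] (f : E → M) : Prop where
  graph : Dfn M fun p : E × M => p.2 = f p.1

variable (M) in
/-- The map `g` forgets variables. -/
class Forget {E E' : Type} [Env M E] [Env M E'] (g : E → E') : Prop where
  exists_idx : ∃ σ : Env.Idx M E' → Env.Idx M E, ∀ i e, (Env.get i (g e) : M) = Env.get (σ i) e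

variable {E E' : Type} [Env M E] [Env M E']

instance Forget.id : Forget M (fun e : E => e) := ⟨_root_.id, fun _ _ => rfl⟩

instance Forget.fst (g : E → E' × M) [h : Forget M g] : Forget M (fun e => (g e).1) :=
  let ⟨σ, hσ⟩ := h.exists_idx
  ⟨fun i => σ (some i), fun i e => hσ (some i) e⟩

theorem Dfn.of_iff {P Q : E → Prop} (hP : Dfn M P) (h : ∀ e, Q e ↔ P e) : Dfn M Q := by
  rwa [show Q = P from funext fun e => propext (h e)]

theorem Dfn.forget {P : E' → Prop} (hP : Dfn M P) (g : E → E') [h : Forget M g] :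
    Dfn M fun e => P (g e) := by
  obtain ⟨φ, hφ⟩ := hP
  obtain ⟨σ, hσ⟩ := h.exists_idx
  refine ⟨φ.relabel (Sum.map _root_.id σ), fun e => ?_⟩
  rw [hφ, Formula.realize_relabel]
  refine iff_of_eq (congrArg _ (funext fun x => ?_))
  rcases x with x | x
  exacts [rfl, hσ x e]

theorem DfnFun.forget {f : E' → M} (hf : DfnFun f) (g : E → E') [h : Forget M g] :
    DfnFun fun e => f (g e) := by
  have : Forget M (fun p : E × M => (g p.1, p.2)) := by
    obtain ⟨σ, hσ⟩ := h.exists_idx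
    refine ⟨fun i => i.elim none fun j => some (σ j), fun i e => ?_⟩
    rcases i with _ | i
    exacts [rfl, hσ i e.1]
  exact ⟨hf.graph.forget (fun p : E × M => (g p.1, p.2))⟩

-- Abstractions in the instances below are not indexed: the goals contain them in eta-reduced form,
-- which the index would not match.
instance Dfn.not (P : E → Prop) [h : Dfn M P] : Dfn M (no_index (fun e => ¬ P e)) :=
  let ⟨φ, hφ⟩ := h
  ⟨φ.not, fun e => by rw [Formula.realize_not, hφ]⟩

instance Dfn.and (P Q : E → Prop) [h : Dfn M P] [h' : Dfn M Q] :
    Dfn M (no_index (fun e => P e ∧ Q e)) :=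
  let ⟨φ, hφ⟩ := h
  let ⟨ψ, hψ⟩ := h'
  ⟨φ ⊓ ψ, fun e => by rw [Formula.realize_inf, hφ, hψ]⟩

instance Dfn.or (P Q : E → Prop) [h : Dfn M P] [h' : Dfn M Q] :
    Dfn M (no_index (fun e => P e ∨ Q e)) :=
  let ⟨φ, hφ⟩ := h
  let ⟨ψ, hψ⟩ := h'
  ⟨φ ⊔ ψ, fun e => by rw [Formula.realize_sup, hφ, hψ]⟩

instance Dfn.imp (P Q : E → Prop) [h : Dfn M P] [h' : Dfn M Q] :
    Dfn M (no_index (fun e => P e → Q e)) :=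
  let ⟨φ, hφ⟩ := h
  let ⟨ψ, hψ⟩ := h'
  ⟨φ.imp ψ, fun e => by rw [Formula.realize_imp, hφ, hψ]⟩

instance Dfn.iff (P Q : E → Prop) [h : Dfn M P] [h' : Dfn M Q] :
    Dfn M (no_index (fun e => (P e ↔ Q e))) :=
  let ⟨φ, hφ⟩ := h
  let ⟨ψ, hψ⟩ := h'
  ⟨φ.iff ψ, fun e => by rw [Formula.realize_iff, hφ, hψ]⟩

instance Dfn.exists (P : E → M → Prop) [h : Dfn M fun p : E × M => P p.1 p.2] :
    Dfn M (no_index (fun e => ∃ x, P e x)) := by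
  obtain ⟨φ, hφ⟩ := h
  refine ⟨(φ.relabel (fun x => x.elim (fun a => Sum.inl (Sum.inl a)) fun i =>
    i.elim (Sum.inr ()) fun j => Sum.inl (Sum.inr j)) :
      LA.Formula ((M ⊕ Env.Idx M E) ⊕ Unit)).iExs Unit, fun e => ?_⟩
  have key : ∀ x : M, (P e x ↔ (φ.relabel (fun x => x.elim (fun a => Sum.inl (Sum.inl a)) fun i =>
    i.elim (Sum.inr ()) fun j => Sum.inl (Sum.inr j)) :
      LA.Formula ((M ⊕ Env.Idx M E) ⊕ Unit)).Realize
        (Sum.elim (Sum.elim _root_.id fun i => Env.get i e) fun _ => x)) := fun x => by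
    rw [Formula.realize_relabel, hφ (e, x)]
    refine iff_of_eq (congrArg _ (funext fun y => ?_))
    rcases y with y | _ | y <;> rfl
  rw [Formula.realize_iExs]
  exact ⟨fun ⟨x, hx⟩ => ⟨fun _ => x, (key x).1 hx⟩, fun ⟨x, hx⟩ => ⟨x (), (key _).2 hx⟩⟩

instance Dfn.forall (P : E → M → Prop) [h : Dfn M fun p : E × M => P p.1 p.2] :
    Dfn M (no_index (fun e => ∀ x, P e x)) :=
  have : Dfn M fun e => ¬ ∃ x, ¬ P e x := inferInstance
  this.of_iff fun e => by simp

/-- Definable functions may be put for the variables of a formula. -/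
theorem Dfn.realize {k : ℕ} (φ : LA.Formula (Fin k)) (t : Fin k → E → M)
    (ht : ∀ i, DfnFun (t i)) : Dfn M fun e => φ.Realize fun i => t i e := by
  choose θ hθ using fun i => (ht i).graph.exists_formula
  let θ' : Fin k → LA.Formula ((M ⊕ Env.Idx M E) ⊕ Fin k) := fun i =>
    (θ i).relabel fun x => x.elim (fun a => Sum.inl (Sum.inl a)) fun j =>
      j.elim (Sum.inr i) fun j => Sum.inl (Sum.inr j)
  have key : ∀ e i (y : Fin k → M), (θ' i).Realize
      (Sum.elim (Sum.elim _root_.id fun i => Env.get i e) y) ↔ y i = t i e := fun e i y => by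
    rw [Formula.realize_relabel, hθ i (e, y i)]
    refine iff_of_eq (congrArg _ (funext fun z => ?_))
    rcases z with z | _ | z <;> rfl
  refine ⟨(BoundedFormula.iInf θ' ⊓ φ.relabel Sum.inr : LA.Formula _).iExs (Fin k), fun e => ?_⟩
  rw [Formula.realize_iExs]
  simp only [Formula.realize_inf, Formula.realize_relabel, Sum.elim_comp_inr]
  have h2 : ∀ y : Fin k → M, Formula.Realize (BoundedFormula.iInf θ')
      (Sum.elim (Sum.elim _root_.id fun i => Env.get i e) y) ↔ ∀ i, y i = t i e := fun y =>
    (BoundedFormula.realize_iInf (f := θ')).trans (forall_congr' fun i => key e i y)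
  simp only [h2]
  refine ⟨fun h => ⟨fun i => t i e, fun i => rfl, h⟩, fun ⟨y, hy, h⟩ => ?_⟩
  rwa [show y = fun i => t i e from funext hy] at h

instance DfnFun.var : DfnFun (no_index (fun e : M => e)) :=
  ⟨⟨(Term.var (Sum.inr none)).equal (Term.var (Sum.inr (some ()))), fun e => by
    rw [Formula.realize_equal]; rfl⟩⟩

instance DfnFun.snd (g : E → E' × M) [h : Forget M g] : DfnFun (no_index (fun e => (g e).2)) := by
  have : DfnFun (fun p : E' × M => p.2) :=
    ⟨⟨(Term.var (Sum.inr none)).equal (Term.var (Sum.inr (some none))), fun e => by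
      rw [Formula.realize_equal]; rfl⟩⟩
  exact this.forget g

instance DfnFun.fst (g : E → M × M) [h : Forget M g] : DfnFun (no_index (fun e => (g e).1)) := by
  have : DfnFun (fun p : M × M => p.1) :=
    ⟨⟨(Term.var (Sum.inr none)).equal (Term.var (Sum.inr (some (some ())))), fun e => by
      rw [Formula.realize_equal]; rfl⟩⟩
  exact this.forget g

instance DfnFun.const (a : M) : DfnFun (no_index (fun _ : E => a)) :=
  ⟨⟨(Term.var (Sum.inr none)).equal (Term.var (Sum.inl a)), fun e => by
    rw [Formula.realize_equal]; rfl⟩⟩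

instance Dfn.eq (f g : E → M) [hf : DfnFun f] [hg : DfnFun g] :
    Dfn M (no_index (fun e => f e = g e)) :=
  (Dfn.realize ((Term.var 0).equal (Term.var 1) : LA.Formula (Fin 2)) ![f, g]
    (Fin.cases hf (Fin.cases hg finZeroElim))).of_iff fun e => by
      rw [Formula.realize_equal]; rfl

theorem DfnFun.weaken (f : E → M) [hf : DfnFun f] : DfnFun fun p : E × M => f p.1 :=
  hf.forget Prod.fst

/-- Composition with a definable unary predicate. -/
theorem Dfn.comp {P : M → Prop} (hP : Dfn M P) (f : E → M) [hf : DfnFun f] :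
    Dfn M fun e => P (f e) := by
  have h1 := hf.graph
  have h2 : Dfn M fun p : E × M => P p.2 := by
    have : Forget M (fun p : E × M => p.2) := ⟨fun _ => none, fun _ _ => rfl⟩
    exact hP.forget (fun p : E × M => p.2)
  have : Dfn M fun e => ∃ y, y = f e ∧ P y := Dfn.exists _ (h := Dfn.and _ _)
  exact this.of_iff fun e => by simp

/-- Composition with a definable binary predicate. -/
theorem Dfn.comp₂ {P : M → M → Prop} (hP : Dfn M fun p : M × M => P p.1 p.2) (f g : E → M)
    [hf : DfnFun f] [hg : DfnFun g] : Dfn M fun e => P (f e) (g e) := by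
  have hg' := DfnFun.weaken (M := M) g
  have h1 : Dfn M fun p : E × M => p.2 = f p.1 := hf.graph
  have h2 : Dfn M fun p : (E × M) × M => p.2 = g p.1.1 := hg'.graph
  have h1' : Dfn M fun p : (E × M) × M => p.1.2 = f p.1.1 := h1.forget (fun p : (E × M) × M => p.1)
  have h3 : Dfn M fun p : (E × M) × M => P p.1.2 p.2 := by
    have : Forget M (fun p : (E × M) × M => (p.1.2, p.2)) :=
      ⟨fun i => i.elim none fun _ => some none, fun i e => by rcases i with _ | i <;> rfl⟩
    exact hP.forget (fun p : (E × M) × M => (p.1.2, p.2))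
  have : Dfn M fun e => ∃ x y, (x = f e ∧ y = g e) ∧ P x y :=
    Dfn.exists _ (h := Dfn.exists _ (h := Dfn.and _ _ (h := Dfn.and _ _)))
  exact this.of_iff fun e => by simp

/-- Composition with a definable ternary predicate. -/
theorem Dfn.comp₃ {P : M → M → M → Prop} (hP : Dfn M fun p : (M × M) × M => P p.1.1 p.1.2 p.2)
    (f g h : E → M) [hf : DfnFun f] [hg : DfnFun g] [hh : DfnFun h] :
    Dfn M fun e => P (f e) (g e) (h e) := by
  have h0 : Dfn M fun p : E × M => p.2 = h p.1 := hh.graph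
  have h1 : Dfn M fun p : (M × M) × M => P p.1.1 p.1.2 p.2 := hP
  have hP' : ∀ (E : Type) [Env M E] (a b c : E → M) [DfnFun a] [DfnFun b] [DfnFun c],
      Dfn M fun e => P (a e) (b e) (c e) := fun E _ a b c ha hb hc => by
    have ha1 := DfnFun.weaken (M := M) a
    have ha2 := DfnFun.weaken (M := M) fun p : E × M => a p.1
    have hb1 := DfnFun.weaken (M := M) b
    have hb2 := DfnFun.weaken (M := M) fun p : E × M => b p.1
    have hc1 := DfnFun.weaken (M := M) c
    have hc2 := DfnFun.weaken (M := M) fun p : E × M => c p.1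
    have ha3 := DfnFun.weaken (M := M) fun p : (E × M) × M => a p.1.1
    have hb3 := DfnFun.weaken (M := M) fun p : (E × M) × M => b p.1.1
    have hc3 := DfnFun.weaken (M := M) fun p : (E × M) × M => c p.1.1
    have hf : Forget M (fun p : ((E × M) × M) × M => ((p.1.1.2, p.1.2), p.2)) :=
      ⟨fun i => i.elim none fun j => j.elim (some none) fun _ => some (some none), fun i e => by
        rcases i with _ | _ | i <;> rfl⟩
    have h3 : Dfn M fun p : ((E × M) × M) × M => P p.1.1.2 p.1.2 p.2 :=
      h1.forget (fun p : ((E × M) × M) × M => ((p.1.1.2, p.1.2), p.2))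
    have : Dfn M fun e => ∃ x y z, ((x = a e ∧ y = b e) ∧ z = c e) ∧ P x y z := inferInstance
    exact this.of_iff fun e => by simp
  exact hP' E f g h

end Definability

/-! ### Models of arithmetic and their semantics -/

section Semantics

variable {α : Type} {M : Type} [LA.Structure M]

/-- The element denoted by a term in the scope of `d` quantifiers, where `ρ i` is the value of the
`i`-th bound variable. -/
def Tm.val (t : Tm α) (d : ℕ) (v : α → M) (ρ : ℕ → M) : M :=
  (t d).realize (Sum.elim v fun i : Fin d => ρ i)

/-- The truth of a formula in the scope of `d` quantifiers, where `ρ i` is the value of the `i`-th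
bound variable. -/
def Fm.Holds (A : Fm α) (d : ℕ) (v : α → M) (ρ : ℕ → M) : Prop :=
  (A d).Realize v fun i : Fin d => ρ i

variable (d : ℕ) (v : α → M) (ρ : ℕ → M) (x y : Tm α) (A B : Fm α)

omit [LA.Structure M] in
theorem snoc_eq_update (a : M) : (Fin.snoc (fun i : Fin d => ρ i) a : Fin (d + 1) → M) =
    fun i : Fin (d + 1) => Function.update ρ d a i := by
  funext i
  refine Fin.lastCases ?_ (fun i => ?_) i
  · simp
  · simp [Function.update_of_ne i.is_lt.ne]

@[simp] theorem holds_eqF : (eqF x y).Holds d v ρ ↔ x.val d v ρ = y.val d v ρ := Iff.rfl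
@[simp] theorem holds_andF : (andF A B).Holds d v ρ ↔ A.Holds d v ρ ∧ B.Holds d v ρ :=
  BoundedFormula.realize_inf
@[simp] theorem holds_orF : (orF A B).Holds d v ρ ↔ A.Holds d v ρ ∨ B.Holds d v ρ :=
  BoundedFormula.realize_sup
@[simp] theorem holds_impF : (impF A B).Holds d v ρ ↔ (A.Holds d v ρ → B.Holds d v ρ) := Iff.rfl
@[simp] theorem holds_notF : (notF A).Holds d v ρ ↔ ¬ A.Holds d v ρ := Iff.rfl

@[simp] theorem holds_all (A : Tm α → Fm α) : (all A).Holds d v ρ ↔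
    ∀ a, (A (bvar d)).Holds (d + 1) v (Function.update ρ d a) := by
  refine BoundedFormula.realize_all.trans (forall_congr' fun a => ?_)
  rw [snoc_eq_update]; rfl

@[simp] theorem holds_ex (A : Tm α → Fm α) : (ex A).Holds d v ρ ↔
    ∃ a, (A (bvar d)).Holds (d + 1) v (Function.update ρ d a) := by
  refine BoundedFormula.realize_ex.trans (exists_congr fun a => ?_)
  rw [snoc_eq_update]; rfl

theorem holds_app {k : ℕ} (R : LA.Formula (Fin k)) (t : Fin k → Tm α) :
    (app R t).Holds d v ρ ↔ R.Realize fun i => (t i).val d v ρ := by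
  unfold app Fm.Holds
  refine (BoundedFormula.realize_relabel (n := 0)).trans ?_
  rw [BoundedFormula.realize_subst]
  refine iff_of_eq (congrArg₂ _ (funext fun i => congrArg (Term.realize · (t i d)) (funext ?_))
    (funext fun i => i.elim0))
  rintro (x | x) <;> rfl

theorem realize_define {k : ℕ} (A : (Fin k → Tm (Fin k)) → Fm (Fin k)) (v : Fin k → M)
    (ρ : ℕ → M) : (define A).Realize v ↔ (A fvar).Holds 0 v ρ := by
  unfold define Formula.Realize Fm.Holds
  exact iff_of_eq (congrArg _ (Subsingleton.elim _ _))

theorem realize_sentence (A : Fm Empty) (v : Empty → M) (ρ : ℕ → M) :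
    M ⊨ sentence A ↔ A.Holds 0 v ρ := by
  unfold sentence Sentence.Realize Formula.Realize Fm.Holds
  exact iff_of_eq (congrArg₂ _ (Subsingleton.elim _ _) (Subsingleton.elim _ _))

@[simp] theorem val_bvar (i : ℕ) (h : i < d) : (bvar i : Tm α).val d v ρ = ρ i := by
  simp [Tm.val, bvar, h]

@[simp] theorem val_fvar (a : α) : (fvar a : Tm α).val d v ρ = v a := rfl

end Semantics

/-- A model of Peano arithmetic. -/
class PAModel (M : Type) extends LA.Structure M where
  /-- The axioms hold. -/
  models : M ⊨ PA

section Operations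

variable {M : Type} [PAModel M]

instance : Zero M := ⟨Structure.funMap (L := LA) ArithFunc.zero ![]⟩
instance : One M := ⟨Structure.funMap (L := LA) ArithFunc.succ ![0]⟩
instance : Add M := ⟨fun x y => Structure.funMap (L := LA) ArithFunc.add ![x, y]⟩
instance : Mul M := ⟨fun x y => Structure.funMap (L := LA) ArithFunc.mul ![x, y]⟩

variable {α : Type} (d : ℕ) (v : α → M) (ρ : ℕ → M) (x y : Tm α)

@[simp] theorem val_zero : (0 : Tm α).val d v ρ = 0 :=
  congrArg (Structure.funMap (L := LA) ArithFunc.zero) (Subsingleton.elim _ _)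

theorem fun_two {β : Type} (f : Fin 2 → β) : f = ![f 0, f 1] := by
  funext i; fin_cases i <;> rfl

theorem fun_one {β : Type} (f : Fin 1 → β) : f = ![f 0] := by
  funext i; fin_cases i; rfl

@[simp] theorem val_add : (x + y).val d v ρ = x.val d v ρ + y.val d v ρ :=
  congrArg (Structure.funMap (L := LA) ArithFunc.add) (fun_two _)

@[simp] theorem val_mul : (x * y).val d v ρ = x.val d v ρ * y.val d v ρ :=
  congrArg (Structure.funMap (L := LA) ArithFunc.mul) (fun_two _)

theorem val_S' : (S x).val d v ρ = Structure.funMap (L := LA) ArithFunc.succ ![x.val d v ρ] :=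
  congrArg (Structure.funMap (L := LA) ArithFunc.succ) (fun_one _)

theorem holds_axiom {A : Fm Empty} (h : PA (sentence A)) : A.Holds 0 Empty.elim fun _ => (0 : M) :=
  (realize_sentence A _ _).1 (PAModel.models.realize_of_mem _ h)

theorem succ_eq (x : M) : Structure.funMap (L := LA) ArithFunc.succ ![x] = x + 1 := by
  have h1 := holds_axiom (M := M) .add_zero
  have h2 := holds_axiom (M := M) .add_succ
  simp [val_S'] at h1 h2
  have h3 := h2 x 0
  rw [h1] at h3
  exact h3.symm

@[simp] theorem val_S : (S x).val d v ρ = x.val d v ρ + 1 := by rw [val_S', succ_eq]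

end Operations

section Induction

variable {M : Type} [PAModel M]

theorem add_one_ne_zero' (x : M) : x + 1 ≠ 0 := by
  have h := holds_axiom (M := M) .succ_ne_zero
  simp at h
  exact h x

theorem add_one_inj' {x y : M} (h' : x + 1 = y + 1) : x = y := by
  have h := holds_axiom (M := M) .succ_inj
  simp at h
  exact h x y h'

theorem add_zero' (x : M) : x + 0 = x := by
  have h := holds_axiom (M := M) .add_zero
  simp at h
  exact h x

theorem add_succ' (x y : M) : x + (y + 1) = (x + y) + 1 := by
  have h := holds_axiom (M := M) .add_succ
  simp at h
  exact h x y

theorem mul_zero' (x : M) : x * 0 = 0 := by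
  have h := holds_axiom (M := M) .mul_zero
  simp at h
  exact h x

theorem mul_succ' (x y : M) : x * (y + 1) = x * y + x := by
  have h := holds_axiom (M := M) .mul_succ
  simp at h
  exact h x y

/-- The induction axioms, with the parameters `p`. -/
theorem induction_formula {n : ℕ} (φ : LA.Formula (Fin (n + 1))) (p : Fin n → M)
    (h0 : φ.Realize (Fin.snoc p 0 : Fin (n + 1) → M))
    (hs : ∀ x, φ.Realize (Fin.snoc p x : Fin (n + 1) → M) →
      φ.Realize (Fin.snoc p (x + 1) : Fin (n + 1) → M)) (x : M) :
    φ.Realize (Fin.snoc p x : Fin (n + 1) → M) := by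
  have h : M ⊨ GoodsteinPA.induction φ := PAModel.models.realize_of_mem _ (.induction φ)
  unfold GoodsteinPA.induction at h
  have h' := (BoundedFormula.realize_alls (v := (default : Empty → M))).1 h p
  let ρ : ℕ → M := fun i => if hi : i < n then p ⟨i, hi⟩ else 0
  have hρ : p = fun i : Fin n => ρ i := by funext i; simp [ρ]
  have key : ∀ (t : Tm Empty) (d : ℕ) (ρ' : ℕ → M), n ≤ d → (∀ i < n, ρ' i = ρ i) →
      ((app φ (Fin.snoc (fun i : Fin n => bvar i) t)).Holds d default ρ' ↔
        φ.Realize (Fin.snoc p (t.val d default ρ') : Fin (n + 1) → M)) := by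
    intro t d ρ' hd hρ'
    rw [holds_app]
    refine iff_of_eq (congrArg _ (funext fun i => ?_))
    refine Fin.lastCases ?_ (fun i => ?_) i
    · simp
    · simp only [Fin.snoc_castSucc]
      rw [val_bvar _ _ _ _ (i.2.trans_le hd), hρ' _ i.2]
      simp [ρ]
  have hu : ∀ a, ∀ i < n, Function.update ρ n a i = ρ i := fun a i hi =>
    Function.update_of_ne hi.ne _ _
  rw [hρ] at h'
  have h'' := (holds_impF n (default : Empty → M) ρ _ _).1 h'
  rw [key _ _ _ le_rfl (fun _ _ => rfl), holds_impF, holds_all, holds_all] at h''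
  simp only [holds_impF] at h''
  have h3 := h'' (by rwa [val_zero]) (fun a => by
    rw [key _ _ _ (by omega) (hu a), key _ _ _ (by omega) (hu a), val_S,
      val_bvar _ _ _ _ (by omega), Function.update_self]
    exact hs a) x
  rwa [key _ _ _ (by omega) (hu x), val_bvar _ _ _ _ (by omega), Function.update_self] at h3

/-- Induction for definable predicates. -/
theorem pa_induction {P : M → Prop} [hP : Dfn M P] (h0 : P 0) (hs : ∀ x, P x → P (x + 1)) (x : M) :
    P x := by
  classical
  obtain ⟨φ, hφ⟩ := hP
  -- the finitely many parameters of `φ` are numbered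
  let s := φ.freeVarFinset
  let e := s.equivFin
  let q : s → Fin (s.card + 1) := fun y =>
    Sum.elim (fun _ => Fin.castSucc (e y)) (fun _ => Fin.last _) (y : M ⊕ Env.Idx M M)
  let p : Fin s.card → M := fun i => Sum.elim id (fun _ => 0) (e.symm i : M ⊕ Env.Idx M M)
  have key : ∀ x, P x ↔ Formula.Realize (BoundedFormula.restrictFreeVar φ q)
      (Fin.snoc p x : Fin (s.card + 1) → M) := fun x => by
    rw [hφ]
    refine (BoundedFormula.realize_restrictFreeVar _ ?_).symm
    rintro ⟨a | a, ha⟩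
    · have : p (e ⟨Sum.inl a, ha⟩) = a := by simp [p]
      simp [q, this]
    · simp only [q, Sum.elim_inr, Fin.snoc_last]; rfl
  rw [key]
  refine induction_formula _ _ ((key 0).1 h0) (fun y hy => (key _).1 (hs y ((key y).2 hy))) x

end Induction

/-! ### Arithmetic in a model -/

section Arithmetic

variable {M : Type} [PAModel M]

section

variable {E : Type} [Env M E]

instance DfnFun.add (f g : E → M) [hf : DfnFun f] [hg : DfnFun g] :
    DfnFun (no_index (fun e => f e + g e)) := by
  have := DfnFun.weaken (M := M) f
  have := DfnFun.weaken (M := M) g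
  refine ⟨(Dfn.realize (define fun v => eqF (v 0) (v 1 + v 2)) ![fun p : E × M => p.2,
    fun p => f p.1, fun p => g p.1] ?_).of_iff fun e => ?_⟩
  · intro i; fin_cases i <;> (dsimp; infer_instance)
  · rw [realize_define _ _ fun _ => 0]; simp

instance DfnFun.mul (f g : E → M) [hf : DfnFun f] [hg : DfnFun g] :
    DfnFun (no_index (fun e => f e * g e)) := by
  have := DfnFun.weaken (M := M) f
  have := DfnFun.weaken (M := M) g
  refine ⟨(Dfn.realize (define fun v => eqF (v 0) (v 1 * v 2)) ![fun p : E × M => p.2,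
    fun p => f p.1, fun p => g p.1] ?_).of_iff fun e => ?_⟩
  · intro i; fin_cases i <;> (dsimp; infer_instance)
  · rw [realize_define _ _ fun _ => 0]; simp

end

theorem zero_add' (x : M) : 0 + x = x := by
  refine pa_induction (P := fun x : M => 0 + x = x) (add_zero' 0) (fun x h => ?_) x
  rw [add_succ', h]

theorem succ_add' (x y : M) : (x + 1) + y = (x + y) + 1 := by
  refine pa_induction (P := fun y : M => (x + 1) + y = (x + y) + 1) ?_ (fun y h => ?_) y
  · rw [add_zero', add_zero']
  · rw [add_succ', h, add_succ']

theorem add_comm' (x y : M) : x + y = y + x := by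
  refine pa_induction (P := fun y : M => x + y = y + x) ?_ (fun y h => ?_) y
  · rw [add_zero', zero_add']
  · rw [add_succ', h, succ_add']

theorem add_assoc' (x y z : M) : x + y + z = x + (y + z) := by
  refine pa_induction (P := fun z : M => x + y + z = x + (y + z)) ?_ (fun z h => ?_) z
  · rw [add_zero', add_zero']
  · rw [add_succ', h, add_succ', add_succ']

theorem zero_mul' (x : M) : 0 * x = 0 := by
  refine pa_induction (P := fun x : M => 0 * x = 0) (mul_zero' 0) (fun x h => ?_) x
  rw [mul_succ', h, add_zero']

theorem succ_mul' (x y : M) : (x + 1) * y = x * y + y := by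
  refine pa_induction (P := fun y : M => (x + 1) * y = x * y + y) ?_ (fun y h => ?_) y
  · rw [mul_zero', mul_zero', add_zero']
  · rw [mul_succ', h, mul_succ', add_succ', add_succ' (x * y + x), add_assoc' _ y x, add_comm' y x,
      ← add_assoc']

theorem mul_comm' (x y : M) : x * y = y * x := by
  refine pa_induction (P := fun y : M => x * y = y * x) ?_ (fun y h => ?_) y
  · rw [mul_zero', zero_mul']
  · rw [mul_succ', h, succ_mul']

theorem mul_add' (x y z : M) : x * (y + z) = x * y + x * z := by
  refine pa_induction (P := fun z : M => x * (y + z) = x * y + x * z) ?_ (fun z h => ?_) z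
  · rw [add_zero', mul_zero', add_zero']
  · rw [add_succ', mul_succ', h, mul_succ', add_assoc']

theorem mul_assoc' (x y z : M) : x * y * z = x * (y * z) := by
  refine pa_induction (P := fun z : M => x * y * z = x * (y * z)) ?_ (fun z h => ?_) z
  · rw [mul_zero', mul_zero', mul_zero']
  · rw [mul_succ', h, mul_succ', mul_add']

instance : CommSemiring M where
  add_assoc := add_assoc'
  zero_add := zero_add'
  add_zero := add_zero'
  add_comm := add_comm'
  mul_assoc := mul_assoc'
  one_mul x := by
    have := succ_mul' (0 : M) x
    rwa [zero_mul', zero_add', zero_add'] at this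
  mul_one x := by
    have := mul_succ' x (0 : M)
    rwa [mul_zero', zero_add', zero_add'] at this
  left_distrib := mul_add'
  right_distrib x y z := by rw [mul_comm', mul_add', mul_comm' z, mul_comm' z]
  zero_mul := zero_mul'
  mul_zero := mul_zero'
  mul_comm := mul_comm'
  nsmul := nsmulRec

theorem add_right_cancel' {x y z : M} (h : x + z = y + z) : x = y := by
  refine pa_induction (P := fun z : M => x + z = y + z → x = y) ?_ (fun z ih h => ?_) z h
  · simp
  · rw [← add_assoc, ← add_assoc] at h
    exact ih (add_one_inj' h)

theorem zero_or_succ (x : M) : x = 0 ∨ ∃ y, x = y + 1 :=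
  pa_induction (P := fun x : M => x = 0 ∨ ∃ y, x = y + 1) (Or.inl rfl)
    (fun y _ => Or.inr ⟨y, rfl⟩) x

theorem eq_zero_of_add {x y : M} (h : x + y = 0) : x = 0 := by
  rcases zero_or_succ y with rfl | ⟨y, rfl⟩
  · simpa using h
  · exact (add_one_ne_zero' _ ((add_assoc x y 1).trans h)).elim

/-- The order that `le` formalizes. -/
instance : PartialOrder M where
  le x y := ∃ z, x + z = y
  le_refl x := ⟨0, add_zero x⟩
  le_trans := by
    rintro x _ _ ⟨y, rfl⟩ ⟨z, rfl⟩
    exact ⟨y + z, (add_assoc x y z).symm⟩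
  le_antisymm := by
    rintro x _ ⟨y, rfl⟩ ⟨z, hz⟩
    have : y + z = 0 := add_right_cancel' (z := x) (by rw [zero_add, add_comm, ← add_assoc, hz])
    rw [eq_zero_of_add this, add_zero]

theorem le_def {x y : M} : x ≤ y ↔ ∃ z, x + z = y := Iff.rfl

theorem le_total' (x y : M) : x ≤ y ∨ y ≤ x := by
  simp only [le_def]
  refine pa_induction (P := fun x : M => (∃ z, x + z = y) ∨ (∃ z, y + z = x)) ?_ (fun x h => ?_) x
  · exact Or.inl ⟨y, zero_add y⟩
  · rcases h with ⟨z, rfl⟩ | ⟨z, rfl⟩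
    · rcases zero_or_succ z with rfl | ⟨z, rfl⟩
      · exact Or.inr ⟨1, by simp⟩
      · exact Or.inl ⟨z, by ring⟩
    · exact Or.inr ⟨z + 1, by ring⟩

noncomputable instance : LinearOrder M where
  le_total := le_total'
  toDecidableLE := Classical.decRel _

theorem lt_def {x y : M} : x < y ↔ ∃ z, x + (z + 1) = y := by
  rw [lt_iff_le_and_ne, le_def]
  constructor
  · rintro ⟨⟨z, rfl⟩, h⟩
    rcases zero_or_succ z with rfl | ⟨z, rfl⟩
    · simp at h
    · exact ⟨z, rfl⟩
  · rintro ⟨z, rfl⟩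
    exact ⟨⟨z + 1, rfl⟩, fun h => add_one_ne_zero' z
      (add_right_cancel' (z := x) (by rw [zero_add, add_comm, ← h]))⟩

instance : CanonicallyOrderedAdd M where
  exists_add_of_le := fun ⟨z, hz⟩ => ⟨z, hz.symm⟩
  le_add_self x y := ⟨y, add_comm x y⟩
  le_self_add _ y := ⟨y, rfl⟩

instance : Nontrivial M := ⟨0, 1, fun h => add_one_ne_zero' (0 : M) (by rw [zero_add, ← h])⟩

instance : IsStrictOrderedRing M where
  add_le_add_left := by
    rintro x _ ⟨z, rfl⟩ y
    exact ⟨z, by ring⟩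
  le_of_add_le_add_left := by
    rintro x y z ⟨w, hw⟩
    exact ⟨w, add_right_cancel' (z := x) (by rw [add_comm z x, ← hw]; ring)⟩
  zero_le_one := ⟨1, zero_add 1⟩
  mul_lt_mul_of_pos_left := by
    intro x hx y z h
    rw [lt_def] at *
    obtain ⟨x, rfl⟩ := hx
    obtain ⟨z, rfl⟩ := h
    exact ⟨x * z + x + z, by ring⟩
  mul_lt_mul_of_pos_right := by
    intro x hx y z h
    rw [lt_def] at *
    obtain ⟨x, rfl⟩ := hx
    obtain ⟨z, rfl⟩ := h
    exact ⟨x * z + x + z, by ring⟩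

open Classical in
/-- Truncated subtraction. -/
noncomputable instance : Sub M := ⟨fun x y => if h : y ≤ x then h.choose else 0⟩

theorem add_sub_of_le' {x y : M} (h : y ≤ x) : y + (x - y) = x := by
  change y + (if h : y ≤ x then h.choose else 0) = x
  rw [dif_pos h]
  exact h.choose_spec

theorem sub_of_not_le {x y : M} (h : ¬ y ≤ x) : x - y = 0 := dif_neg h

instance : OrderedSub M where
  tsub_le_iff_right x y z := by
    by_cases h : y ≤ x
    · conv_rhs => rw [← add_sub_of_le' h, add_comm]
      exact (add_le_add_iff_right y).symm
    · rw [sub_of_not_le h]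
      exact ⟨fun _ => (le_of_not_ge h).trans le_add_self, fun _ => zero_le⟩

theorem add_one_le_iff {x y : M} : x + 1 ≤ y ↔ x < y := by
  rw [lt_def, le_def]
  exact exists_congr fun z => by rw [add_assoc, add_comm 1]

theorem lt_add_one_iff {x y : M} : x < y + 1 ↔ x ≤ y := by
  rw [← add_one_le_iff, add_le_add_iff_right]

theorem pos_iff_one_le {x : M} : 0 < x ↔ 1 ≤ x := by rw [← add_one_le_iff, zero_add]

section

variable {E : Type} [Env M E]

instance Dfn.le (f g : E → M) [hf : DfnFun f] [hg : DfnFun g] :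
    Dfn M (no_index (fun e => f e ≤ g e)) := by
  have := DfnFun.weaken (M := M) f
  have := DfnFun.weaken (M := M) g
  exact (inferInstance : Dfn M fun e => ∃ z, f e + z = g e)

instance Dfn.lt (f g : E → M) [hf : DfnFun f] [hg : DfnFun g] :
    Dfn M (no_index (fun e => f e < g e)) :=
  (inferInstance : Dfn M fun e => ¬ g e ≤ f e).of_iff fun _ => not_le.symm

instance Dfn.dvd (f g : E → M) [hf : DfnFun f] [hg : DfnFun g] :
    Dfn M (no_index (fun e => f e ∣ g e)) := by
  have := DfnFun.weaken (M := M) f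
  have := DfnFun.weaken (M := M) g
  exact (inferInstance : Dfn M fun e => ∃ z, g e = f e * z)

instance DfnFun.sub (f g : E → M) [hf : DfnFun f] [hg : DfnFun g] :
    DfnFun (no_index (fun e => f e - g e)) := by
  have := DfnFun.weaken (M := M) f
  have := DfnFun.weaken (M := M) g
  refine ⟨(inferInstance : Dfn M fun p : E × M => (g p.1 ≤ f p.1 ∧ g p.1 + p.2 = f p.1) ∨
    (¬ g p.1 ≤ f p.1 ∧ p.2 = 0)).of_iff fun p => ?_⟩
  by_cases h : g p.1 ≤ f p.1
  · simp only [h, true_and, not_true, false_and, or_false]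
    rw [← add_left_cancel_iff (a := g p.1), add_sub_of_le' h]
  · simp [h, sub_of_not_le h]

end

/-- Strong induction for definable predicates. -/
theorem pa_strong_induction {P : M → Prop} [hP : Dfn M P] (h : ∀ x, (∀ y, y < x → P y) → P x)
    (x : M) : P x := by
  have (E : Type) [Env M E] (f : E → M) [DfnFun f] : Dfn M fun e => P (f e) := hP.comp f
  have key := pa_induction (P := fun x : M => ∀ y, y < x → P y) (fun y hy => (not_lt_zero hy).elim)
    fun x ih y hy => by
      rcases (lt_add_one_iff.1 hy).lt_or_eq with h' | rfl
      exacts [ih y h', h y ih]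
  exact h x (key x)

end Arithmetic

/-! ### The ordered ring of differences -/

section Differences

variable (M : Type) [PAModel M]

/-- Pairs with the same difference. -/
def diffSetoid : Setoid (M × M) where
  r p q := p.1 + q.2 = q.1 + p.2
  iseqv := ⟨fun _ => rfl, fun h => h.symm, fun {p q r} h₁ h₂ =>
    add_right_cancel' (z := q.1 + q.2) (by linear_combination h₁ + h₂)⟩

/-- The ring of formal differences of elements of `M`.  It is an ordered commutative ring, so that
`linarith` and `nlinarith` apply to it. -/
def Diff : Type := Quotient (diffSetoid M)

variable {M}

namespace Diff

/-- The difference `a - b`. -/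
def mk (a b : M) : Diff M := Quotient.mk (diffSetoid M) (a, b)

theorem mk_eq_mk {a b c d : M} : mk a b = mk c d ↔ a + d = c + b :=
  Quotient.eq (r := diffSetoid M)

theorem ind {P : Diff M → Prop} (h : ∀ a b, P (mk a b)) (x : Diff M) : P x :=
  Quotient.inductionOn x fun p => h p.1 p.2

/-- A binary operation that is given by its values on pairs. -/
def lift₂ {β : Type} (f : M → M → M → M → β) (h : ∀ a b c d a' b' c' d',
    a + b' = a' + b → c + d' = c' + d → f a b c d = f a' b' c' d') (x y : Diff M) : β :=
  Quotient.lift₂ (fun p q => f p.1 p.2 q.1 q.2) (fun _ _ _ _ h₁ h₂ => h _ _ _ _ _ _ _ _ h₁ h₂) x y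

instance : Zero (Diff M) := ⟨mk 0 0⟩
instance : One (Diff M) := ⟨mk 1 0⟩
instance : Add (Diff M) := ⟨lift₂ (fun a b c d => mk (a + c) (b + d))
  fun a b c d a' b' c' d' h₁ h₂ => mk_eq_mk.2 (by linear_combination h₁ + h₂)⟩
instance : Neg (Diff M) := ⟨Quotient.lift (fun p => mk p.2 p.1) fun p q h => mk_eq_mk.2 (by
  have h : p.1 + q.2 = q.1 + p.2 := h
  rw [add_comm, ← h, add_comm])⟩
instance : Mul (Diff M) := ⟨lift₂ (fun a b c d => mk (a * c + b * d) (a * d + b * c))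
  fun a b c d a' b' c' d' h₁ h₂ => mk_eq_mk.2 (add_right_cancel'
    (z := a' * d + b' * c + a' * c + b' * d)
    (by linear_combination c * h₁ + d * h₁.symm + a' * h₂ + b' * h₂.symm))⟩

theorem mk_add (a b c d : M) : mk a b + mk c d = mk (a + c) (b + d) := rfl
theorem mk_mul (a b c d : M) : mk a b * mk c d = mk (a * c + b * d) (a * d + b * c) := rfl
theorem neg_mk (a b : M) : -mk a b = mk b a := rfl
theorem zero_def : (0 : Diff M) = mk 0 0 := rfl
theorem one_def : (1 : Diff M) = mk 1 0 := rfl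

instance : CommRing (Diff M) where
  add_assoc x y z := by
    induction x using ind; induction y using ind; induction z using ind
    simp only [mk_add, add_assoc]
  zero_add x := by induction x using ind; simp only [zero_def, mk_add, zero_add]
  add_zero x := by induction x using ind; simp only [zero_def, mk_add, add_zero]
  add_comm x y := by
    induction x using ind; induction y using ind
    simp only [mk_add, mk_eq_mk]; ring
  mul_assoc x y z := by
    induction x using ind; induction y using ind; induction z using ind
    simp only [mk_mul, mk_eq_mk]; ring
  one_mul x := by induction x using ind; simp [one_def, mk_mul]
  mul_one x := by induction x using ind; simp [one_def, mk_mul]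
  left_distrib x y z := by
    induction x using ind; induction y using ind; induction z using ind
    simp only [mk_mul, mk_add, mk_eq_mk]; ring
  right_distrib x y z := by
    induction x using ind; induction y using ind; induction z using ind
    simp only [mk_mul, mk_add, mk_eq_mk]; ring
  zero_mul x := by induction x using ind; simp [zero_def, mk_mul]
  mul_zero x := by induction x using ind; simp [zero_def, mk_mul]
  neg_add_cancel x := by
    induction x using ind; simp only [neg_mk, zero_def, mk_add, mk_eq_mk]; ring
  mul_comm x y := by
    induction x using ind; induction y using ind
    simp only [mk_mul, mk_eq_mk]; ring
  nsmul := nsmulRec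
  zsmul := zsmulRec

instance : LE (Diff M) := ⟨lift₂ (fun a b c d => a + d ≤ c + b)
  fun a b c d a' b' c' d' h₁ h₂ => propext (by
    have e₁ : a + d + (b' + c') = a' + d' + (b + c) := by linear_combination h₁ + h₂.symm
    have e₂ : c + b + (b' + c') = c' + b' + (b + c) := by ring
    rw [← add_le_add_iff_right (b' + c'), e₁, e₂, add_le_add_iff_right])⟩

theorem mk_le_mk {a b c d : M} : mk a b ≤ mk c d ↔ a + d ≤ c + b := Iff.rfl

noncomputable instance : LinearOrder (Diff M) where
  le_refl x := by induction x using ind; exact mk_le_mk.2 (le_of_eq (by ring))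
  le_trans x y z := by
    induction x using ind with | h a b
    induction y using ind with | h c d
    induction z using ind with | h e f
    simp only [mk_le_mk]
    intro h₁ h₂
    rw [← add_le_add_iff_right (c + d)]
    calc a + f + (c + d) = (a + d) + (c + f) := by ring
      _ ≤ (c + b) + (e + d) := add_le_add h₁ h₂
      _ = e + b + (c + d) := by ring
  le_antisymm x y := by
    induction x using ind; induction y using ind
    simp only [mk_le_mk, mk_eq_mk]
    exact fun h₁ h₂ => le_antisymm h₁ h₂
  le_total x y := by
    induction x using ind; induction y using ind
    simp only [mk_le_mk]
    exact le_total _ _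
  toDecidableLE := Classical.decRel _

instance : Nontrivial (Diff M) := ⟨0, 1, fun h => by
  simp [zero_def, one_def, mk_eq_mk] at h⟩

instance : IsOrderedAddMonoid (Diff M) where
  add_le_add_left x y h z := by
    induction x using ind with | h a b
    induction y using ind with | h c d
    induction z using ind with | h e f
    simp only [mk_add, mk_le_mk] at *
    calc a + e + (d + f) = a + d + (e + f) := by ring
      _ ≤ c + b + (e + f) := by gcongr
      _ = _ := by ring

instance : ZeroLEOneClass (Diff M) := ⟨by simp [zero_def, one_def, mk_le_mk]⟩

instance : IsStrictOrderedRing (Diff M) := IsStrictOrderedRing.of_mul_pos fun x y => by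
  induction x using ind with | h a b
  induction y using ind with | h c d
  simp only [← not_le, mk_le_mk, mk_mul, zero_def, zero_add, add_zero]
  simp only [not_le, lt_def]
  rintro ⟨z, rfl⟩ ⟨w, rfl⟩
  exact ⟨z * w + z + w, by ring⟩

/-- The embedding of `M`. -/
@[coe] def ofM (a : M) : Diff M := mk a 0

instance : Coe M (Diff M) := ⟨ofM⟩

theorem ofM_nonneg (a : M) : (0 : Diff M) ≤ a := by
  change mk 0 0 ≤ mk a 0
  simp [mk_le_mk]

/-- Translation of arithmetical facts in `M` into the ring of differences; the order of `M` is
discrete. -/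
theorem toDiff : (∀ a b : M, a = b ↔ (a : Diff M) = b) ∧ (∀ a b : M, a ≤ b ↔ (a : Diff M) ≤ b) ∧
    (∀ a b : M, a < b ↔ (a : Diff M) + 1 ≤ b) ∧ (∀ a b : M, ofM (a + b) = a + b) ∧
    (∀ a b : M, ofM (a * b) = a * b) ∧ ofM (0 : M) = 0 ∧ ofM (1 : M) = 1 ∧
    ∀ (n : ℕ) [n.AtLeastTwo], ofM (ofNat(n) : M) = ofNat(n) := by
  have h0 : ofM (0 : M) = 0 := rfl
  have h1 : ofM (1 : M) = 1 := rfl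
  have hadd : ∀ a b : M, ofM (a + b) = a + b := fun a b => by
    simp [ofM, mk_add]
  refine ⟨fun a b => by simp [ofM, mk_eq_mk], fun a b => by simp [ofM, mk_le_mk], fun a b => ?_,
    hadd, fun a b => by simp [ofM, mk_mul], h0, h1, fun n _ => ?_⟩
  · rw [← add_one_le_iff]
    simp [ofM, one_def, mk_le_mk, mk_add]
  · have : ∀ n : ℕ, ofM (n : M) = n := fun n => by
      induction n with
      | zero => simpa using h0
      | succ n ih => push_cast; rw [hadd, ih, h1]
    exact this n

end Diff

end Differences

-- Definability of the rules of the inductive definitions takes long instance searches.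
set_option synthInstance.maxSize 2000
set_option synthInstance.maxHeartbeats 400000

open Diff

/-! ### Pairs, finite sets and inductive definitions in a model -/

section Coding

variable {M : Type} [PAModel M] {E : Type} [Env M E]

section

variable {α : Type} (d : ℕ) (v : α → M) (ρ : ℕ → M) (x y z : Tm α)

@[simp] theorem holds_le : (le x y).Holds d v ρ ↔ x.val d v ρ ≤ y.val d v ρ := by
  rw [le, holds_app, leR, realize_define _ _ ρ]
  simp [le_def]

@[simp] theorem holds_lt : (lt x y).Holds d v ρ ↔ x.val d v ρ < y.val d v ρ := by
  rw [lt, holds_app, ltR, realize_define _ _ ρ]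
  simp [lt_def]

@[simp] theorem val_num (n : ℕ) : (num n : Tm α).val d v ρ = n := by
  induction n with
  | zero => simp [num]
  | succ n ih => simp [num, ih]

end

/-- The pairing `⟨x, y⟩ = (x + y)² + x` of `M`. -/
def pair (x y : M) : M := (x + y) * (x + y) + x

/-- Triples in `M`. -/
def trip (x y z : M) : M := pair x (pair y z)

theorem pair_inj {x y x' y' : M} : pair x y = pair x' y' ↔ x = x' ∧ y = y' := by
  refine ⟨fun h => ?_, fun h => by rw [h.1, h.2]⟩
  unfold pair at h
  have hs : x + y = x' + y' := by
    rcases lt_trichotomy (x + y) (x' + y') with h' | h' | h'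
    · simp only [toDiff] at *
      nlinarith [ofM_nonneg x, ofM_nonneg y, ofM_nonneg x', ofM_nonneg y']
    · exact h'
    · simp only [toDiff] at *
      nlinarith [ofM_nonneg x, ofM_nonneg y, ofM_nonneg x', ofM_nonneg y']
  rw [hs, add_left_cancel_iff] at h
  subst h
  exact ⟨rfl, add_left_cancel hs⟩

theorem trip_inj {x y z x' y' z' : M} :
    trip x y z = trip x' y' z' ↔ x = x' ∧ y = y' ∧ z = z' := by
  rw [trip, trip, pair_inj, pair_inj]

theorem left_le_pair (x y : M) : x ≤ pair x y := le_add_self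

theorem right_le_pair (x y : M) : y ≤ pair x y := by
  unfold pair
  rcases zero_or_succ y with rfl | ⟨y, rfl⟩
  · exact zero_le
  simp only [toDiff]
  nlinarith [ofM_nonneg x, ofM_nonneg y]

instance DfnFun.pair (f g : E → M) [DfnFun f] [DfnFun g] :
    DfnFun (no_index (fun e => pair (f e) (g e))) := by
  unfold GoodsteinPA.pair; infer_instance

instance DfnFun.trip (f g h : E → M) [DfnFun f] [DfnFun g] [DfnFun h] :
    DfnFun (no_index (fun e => trip (f e) (g e) (h e))) := by
  unfold GoodsteinPA.trip; infer_instance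

/-- Membership of `x` in the finite set with the code `(a, b, c)`. -/
def Mem (x a b c : M) : Prop := x < c ∧ ((x + 1) * b + 1) ∣ a

instance Dfn.mem (f g h k : E → M) [DfnFun f] [DfnFun g] [DfnFun h] [DfnFun k] :
    Dfn M (no_index (fun e => Mem (f e) (g e) (h e) (k e))) := by
  unfold Mem; infer_instance

section

variable {α : Type} (d : ℕ) (v : α → M) (ρ : ℕ → M) (x y z w : Tm α)

@[simp] theorem val_pr : (pr x y).val d v ρ = pair (x.val d v ρ) (y.val d v ρ) := by
  simp [pr, pair]

@[simp] theorem val_tr : (tr x y z).val d v ρ =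
    trip (x.val d v ρ) (y.val d v ρ) (z.val d v ρ) := by
  simp [tr, trip]

@[simp] theorem holds_mem : (mem x y z w).Holds d v ρ ↔
    Mem (x.val d v ρ) (y.val d v ρ) (z.val d v ρ) (w.val d v ρ) := by
  rw [mem, holds_app, memR, realize_define _ _ ρ]
  simp [Mem, dvd_def, mul_comm, eq_comm]

end

theorem dvd_of_dvd_add {p u w : M} (h : p ∣ u + w) (hu : p ∣ u) : p ∣ w := by
  obtain ⟨k, hk⟩ := h
  obtain ⟨j, rfl⟩ := hu
  rcases le_total j k with hjk | hjk
  · obtain ⟨z, rfl⟩ := hjk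
    exact ⟨z, by rwa [mul_add, add_left_cancel_iff] at hk⟩
  · obtain ⟨z, rfl⟩ := hjk
    rw [mul_add, add_assoc] at hk
    have : p * z + w = 0 := add_left_cancel (a := p * k) (by rw [hk, add_zero])
    rw [eq_zero_of_add ((add_comm w _).trans this)]
    exact dvd_zero p

/-- The moduli `(x + 1) b + 1` with `x < c` are coprime if `b` is divisible by all positive
numbers up to `c`. -/
theorem dvd_of_dvd_mul_modulus {a b c x y : M} (hb : ∀ z, 0 < z → z ≤ c → z ∣ b) (hx : x < c)
    (hy : y < c) (hxy : x ≠ y) (h : (x + 1) * b + 1 ∣ a * ((y + 1) * b + 1)) :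
    (x + 1) * b + 1 ∣ a := by
  -- with `z` the distance of `x` and `y`
  have key : ∃ z, 0 < z ∧ z ≤ c ∧ (x + 1) * b + 1 ∣ z * a := by
    rcases lt_or_gt_of_ne hxy with hlt | hlt
    · obtain ⟨z, rfl⟩ := lt_def.1 hlt
      refine ⟨z + 1, by simp, le_add_self.trans hy.le, ?_⟩
      refine dvd_of_dvd_add (u := (x + 1) * (a * ((x + (z + 1) + 1) * b + 1))) ?_ (h.mul_left _)
      exact ⟨(x + (z + 1) + 1) * a, by ring⟩
    · obtain ⟨z, rfl⟩ := lt_def.1 hlt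
      refine ⟨z + 1, by simp, le_add_self.trans hx.le, ?_⟩
      refine dvd_of_dvd_add (u := (y + 1) * a * ((y + (z + 1) + 1) * b + 1)) ?_ (dvd_mul_left _ _)
      refine (h.mul_left (y + (z + 1) + 1)).trans (dvd_of_eq ?_)
      ring
  obtain ⟨z, hz, hzc, hd⟩ := key
  -- the modulus is coprime to `b`, so that it divides `a` if it divides `b * a`
  refine dvd_of_dvd_add (u := (x + 1) * (b * a)) ?_
    ((hd.trans (mul_dvd_mul_right (hb z hz hzc) a)).mul_left _)
  exact ⟨a, by ring⟩

theorem exists_common_multiple (c : M) : ∃ b : M, 0 < b ∧ ∀ z, 0 < z → z ≤ c → z ∣ b := by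
  refine pa_induction (P := fun c : M => ∃ b : M, 0 < b ∧ ∀ z, 0 < z → z ≤ c → z ∣ b)
    ⟨1, by simp, fun z h h' => absurd h' (not_le.2 h)⟩ (fun c ⟨b, hb, h⟩ => ?_) c
  refine ⟨b * (c + 1), mul_pos hb (by simp), fun z hz hzc => ?_⟩
  rcases hzc.lt_or_eq with hlt | rfl
  · exact (h z hz (lt_add_one_iff.1 hlt)).mul_right _
  · exact dvd_mul_left _ _

/-- A predicate that is represented by a finite set code. -/
def Coded (X : M → Prop) : Prop := ∃ a b c, ∀ x, X x ↔ Mem x a b c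

/-- Comprehension: bounded definable predicates are coded. -/
theorem coded_of_bounded {X : M → Prop} [hX : Dfn M X] (c : M) (h : ∀ x, X x → x < c) :
    Coded X := by
  obtain ⟨b, hb0, hb⟩ := exists_common_multiple c
  have (E : Type) [Env M E] (f : E → M) [DfnFun f] : Dfn M fun e => X (f e) := hX.comp f
  have key : ∀ n : M, ∃ a, ∀ x, x < c → ((x + 1) * b + 1 ∣ a ↔ x < n ∧ X x) := by
    refine pa_induction ⟨1, fun x _ => ?_⟩ fun n ⟨a, ha⟩ => ?_
    · simp only [not_lt_zero, false_and, iff_false]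
      rintro ⟨k, hk⟩
      have hk0 : 0 < k := pos_of_ne_zero fun h0 => by simp [h0] at hk
      have : 1 + (x + 1) * b ≤ ((x + 1) * b + 1) * k :=
        (add_comm _ _).le.trans (le_mul_of_one_le_right zero_le (pos_iff_one_le.1 hk0))
      rw [← hk] at this
      exact absurd this (not_le.2 (lt_add_of_pos_right _ (mul_pos (by simp) hb0)))
    · by_cases hn : n < c ∧ X n
      · refine ⟨a * ((n + 1) * b + 1), fun x hx => ?_⟩
        by_cases hxn : x = n
        · subst hxn
          simp [hn.2]
        · have h1 : x < n + 1 ↔ x < n := by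
            rw [lt_add_one_iff]; exact ⟨fun h => lt_of_le_of_ne h hxn, le_of_lt⟩
          rw [h1, ← ha x hx]
          exact ⟨dvd_of_dvd_mul_modulus hb hx hn.1 hxn, fun h => h.mul_right _⟩
      · refine ⟨a, fun x hx => (ha x hx).trans ⟨fun h => ⟨h.1.trans (by simp), h.2⟩, fun h =>
          ⟨lt_of_le_of_ne (lt_add_one_iff.1 h.1) fun hxn => hn (hxn ▸ ⟨hx, h.2⟩), h.2⟩⟩⟩
  obtain ⟨a, ha⟩ := key c
  exact ⟨a, b, c, fun x => ⟨fun hx => ⟨h x hx, (ha x (h x hx)).2 ⟨h x hx, hx⟩⟩,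
    fun hx => ((ha x hx.1).1 hx.2).2⟩⟩

/-- `Derivable K t`: `t` has a derivation by the rules `K`. -/
def Derivable (K : (M → Prop) → M → Prop) (t : M) : Prop :=
  ∃ a b c, Mem t a b c ∧ ∀ u, Mem u a b c → K (fun x => Mem x a b c) u

/-- More premises allow more conclusions. -/
def MonotoneRules (K : (M → Prop) → M → Prop) : Prop :=
  ∀ X Y : M → Prop, (∀ x, X x → Y x) → ∀ u, K X u → K Y u

theorem derivable_iff {K : (M → Prop) → M → Prop} {t : M} :
    Derivable K t ↔ ∃ X, Coded X ∧ X t ∧ ∀ u, X u → K X u := by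
  constructor
  · rintro ⟨a, b, c, h, h'⟩
    exact ⟨_, ⟨a, b, c, fun _ => Iff.rfl⟩, h, h'⟩
  · rintro ⟨X, ⟨a, b, c, hX⟩, h, h'⟩
    obtain rfl : X = fun x => Mem x a b c := funext fun x => propext (hX x)
    exact ⟨a, b, c, h, h'⟩

/-- Inversion: a derivable element is the conclusion of a rule with derivable premises. -/
theorem Derivable.inv {K : (M → Prop) → M → Prop} (hK : MonotoneRules K) {t : M}
    (h : Derivable K t) : K (Derivable K) t := by
  obtain ⟨X, hX, ht, hcl⟩ := derivable_iff.1 h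
  exact hK X _ (fun x hx => derivable_iff.2 ⟨X, hX, hx, hcl⟩) t (hcl t ht)

/-- Closure under rules with two premises: two derivations are joined. -/
theorem Derivable.intro₂ {K : (M → Prop) → M → Prop} (hK : MonotoneRules K) {p q u : M}
    (hp : Derivable K p) (hq : Derivable K q) (h : ∀ X : M → Prop, X p → X q → K X u) :
    Derivable K u := by
  obtain ⟨a, b, c, hp, hpcl⟩ := hp
  obtain ⟨a', b', c', hq, hqcl⟩ := hq
  let X : M → Prop := fun x => (Mem x a b c ∨ Mem x a' b' c') ∨ x = u
  have hX : Dfn M X := inferInstance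
  refine derivable_iff.2 ⟨X, coded_of_bounded (c + c' + (u + 1)) ?_, Or.inr rfl, ?_⟩
  · rintro x ((hx | hx) | rfl)
    · exact hx.1.trans_le (le_self_add.trans le_self_add)
    · exact hx.1.trans_le (le_add_self.trans le_self_add)
    · exact (lt_add_one_iff.2 le_rfl).trans_le le_add_self
  · rintro x ((hx | hx) | rfl)
    · exact hK _ _ (fun y hy => Or.inl (Or.inl hy)) _ (hpcl x hx)
    · exact hK _ _ (fun y hy => Or.inl (Or.inr hy)) _ (hqcl x hx)
    · exact h X (Or.inl (Or.inl hp)) (Or.inl (Or.inr hq))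

theorem Derivable.intro₀ {K : (M → Prop) → M → Prop} {u : M} (h : ∀ X : M → Prop, K X u) :
    Derivable K u :=
  derivable_iff.2 ⟨fun x => x = u, coded_of_bounded (u + 1) fun x hx => by
    rw [hx]; exact lt_add_one_iff.2 le_rfl, rfl, fun _ hx => by rw [hx]; exact h _⟩

/-- Rules with at most two premises, all of them positive. -/
structure BinaryRules (K : (M → Prop) → M → Prop) : Prop where
  mono : MonotoneRules K
  binary : ∀ X u, K X u → (∀ Y, K Y u) ∨ ∃ p q, X p ∧ X q ∧ ∀ Y : M → Prop, Y p → Y q → K Y u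

/-- An inductively defined predicate is a fixed point of its rules. -/
theorem BinaryRules.derivable_iff {K : (M → Prop) → M → Prop} (hK : BinaryRules K) {u : M} :
    Derivable K u ↔ K (Derivable K) u := by
  refine ⟨Derivable.inv hK.mono, fun h => ?_⟩
  rcases hK.binary _ _ h with h | ⟨p, q, hp, hq, h⟩
  exacts [Derivable.intro₀ h, Derivable.intro₂ hK.mono hp hq h]

/-- The meaning of an inductive definition by a formula. -/
theorem realize_derivable {k : ℕ} {J : (Fin k → Tm (Fin k)) → (Tm (Fin k) → Fm (Fin k)) →
      Tm (Fin k) → Fm (Fin k)} {t : (Fin k → Tm (Fin k)) → Tm (Fin k)} {v : Fin k → M}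
    (K : (M → Prop) → M → Prop) (u : M) (ht : ∀ ρ, (t fvar).val 3 v ρ = u)
    (hJ : ∀ ρ : ℕ → M, (J fvar (fun x => mem x (bvar 0) (bvar 1) (bvar 2)) (bvar 3)).Holds 4 v ρ ↔
      K (fun x => Mem x (ρ 0) (ρ 1) (ρ 2)) (ρ 3)) :
    (define fun v => derivable (J v) (t v)).Realize v ↔ Derivable K u := by
  rw [realize_define _ _ fun _ => 0]
  simp [derivable, ht, hJ, Derivable]

end Coding

/-! ### The meaning of the defined relations in a model -/

section Relations

variable {M : Type} [PAModel M]

theorem fun_three {β : Type} (f : Fin 3 → β) : f = ![f 0, f 1, f 2] := by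
  funext i; fin_cases i <;> rfl

theorem fun_four {β : Type} (f : Fin 4 → β) : f = ![f 0, f 1, f 2, f 3] := by
  funext i; fin_cases i <;> rfl

theorem Dfn.realize₂ {E : Type} [Env M E] (R : LA.Formula (Fin 2)) (f g : E → M)
    [hf : DfnFun f] [hg : DfnFun g] : Dfn M fun e => R.Realize ![f e, g e] :=
  (Dfn.realize R ![f, g] (Fin.forall_fin_two.2 ⟨hf, hg⟩)).of_iff fun e => by
    rw [fun_two fun i => _]; rfl

theorem Dfn.realize₃ {E : Type} [Env M E] (R : LA.Formula (Fin 3)) (f g h : E → M)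
    [hf : DfnFun f] [hg : DfnFun g] [hh : DfnFun h] :
    Dfn M fun e => R.Realize ![f e, g e, h e] :=
  (Dfn.realize R ![f, g, h] (by intro i; fin_cases i; exacts [hf, hg, hh])).of_iff fun e => by
    rw [fun_three fun i => _]; rfl

theorem Dfn.realize₄ {E : Type} [Env M E] (R : LA.Formula (Fin 4)) (f g h k : E → M)
    [hf : DfnFun f] [hg : DfnFun g] [hh : DfnFun h] [hk : DfnFun k] :
    Dfn M fun e => R.Realize ![f e, g e, h e, k e] :=
  (Dfn.realize R ![f, g, h, k]
    (by intro i; fin_cases i; exacts [hf, hg, hh, hk])).of_iff fun e => by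
    rw [fun_four fun i => _]; rfl

/-! ### Codes of primitive recursive functions -/

/-- `z = Nat.pair x y`. -/
def NatPair (x y z : M) : Prop := (x < y ∧ z = y * y + x) ∨ (y ≤ x ∧ z = x * x + x + y)

@[simp] theorem holds_natPair {α : Type} (d : ℕ) (v : α → M) (ρ : ℕ → M) (x y z : Tm α) :
    (natPair x y z).Holds d v ρ ↔ NatPair (x.val d v ρ) (y.val d v ρ) (z.val d v ρ) := by
  rw [natPair, holds_app, natPairR, realize_define _ _ ρ]
  simp [NatPair]

/-- The rules that generate codes of primitive recursive functions. -/
def CodeRules (X : M → Prop) (u : M) : Prop :=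
  u = trip 0 0 0 ∨ u = trip 1 0 0 ∨ u = trip 2 0 0 ∨ u = trip 3 0 0 ∨
    ∃ f g, X f ∧ X g ∧ (u = trip 4 f g ∨ u = trip 5 f g ∨ u = trip 6 f g)

/-- `e` is a code of a primitive recursive function. -/
def Code (e : M) : Prop := codeR.Realize ![e]

@[simp] theorem holds_code {α : Type} (d : ℕ) (v : α → M) (ρ : ℕ → M) (x : Tm α) :
    (code x).Holds d v ρ ↔ Code (x.val d v ρ) := by
  rw [code, holds_app, fun_one fun i => _]; rfl

theorem binaryRules_code : BinaryRules (CodeRules (M := M)) where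
  mono X Y h u := by
    rintro (h' | h' | h' | h' | ⟨f, g, hf, hg, h'⟩)
    · exact Or.inl h'
    · exact Or.inr (Or.inl h')
    · exact Or.inr (Or.inr (Or.inl h'))
    · exact Or.inr (Or.inr (Or.inr (Or.inl h')))
    · exact Or.inr (Or.inr (Or.inr (Or.inr ⟨f, g, h f hf, h g hg, h'⟩)))
  binary X u := by
    rintro (h' | h' | h' | h' | ⟨f, g, hf, hg, h'⟩)
    · exact Or.inl fun _ => Or.inl h'
    · exact Or.inl fun _ => Or.inr (Or.inl h')
    · exact Or.inl fun _ => Or.inr (Or.inr (Or.inl h'))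
    · exact Or.inl fun _ => Or.inr (Or.inr (Or.inr (Or.inl h')))
    · exact Or.inr ⟨f, g, hf, hg, fun Y hf hg =>
        Or.inr (Or.inr (Or.inr (Or.inr ⟨f, g, hf, hg, h'⟩)))⟩

theorem code_iff {e : M} : Code e ↔ CodeRules Code e := by
  have key : ∀ e : M, Code e ↔ Derivable CodeRules e := fun e => by
    unfold Code codeR
    refine realize_derivable CodeRules e (fun ρ => rfl) fun ρ => ?_
    simp [CodeRules, cZero, cSucc, cLeft, cRight, cPair, cComp, cPrec]
  rw [key, binaryRules_code.derivable_iff]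
  simp only [CodeRules, key]

/-- The rules that generate the graphs of primitive recursive functions. -/
def EvalRules (X : M → Prop) (u : M) : Prop :=
  (∃ x, u = trip (trip 0 0 0) x 0) ∨
  (∃ x, u = trip (trip 1 0 0) x (x + 1)) ∨
  (∃ x y z, NatPair x y z ∧ (u = trip (trip 2 0 0) z x ∨ u = trip (trip 3 0 0) z y)) ∨
  (∃ f g x y z w, X (trip f x y) ∧ X (trip g x z) ∧ NatPair y z w ∧ u = trip (trip 4 f g) x w) ∨
  (∃ f g x y z, X (trip g x y) ∧ X (trip f y z) ∧ u = trip (trip 5 f g) x z) ∨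
  (∃ f g z w y, NatPair z 0 w ∧ X (trip f z y) ∧ u = trip (trip 6 f g) w y) ∨
  ∃ f g z n w w' i p q y, NatPair z n w ∧ NatPair z (n + 1) w' ∧ X (trip (trip 6 f g) w i) ∧
    NatPair n i p ∧ NatPair z p q ∧ X (trip g q y) ∧ u = trip (trip 6 f g) w' y

/-- The primitive recursive function with the code `e` takes the value `y` at `x`. -/
def Eval (e x y : M) : Prop := evalR.Realize ![e, x, y]

instance Dfn.eval {E : Type} [Env M E] (f g h : E → M) [DfnFun f] [DfnFun g] [DfnFun h] :
    Dfn M (no_index (fun e => Eval (f e) (g e) (h e))) := Dfn.realize₃ _ _ _ _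

@[simp] theorem holds_eval {α : Type} (d : ℕ) (v : α → M) (ρ : ℕ → M) (x y z : Tm α) :
    (eval x y z).Holds d v ρ ↔ Eval (x.val d v ρ) (y.val d v ρ) (z.val d v ρ) := by
  rw [eval, holds_app, fun_three fun i => _]; rfl

theorem binaryRules_eval : BinaryRules (EvalRules (M := M)) where
  mono X Y h u := by
    rintro (h' | h' | h' | ⟨f, g, x, y, z, w, h₁, h₂, h'⟩ | ⟨f, g, x, y, z, h₁, h₂, h'⟩ |
      ⟨f, g, z, w, y, h₀, h₁, h'⟩ | ⟨f, g, z, n, w, w', i, p, q, y, h₀, h₁, h₂, h₃, h₄, h₅, h'⟩)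
    · exact Or.inl h'
    · exact Or.inr (Or.inl h')
    · exact Or.inr (Or.inr (Or.inl h'))
    · exact Or.inr (Or.inr (Or.inr (Or.inl ⟨f, g, x, y, z, w, h _ h₁, h _ h₂, h'⟩)))
    · exact Or.inr (Or.inr (Or.inr (Or.inr (Or.inl ⟨f, g, x, y, z, h _ h₁, h _ h₂, h'⟩))))
    · exact Or.inr (Or.inr (Or.inr (Or.inr (Or.inr (Or.inl ⟨f, g, z, w, y, h₀, h _ h₁, h'⟩)))))
    · exact Or.inr (Or.inr (Or.inr (Or.inr (Or.inr (Or.inr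
        ⟨f, g, z, n, w, w', i, p, q, y, h₀, h₁, h _ h₂, h₃, h₄, h _ h₅, h'⟩)))))
  binary X u := by
    rintro (h' | h' | h' | ⟨f, g, x, y, z, w, h₁, h₂, h'⟩ | ⟨f, g, x, y, z, h₁, h₂, h'⟩ |
      ⟨f, g, z, w, y, h₀, h₁, h'⟩ | ⟨f, g, z, n, w, w', i, p, q, y, h₀, h₁, h₂, h₃, h₄, h₅, h'⟩)
    · exact Or.inl fun _ => Or.inl h'
    · exact Or.inl fun _ => Or.inr (Or.inl h')
    · exact Or.inl fun _ => Or.inr (Or.inr (Or.inl h'))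
    · exact Or.inr ⟨_, _, h₁, h₂, fun Y h₁ h₂ =>
        Or.inr (Or.inr (Or.inr (Or.inl ⟨f, g, x, y, z, w, h₁, h₂, h'⟩)))⟩
    · exact Or.inr ⟨_, _, h₁, h₂, fun Y h₁ h₂ =>
        Or.inr (Or.inr (Or.inr (Or.inr (Or.inl ⟨f, g, x, y, z, h₁, h₂, h'⟩))))⟩
    · exact Or.inr ⟨_, _, h₁, h₁, fun Y h₁ _ =>
        Or.inr (Or.inr (Or.inr (Or.inr (Or.inr (Or.inl ⟨f, g, z, w, y, h₀, h₁, h'⟩)))))⟩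
    · exact Or.inr ⟨_, _, h₂, h₅, fun Y h₂ h₅ => Or.inr (Or.inr (Or.inr (Or.inr (Or.inr (Or.inr
        ⟨f, g, z, n, w, w', i, p, q, y, h₀, h₁, h₂, h₃, h₄, h₅, h'⟩)))))⟩

theorem eval_iff {e x y : M} :
    Eval e x y ↔ EvalRules (fun u => ∃ e x y, u = trip e x y ∧ Eval e x y) (trip e x y) := by
  have key : ∀ e x y : M, Eval e x y ↔ Derivable EvalRules (trip e x y) := fun e x y => by
    unfold Eval evalR
    refine realize_derivable EvalRules _ (fun ρ => by simp) fun ρ => ?_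
    simp [EvalRules, cZero, cSucc, cLeft, cRight, cPair, cComp, cPrec]
  rw [key, binaryRules_eval.derivable_iff]
  have h : ∀ e x y : M, Derivable EvalRules (trip e x y) ↔
      ∃ e' x' y', trip e x y = trip e' x' y' ∧ Eval e' x' y' := fun e x y => by
    rw [← key]
    exact ⟨fun h => ⟨e, x, y, rfl, h⟩, by
      rintro ⟨e', x', y', h, h'⟩
      obtain ⟨rfl, rfl, rfl⟩ := trip_inj.1 h
      exact h'⟩
  simp only [EvalRules, h]

/-! ### Powers, base change and Goodstein sequences -/

/-- The rules for `b ^ n = y`. -/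
def PowRules (b : M) (X : M → Prop) (u : M) : Prop :=
  u = pair 0 1 ∨ ∃ n y, X (pair n y) ∧ u = pair (n + 1) (y * b)

/-- `b ^ n = y`. -/
def Pow (b n y : M) : Prop := powR.Realize ![b, n, y]

instance Dfn.pow {E : Type} [Env M E] (f g h : E → M) [DfnFun f] [DfnFun g] [DfnFun h] :
    Dfn M (no_index (fun e => Pow (f e) (g e) (h e))) := Dfn.realize₃ _ _ _ _

@[simp] theorem holds_pow {α : Type} (d : ℕ) (v : α → M) (ρ : ℕ → M) (x y z : Tm α) :
    (pow x y z).Holds d v ρ ↔ Pow (x.val d v ρ) (y.val d v ρ) (z.val d v ρ) := by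
  rw [pow, holds_app, fun_three fun i => _]; rfl

theorem binaryRules_pow (b : M) : BinaryRules (PowRules b) where
  mono X Y h u := by
    rintro (h' | ⟨n, y, h₁, h'⟩)
    · exact Or.inl h'
    · exact Or.inr ⟨n, y, h _ h₁, h'⟩
  binary X u := by
    rintro (h' | ⟨n, y, h₁, h'⟩)
    · exact Or.inl fun _ => Or.inl h'
    · exact Or.inr ⟨_, _, h₁, h₁, fun Y h₁ _ => Or.inr ⟨n, y, h₁, h'⟩⟩

theorem pow_iff {b n y : M} :
    Pow b n y ↔ (n = 0 ∧ y = 1) ∨ ∃ n' y', Pow b n' y' ∧ n = n' + 1 ∧ y = y' * b := by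
  have key : ∀ n y : M, Pow b n y ↔ Derivable (PowRules b) (pair n y) := fun n y => by
    unfold Pow powR
    refine realize_derivable (PowRules b) _ (fun ρ => by simp) fun ρ => ?_
    simp [PowRules]
  rw [key, (binaryRules_pow b).derivable_iff]
  simp only [PowRules, key, pair_inj]

/-- The rules for the change of the base `b`: if `m = b ^ n * k + m'` is the decomposition of `m`,
and `n` and `m'` go to `n'` and `r'`, then `m` goes to `C n' k r'`. -/
def BaseRules (b : M) (C : M → M → M → M) (X : M → Prop) (u : M) : Prop :=
  u = pair 0 0 ∨ ∃ n k m' p n' r', Pow b n p ∧ 0 < k ∧ k < b ∧ m' < p ∧ X (pair n n') ∧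
    X (pair m' r') ∧ u = pair (p * k + m') (C n' k r')

theorem binaryRules_base (b : M) (C : M → M → M → M) : BinaryRules (BaseRules b C) where
  mono X Y h u := by
    rintro (h' | ⟨n, k, m', p, n', r', h₁, h₂, h₃, h₄, h₅, h₆, h'⟩)
    · exact Or.inl h'
    · exact Or.inr ⟨n, k, m', p, n', r', h₁, h₂, h₃, h₄, h _ h₅, h _ h₆, h'⟩
  binary X u := by
    rintro (h' | ⟨n, k, m', p, n', r', h₁, h₂, h₃, h₄, h₅, h₆, h'⟩)
    · exact Or.inl fun _ => Or.inl h'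
    · exact Or.inr ⟨_, _, h₅, h₆, fun Y h₅ h₆ =>
        Or.inr ⟨n, k, m', p, n', r', h₁, h₂, h₃, h₄, h₅, h₆, h'⟩⟩

/-- `r` results from `m` by the change of the base `b` to `c`. -/
def BaseChange (b c m r : M) : Prop := baseChangeR.Realize ![b, c, m, r]

instance Dfn.baseChange {E : Type} [Env M E] (f g h k : E → M) [DfnFun f] [DfnFun g] [DfnFun h]
    [DfnFun k] : Dfn M (no_index (fun e => BaseChange (f e) (g e) (h e) (k e))) :=
  Dfn.realize₄ _ _ _ _ _

@[simp] theorem holds_baseChange {α : Type} (d : ℕ) (v : α → M) (ρ : ℕ → M) (x y z w : Tm α) :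
    (baseChange x y z w).Holds d v ρ ↔
      BaseChange (x.val d v ρ) (y.val d v ρ) (z.val d v ρ) (w.val d v ρ) := by
  rw [baseChange, holds_app, fun_four fun i => _]; rfl

theorem baseChange_iff {b c m r : M} (P : M → M) (hP : ∀ n q, Pow c n q ↔ q = P n) :
    BaseChange b c m r ↔ Derivable (BaseRules b fun n k r => P n * k + r) (pair m r) := by
  unfold BaseChange baseChangeR
  refine realize_derivable _ _ (fun ρ => by simp) fun ρ => ?_
  simp [BaseRules, hP]

/-- The rules for the Goodstein sequence that starts with `m` and uses the bases given by the
code `e`. -/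
def GoodsteinRules (e m : M) (X : M → Prop) (u : M) : Prop :=
  u = pair 0 m ∨ ∃ i x b c z y, X (pair i x) ∧ Eval e i b ∧ Eval e (i + 1) c ∧
    BaseChange b c x z ∧ (z = y + 1 ∨ (z = 0 ∧ y = 0)) ∧ u = pair (i + 1) y

/-- The `i`-th term of a Goodstein sequence is `y`. -/
def Goodstein (e m i y : M) : Prop := goodsteinR.Realize ![e, m, i, y]

instance Dfn.goodstein {E : Type} [Env M E] (f g h k : E → M) [DfnFun f] [DfnFun g] [DfnFun h]
    [DfnFun k] : Dfn M (no_index (fun e => Goodstein (f e) (g e) (h e) (k e))) :=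
  Dfn.realize₄ _ _ _ _ _

@[simp] theorem holds_goodstein {α : Type} (d : ℕ) (v : α → M) (ρ : ℕ → M) (x y z w : Tm α) :
    (goodstein x y z w).Holds d v ρ ↔
      Goodstein (x.val d v ρ) (y.val d v ρ) (z.val d v ρ) (w.val d v ρ) := by
  rw [goodstein, holds_app, fun_four fun i => _]; rfl

theorem binaryRules_goodstein (e m : M) : BinaryRules (GoodsteinRules e m) where
  mono X Y h u := by
    rintro (h' | ⟨i, x, b, c, z, y, h₁, h'⟩)
    · exact Or.inl h'
    · exact Or.inr ⟨i, x, b, c, z, y, h _ h₁, h'⟩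
  binary X u := by
    rintro (h' | ⟨i, x, b, c, z, y, h₁, h'⟩)
    · exact Or.inl fun _ => Or.inl h'
    · exact Or.inr ⟨_, _, h₁, h₁, fun Y h₁ _ => Or.inr ⟨i, x, b, c, z, y, h₁, h'⟩⟩

theorem goodstein_iff {e m j w : M} : Goodstein e m j w ↔ (j = 0 ∧ w = m) ∨
    ∃ i x b c z, Goodstein e m i x ∧ Eval e i b ∧ Eval e (i + 1) c ∧
      BaseChange b c x z ∧ (z = w + 1 ∨ (z = 0 ∧ w = 0)) ∧ j = i + 1 := by
  have key : ∀ i y : M, Goodstein e m i y ↔ Derivable (GoodsteinRules e m) (pair i y) :=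
    fun i y => by
      unfold Goodstein goodsteinR
      refine realize_derivable (GoodsteinRules e m) _ (fun ρ => by simp) fun ρ => ?_
      simp [GoodsteinRules]
  rw [key, (binaryRules_goodstein e m).derivable_iff]
  simp only [GoodsteinRules, ← key, pair_inj]
  refine or_congr Iff.rfl ⟨?_, ?_⟩
  · rintro ⟨i, x, b, c, z, y, h₁, h₂, h₃, h₄, h₅, h₆, rfl⟩
    exact ⟨i, x, b, c, z, h₁, h₂, h₃, h₄, h₅, h₆⟩
  · rintro ⟨i, x, b, c, z, h₁, h₂, h₃, h₄, h₅, h₆⟩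
    exact ⟨i, x, b, c, z, w, h₁, h₂, h₃, h₄, h₅, h₆, rfl⟩

/-! ### Ordinals in Cantor normal form -/

/-- The code of `ω ^ e * k + r`. -/
def ocons (e k r : M) : M := trip e k r + 1

theorem ocons_inj {e k r e' k' r' : M} :
    ocons e k r = ocons e' k' r' ↔ e = e' ∧ k = k' ∧ r = r' := by
  rw [ocons, ocons, add_left_inj, trip_inj]

theorem ocons_ne_zero (e k r : M) : ocons e k r ≠ 0 := add_one_ne_zero' _

@[simp] theorem val_cnf {α : Type} (d : ℕ) (v : α → M) (ρ : ℕ → M) (x y z : Tm α) :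
    (cnf x y z).val d v ρ = ocons (x.val d v ρ) (y.val d v ρ) (z.val d v ρ) := by
  simp [cnf, ocons]

instance DfnFun.ocons {E : Type} [Env M E] (f g h : E → M) [DfnFun f] [DfnFun g] [DfnFun h] :
    DfnFun (no_index (fun e => ocons (f e) (g e) (h e))) := by
  unfold GoodsteinPA.ocons; infer_instance

/-- The rules for the lexicographic order of Cantor normal forms. -/
def OrdLtRules (X : M → Prop) (u : M) : Prop :=
  (∃ e k r, u = pair 0 (ocons e k r)) ∨ ∃ e k r e' k' r',
    (X (pair e e') ∨ (e = e' ∧ k < k') ∨ (e = e' ∧ k = k' ∧ X (pair r r'))) ∧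
      u = pair (ocons e k r) (ocons e' k' r')

/-- The order of Cantor normal forms. -/
def OrdLt (x y : M) : Prop := ordLtR.Realize ![x, y]

instance Dfn.ordLt {E : Type} [Env M E] (f g : E → M) [DfnFun f] [DfnFun g] :
    Dfn M (no_index (fun e => OrdLt (f e) (g e))) := Dfn.realize₂ _ _ _

@[simp] theorem holds_ordLt {α : Type} (d : ℕ) (v : α → M) (ρ : ℕ → M) (x y : Tm α) :
    (ordLt x y).Holds d v ρ ↔ OrdLt (x.val d v ρ) (y.val d v ρ) := by
  rw [ordLt, holds_app, fun_two fun i => _]; rfl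

theorem binaryRules_ordLt : BinaryRules (OrdLtRules (M := M)) where
  mono X Y h u := by
    rintro (h' | ⟨e, k, r, e', k', r', h₁ | h₁ | ⟨h₁, h₂, h₃⟩, h'⟩)
    · exact Or.inl h'
    · exact Or.inr ⟨e, k, r, e', k', r', Or.inl (h _ h₁), h'⟩
    · exact Or.inr ⟨e, k, r, e', k', r', Or.inr (Or.inl h₁), h'⟩
    · exact Or.inr ⟨e, k, r, e', k', r', Or.inr (Or.inr ⟨h₁, h₂, h _ h₃⟩), h'⟩
  binary X u := by
    rintro (h' | ⟨e, k, r, e', k', r', h₁ | h₁ | ⟨h₁, h₂, h₃⟩, h'⟩)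
    · exact Or.inl fun _ => Or.inl h'
    · exact Or.inr ⟨_, _, h₁, h₁, fun Y h₁ _ =>
        Or.inr ⟨e, k, r, e', k', r', Or.inl h₁, h'⟩⟩
    · exact Or.inl fun _ => Or.inr ⟨e, k, r, e', k', r', Or.inr (Or.inl h₁), h'⟩
    · exact Or.inr ⟨_, _, h₃, h₃, fun Y h₃ _ =>
        Or.inr ⟨e, k, r, e', k', r', Or.inr (Or.inr ⟨h₁, h₂, h₃⟩), h'⟩⟩

theorem ordLt_rules {x y : M} : OrdLt x y ↔ (∃ e k r, x = 0 ∧ y = ocons e k r) ∨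
    ∃ e k r e' k' r', (OrdLt e e' ∨ (e = e' ∧ k < k') ∨ (e = e' ∧ k = k' ∧ OrdLt r r')) ∧
      x = ocons e k r ∧ y = ocons e' k' r' := by
  have key : ∀ x y : M, OrdLt x y ↔ Derivable OrdLtRules (pair x y) := fun x y => by
    unfold OrdLt ordLtR
    refine realize_derivable OrdLtRules _ (fun ρ => by simp) fun ρ => ?_
    simp [OrdLtRules]
  rw [key, binaryRules_ordLt.derivable_iff]
  simp only [OrdLtRules, ← key, pair_inj]

theorem not_ordLt_zero (x : M) : ¬ OrdLt x 0 := by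
  rw [ordLt_rules]
  simp [(ocons_ne_zero _ _ _).symm]

theorem zero_ordLt (e k r : M) : OrdLt 0 (ocons e k r) :=
  ordLt_rules.2 (Or.inl ⟨e, k, r, rfl, rfl⟩)

theorem ocons_ordLt {e k r e' k' r' : M} : OrdLt (ocons e k r) (ocons e' k' r') ↔
    OrdLt e e' ∨ (e = e' ∧ k < k') ∨ (e = e' ∧ k = k' ∧ OrdLt r r') := by
  rw [ordLt_rules]
  constructor
  · rintro (⟨_, _, _, h, -⟩ | ⟨_, _, _, _, _, _, h, h₁, h₂⟩)
    · exact (ocons_ne_zero _ _ _ h).elim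
    · obtain ⟨rfl, rfl, rfl⟩ := ocons_inj.1 h₁
      obtain ⟨rfl, rfl, rfl⟩ := ocons_inj.1 h₂
      exact h
  · exact fun h => Or.inr ⟨_, _, _, _, _, _, h, rfl, rfl⟩

/-- The rules for Cantor normal forms. -/
def OrdRules (X : M → Prop) (u : M) : Prop :=
  u = 0 ∨ ∃ e k r, X e ∧ 0 < k ∧ X r ∧
    (r = 0 ∨ ∃ e' k' r', r = ocons e' k' r' ∧ OrdLt e' e) ∧ u = ocons e k r

/-- `x` codes a Cantor normal form. -/
def Ord (x : M) : Prop := ordR.Realize ![x]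

@[simp] theorem holds_ord {α : Type} (d : ℕ) (v : α → M) (ρ : ℕ → M) (x : Tm α) :
    (ord x).Holds d v ρ ↔ Ord (x.val d v ρ) := by
  rw [ord, holds_app, fun_one fun i => _]; rfl

instance Dfn.ord {E : Type} [Env M E] (f : E → M) [hf : DfnFun f] :
    Dfn M (no_index (fun e => Ord (f e))) :=
  (Dfn.realize ordR ![f] (Fin.forall_fin_one.2 hf)).of_iff fun e => by
    rw [fun_one fun i => _]; rfl

theorem binaryRules_ord : BinaryRules (OrdRules (M := M)) where
  mono X Y h u := by
    rintro (h' | ⟨e, k, r, h₁, h₂, h₃, h'⟩)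
    · exact Or.inl h'
    · exact Or.inr ⟨e, k, r, h _ h₁, h₂, h _ h₃, h'⟩
  binary X u := by
    rintro (h' | ⟨e, k, r, h₁, h₂, h₃, h'⟩)
    · exact Or.inl fun _ => Or.inl h'
    · exact Or.inr ⟨_, _, h₁, h₃, fun Y h₁ h₃ => Or.inr ⟨e, k, r, h₁, h₂, h₃, h'⟩⟩

theorem ord_iff {x : M} : Ord x ↔ OrdRules Ord x := by
  have key : ∀ x : M, Ord x ↔ Derivable OrdRules x := fun x => by
    unfold Ord ordR
    refine realize_derivable OrdRules _ (fun ρ => rfl) fun ρ => ?_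
    simp [OrdRules]
  rw [key, binaryRules_ord.derivable_iff]
  simp only [OrdRules, ← key]

end Relations

/-! ### Powers and complete base representations -/

section Bases

variable {M : Type} [PAModel M]

theorem exists_pow (b n : M) : ∃ y, Pow b n y := by
  refine pa_induction (P := fun n : M => ∃ y, Pow b n y) ⟨1, pow_iff.2 (Or.inl ⟨rfl, rfl⟩)⟩
    (fun n ⟨y, hy⟩ => ⟨y * b, pow_iff.2 (Or.inr ⟨n, y, hy, rfl, rfl⟩)⟩) n

theorem pow_unique (b n : M) : ∀ y y', Pow b n y → Pow b n y' → y = y' := by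
  refine pa_induction (P := fun n : M => ∀ y y', Pow b n y → Pow b n y' → y = y') ?_ ?_ n
  · intro y y' h h'
    rw [pow_iff] at h h'
    simp only [true_and, (add_one_ne_zero' _).symm, false_and, and_false, exists_false,
      or_false] at h h'
    rw [h, h']
  · intro n ih y y' h h'
    rw [pow_iff] at h h'
    simp only [add_one_ne_zero', false_and, false_or, add_left_inj] at h h'
    obtain ⟨_, z, hz, rfl, rfl⟩ := h
    obtain ⟨_, z', hz', rfl, rfl⟩ := h'
    rw [ih z z' hz hz']

/-- The power `b ^ n` in `M`. -/
noncomputable def pw (b n : M) : M := (exists_pow b n).choose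

theorem pow_iff_eq {b n y : M} : Pow b n y ↔ y = pw b n :=
  ⟨fun h => pow_unique b n _ _ h (exists_pow b n).choose_spec, fun h =>
    h ▸ (exists_pow b n).choose_spec⟩

instance DfnFun.pw {E : Type} [Env M E] (f g : E → M) [DfnFun f] [DfnFun g] :
    DfnFun (no_index (fun e => pw (f e) (g e))) := by
  have := DfnFun.weaken (M := M) f
  have := DfnFun.weaken (M := M) g
  exact ⟨(inferInstance : Dfn M fun p : E × M => Pow (f p.1) (g p.1) p.2).of_iff
    fun _ => pow_iff_eq.symm⟩

theorem pw_zero (b : M) : pw b 0 = 1 := (pow_iff_eq.1 (pow_iff.2 (Or.inl ⟨rfl, rfl⟩))).symm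

theorem pw_succ (b n : M) : pw b (n + 1) = pw b n * b :=
  (pow_iff_eq.1 (pow_iff.2 (Or.inr ⟨n, pw b n, pow_iff_eq.2 rfl, rfl, rfl⟩))).symm

theorem one_lt_of_two_le {b : M} (hb : 2 ≤ b) : 1 < b := one_lt_two.trans_le hb

theorem pos_of_two_le {b : M} (hb : 2 ≤ b) : 0 < b := zero_lt_two.trans_le hb

theorem pw_pos {b : M} (hb : 2 ≤ b) (n : M) : 0 < pw b n := by
  refine pa_induction (P := fun n => 0 < pw b n) (by rw [pw_zero]; exact one_pos) (fun n h => ?_) n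
  rw [pw_succ]
  exact mul_pos h (pos_of_two_le hb)

theorem pw_succ_le {b : M} (hb : 2 ≤ b) {n n' : M} (h : n < n') : pw b (n + 1) ≤ pw b n' := by
  obtain ⟨z, rfl⟩ := lt_def.1 h
  refine pa_induction (P := fun z => pw b (n + 1) ≤ pw b (n + (z + 1))) (by rw [zero_add])
    (fun z ih => ih.trans ?_) z
  rw [← add_assoc n (z + 1), pw_succ b (n + (z + 1))]
  exact le_mul_of_one_le_right zero_le (one_lt_of_two_le hb).le

theorem pw_lt_pw_succ {b : M} (hb : 2 ≤ b) (n : M) : pw b n < pw b (n + 1) := by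
  rw [pw_succ]
  exact lt_mul_of_one_lt_right (pw_pos hb n) (one_lt_of_two_le hb)

theorem pw_le_pw {b : M} (hb : 2 ≤ b) {n n' : M} (h : n ≤ n') : pw b n ≤ pw b n' := by
  rcases h.eq_or_lt with rfl | h
  exacts [le_rfl, (pw_lt_pw_succ hb n).le.trans (pw_succ_le hb h)]

theorem lt_pw {b : M} (hb : 2 ≤ b) (n : M) : n < pw b n := by
  refine pa_induction (P := fun n => n < pw b n) (pw_pos hb 0) (fun n h => ?_) n
  exact (add_one_le_iff.2 h).trans_lt (pw_lt_pw_succ hb n)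

/-- The leading term of the `b`-representation of `m`: `m = b ^ n * k + r` with `0 < k < b` and
`r < b ^ n`. -/
structure Leading (b m n k r : M) : Prop where
  pos : 0 < k
  lt : k < b
  rest : r < pw b n
  eq : m = pw b n * k + r

theorem exists_leading {b : M} (hb : 2 ≤ b) (m : M) : m = 0 ∨ ∃ n k r, Leading b m n k r := by
  suffices m = 0 ∨ ∃ n k r, (0 < k ∧ k < b) ∧ r < pw b n ∧ m = pw b n * k + r by
    rcases this with h | ⟨n, k, r, ⟨h₁, h₂⟩, h₃, h₄⟩
    exacts [Or.inl h, Or.inr ⟨n, k, r, h₁, h₂, h₃, h₄⟩]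
  refine pa_induction (P := fun m => m = 0 ∨ ∃ n k r, (0 < k ∧ k < b) ∧ r < pw b n ∧
    m = pw b n * k + r) (Or.inl rfl) (fun m ih => Or.inr ?_) m
  rcases ih with rfl | ⟨n, k, r, ⟨hk, hkb⟩, hr, rfl⟩
  · exact ⟨0, 1, 0, ⟨one_pos, one_lt_of_two_le hb⟩, pw_pos hb 0, by rw [pw_zero]; ring⟩
  rcases (add_one_le_iff.2 hr).lt_or_eq with h | h
  · exact ⟨n, k, r + 1, ⟨hk, hkb⟩, h, by ring⟩
  rcases (add_one_le_iff.2 hkb).lt_or_eq with h' | h'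
  · exact ⟨n, k + 1, 0, ⟨by simp, h'⟩, pw_pos hb n, by rw [add_assoc, h]; ring⟩
  · exact ⟨n + 1, 1, 0, ⟨one_pos, one_lt_of_two_le hb⟩, pw_pos hb _, by
      rw [pw_succ, add_assoc, h, ← h']; ring⟩

namespace Leading

variable {b m n k r m' n' k' r' : M}

theorem pw_le (h : Leading b m n k r) : pw b n ≤ m := by
  rw [h.eq]
  exact (le_mul_of_one_le_right zero_le (pos_iff_one_le.1 h.pos)).trans le_self_add

theorem lt_mul_succ (h : Leading b m n k r) : m < pw b n * (k + 1) := by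
  rw [h.eq, mul_add, mul_one]
  exact add_lt_add_right h.rest _

theorem lt_pw_succ (h : Leading b m n k r) : m < pw b (n + 1) := by
  rw [pw_succ]
  exact h.lt_mul_succ.trans_le (mul_le_mul_right (add_one_le_iff.2 h.lt) _)

theorem exponent_lt (hb : 2 ≤ b) (h : Leading b m n k r) : n < m := (lt_pw hb n).trans_le h.pw_le

theorem rest_lt (h : Leading b m n k r) : r < m := h.rest.trans_le h.pw_le

/-- The order of numbers is the lexicographic order of their representations. -/
theorem lt_of_lex (hb : 2 ≤ b) (h : Leading b m n k r) (h' : Leading b m' n' k' r')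
    (hlex : n < n' ∨ n = n' ∧ (k < k' ∨ k = k' ∧ r < r')) : m < m' := by
  rcases hlex with hn | ⟨rfl, hk | ⟨rfl, hr⟩⟩
  · exact h.lt_pw_succ.trans_le ((pw_succ_le hb hn).trans h'.pw_le)
  · refine h.lt_mul_succ.trans_le ?_
    rw [h'.eq]
    exact (mul_le_mul_right (add_one_le_iff.2 hk) _).trans le_self_add
  · rw [h.eq, h'.eq]
    exact add_lt_add_right hr _

theorem trichotomy (hb : 2 ≤ b) (h : Leading b m n k r) (h' : Leading b m' n' k' r') :
    (n < n' ∨ n = n' ∧ (k < k' ∨ k = k' ∧ r < r')) ∨ (n = n' ∧ k = k' ∧ r = r') ∨ m' < m := by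
  rcases lt_trichotomy n n' with hn | hn | hn
  · exact Or.inl (Or.inl hn)
  · rcases lt_trichotomy k k' with hk | hk | hk
    · exact Or.inl (Or.inr ⟨hn, Or.inl hk⟩)
    · rcases lt_trichotomy r r' with hr | hr | hr
      · exact Or.inl (Or.inr ⟨hn, Or.inr ⟨hk, hr⟩⟩)
      · exact Or.inr (Or.inl ⟨hn, hk, hr⟩)
      · exact Or.inr (Or.inr (lt_of_lex hb h' h (Or.inr ⟨hn.symm, Or.inr ⟨hk.symm, hr⟩⟩)))
    · exact Or.inr (Or.inr (lt_of_lex hb h' h (Or.inr ⟨hn.symm, Or.inl hk⟩)))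
  · exact Or.inr (Or.inr (lt_of_lex hb h' h (Or.inl hn)))

theorem lex_of_lt (hb : 2 ≤ b) (h : Leading b m n k r) (h' : Leading b m' n' k' r')
    (hlt : m < m') : n < n' ∨ n = n' ∧ (k < k' ∨ k = k' ∧ r < r') := by
  rcases trichotomy hb h h' with h₁ | ⟨rfl, rfl, rfl⟩ | h₁
  · exact h₁
  · exact absurd (h.eq.trans h'.eq.symm) hlt.ne
  · exact absurd h₁ hlt.asymm

theorem unique (hb : 2 ≤ b) (h : Leading b m n k r) (h' : Leading b m n' k' r') :
    n = n' ∧ k = k' ∧ r = r' := by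
  rcases trichotomy hb h h' with h₁ | h₁ | h₁
  · exact absurd (lt_of_lex hb h h' h₁) (lt_irrefl _)
  · exact h₁
  · exact absurd h₁ (lt_irrefl _)

theorem ne_zero (h : Leading b m n k r) : m ≠ 0 := (zero_le.trans_lt h.rest_lt).ne'

end Leading

/-- Recursion along the complete base representation: the rules for a change of base define a
function. -/
theorem base_recursion {b : M} (hb : 2 ≤ b) (C : M → M → M → M)
    (hC : Dfn M fun p : M × M => Derivable (BaseRules b C) (pair p.1 p.2)) :
    ∃ F : M → M, (∀ m r, Derivable (BaseRules b C) (pair m r) ↔ r = F m) ∧ F 0 = 0 ∧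
      ∀ m n k r, Leading b m n k r → F m = C (F n) k (F r) := by
  set R : M → M → Prop := fun m r => Derivable (BaseRules b C) (pair m r) with hRdef
  have (E : Type) [Env M E] (f g : E → M) [DfnFun f] [DfnFun g] : Dfn M fun e => R (f e) (g e) :=
    hC.comp₂ (P := R) f g
  have hR : ∀ m x, R m x ↔ (m = 0 ∧ x = 0) ∨ ∃ n k r n' r', Leading b m n k r ∧ R n n' ∧ R r r' ∧
      x = C n' k r' := by
    intro m x
    simp only [hRdef]
    rw [(binaryRules_base b C).derivable_iff]
    simp only [BaseRules, pair_inj]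
    refine or_congr Iff.rfl ⟨?_, ?_⟩
    · rintro ⟨n, k, m', p, n', r', h₁, h₂, h₃, h₄, h₅, h₆, h₇, h₈⟩
      rw [pow_iff_eq] at h₁
      subst h₁
      exact ⟨n, k, m', n', r', ⟨h₂, h₃, h₄, h₇⟩, h₅, h₆, h₈⟩
    · rintro ⟨n, k, r, n', r', h, h₅, h₆, h₈⟩
      exact ⟨n, k, r, _, n', r', pow_iff_eq.2 rfl, h.pos, h.lt, h.rest, h₅, h₆, h.eq, h₈⟩
  have key : ∀ m, ∃ x, R m x ∧ ∀ y, R m y → y = x := by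
    refine pa_strong_induction fun m ih => ?_
    rcases exists_leading hb m with rfl | ⟨n, k, r, h⟩
    · refine ⟨0, (hR _ _).2 (Or.inl ⟨rfl, rfl⟩), fun y hy => ?_⟩
      rcases (hR _ _).1 hy with h | ⟨_, _, _, _, _, h, -⟩
      exacts [h.2, (h.ne_zero rfl).elim]
    · obtain ⟨n', hn', hn''⟩ := ih n (h.exponent_lt hb)
      obtain ⟨r', hr', hr''⟩ := ih r h.rest_lt
      refine ⟨C n' k r', (hR _ _).2 (Or.inr ⟨n, k, r, n', r', h, hn', hr', rfl⟩), fun y hy => ?_⟩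
      rcases (hR _ _).1 hy with h₀ | ⟨n₁, k₁, r₁, n₁', r₁', h₁, h₂, h₃, rfl⟩
      · exact (h.ne_zero h₀.1).elim
      · obtain ⟨rfl, rfl, rfl⟩ := h.unique hb h₁
        rw [hn'' _ h₂, hr'' _ h₃]
  choose F hF hF' using key
  refine ⟨F, fun m r => ⟨hF' m r, fun h => h ▸ hF m⟩, 
    (hF' 0 0 ((hR _ _).2 (Or.inl ⟨rfl, rfl⟩))).symm, fun m n k r h =>
      (hF' _ _ ((hR _ _).2 (Or.inr ⟨n, k, r, F n, F r, h, hF n, hF r, rfl⟩))).symm⟩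

open Classical in
/-- The number that results from `m` by the change of the base `b` to `c`.  For `b < 2` the value
`0` is a dummy. -/
noncomputable def shift (b c m : M) : M := if 2 ≤ b then Classical.epsilon (BaseChange b c m) else 0

open Classical in
/-- The ordinal that results from `m` if the base `b` of the complete representation is replaced by
`ω`.  For `b < 2` the value `0` is a dummy. -/
noncomputable def toOrd (b m : M) : M :=
  if 2 ≤ b then Classical.epsilon fun x => Derivable (BaseRules b ocons) (pair m x) else 0

theorem shift_spec {b : M} (hb : 2 ≤ b) (c : M) :
    (∀ m r, BaseChange b c m r ↔ r = shift b c m) ∧ shift b c 0 = 0 ∧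
      ∀ m n k r, Leading b m n k r →
        shift b c m = pw c (shift b c n) * k + shift b c r := by
  have h := fun m r => baseChange_iff (b := b) (c := c) (m := m) (r := r) (pw c)
    fun n q => pow_iff_eq
  obtain ⟨F, h₁, h₂, h₃⟩ := base_recursion hb (fun n k r => pw c n * k + r)
    ((inferInstance : Dfn M fun p : M × M => BaseChange b c p.1 p.2).of_iff fun p => (h _ _).symm)
  simp only [← h] at h₁
  have hF : shift b c = F := by
    funext m
    rw [shift, if_pos hb]
    exact (h₁ _ _).1 (Classical.epsilon_spec ⟨F m, (h₁ _ _).2 rfl⟩)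
  rw [hF]
  exact ⟨h₁, h₂, h₃⟩

instance DfnFun.shift {E : Type} [Env M E] (f g h : E → M) [DfnFun f] [DfnFun g] [DfnFun h] :
    DfnFun (no_index (fun e => shift (f e) (g e) (h e))) := by
  have := DfnFun.weaken (M := M) f
  have := DfnFun.weaken (M := M) g
  have := DfnFun.weaken (M := M) h
  refine ⟨(inferInstance : Dfn M fun p : E × M => (2 ≤ f p.1 ∧
    BaseChange (f p.1) (g p.1) (h p.1) p.2) ∨ (¬ 2 ≤ f p.1 ∧ p.2 = 0)).of_iff fun p => ?_⟩
  by_cases hb : 2 ≤ f p.1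
  · simp only [hb, (shift_spec hb _).1, true_and, not_true, false_and, or_false]
  · simp [hb, GoodsteinPA.shift]

instance Dfn.toOrdRules {E : Type} [Env M E] (f g h : E → M) [DfnFun f] [DfnFun g] [DfnFun h] :
    Dfn M (no_index (fun e => Derivable (BaseRules (f e) GoodsteinPA.ocons)
      (GoodsteinPA.pair (g e) (h e)))) := by
  have h0 : Dfn M fun p : (M × M) × M =>
      Derivable (BaseRules p.1.1 GoodsteinPA.ocons) (GoodsteinPA.pair p.1.2 p.2) := by
    simp only [Derivable, BaseRules]
    infer_instance
  exact h0.comp₃ (P := fun x y z : M => Derivable (BaseRules x GoodsteinPA.ocons)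
    (GoodsteinPA.pair y z)) f g h

theorem toOrd_spec {b : M} (hb : 2 ≤ b) :
    (∀ m r, Derivable (BaseRules b ocons) (pair m r) ↔ r = toOrd b m) ∧ toOrd b 0 = 0 ∧
      ∀ m n k r, Leading b m n k r → toOrd b m = ocons (toOrd b n) k (toOrd b r) := by
  obtain ⟨F, h₁, h₂, h₃⟩ := base_recursion hb ocons inferInstance
  have hF : toOrd b = F := by
    funext m
    rw [toOrd, if_pos hb]
    exact (h₁ _ _).1 (Classical.epsilon_spec
      (p := fun x => Derivable (BaseRules b ocons) (pair m x)) ⟨F m, (h₁ _ _).2 rfl⟩)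
  rw [hF]
  exact ⟨h₁, h₂, h₃⟩

instance DfnFun.toOrd {E : Type} [Env M E] (f g : E → M) [DfnFun f] [DfnFun g] :
    DfnFun (no_index (fun e => toOrd (f e) (g e))) := by
  have := DfnFun.weaken (M := M) f
  have := DfnFun.weaken (M := M) g
  refine ⟨(inferInstance : Dfn M fun p : E × M => (2 ≤ f p.1 ∧
    Derivable (BaseRules (f p.1) GoodsteinPA.ocons) (GoodsteinPA.pair (g p.1) p.2)) ∨
      (¬ 2 ≤ f p.1 ∧ p.2 = 0)).of_iff fun p => ?_⟩
  by_cases hb : 2 ≤ f p.1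
  · simp only [hb, (toOrd_spec hb).1, true_and, not_true, false_and, or_false]
  · simp [hb, GoodsteinPA.toOrd]

theorem shift_zero {b : M} (hb : 2 ≤ b) (c : M) : shift b c 0 = 0 := (shift_spec hb c).2.1

theorem toOrd_zero {b : M} (hb : 2 ≤ b) : toOrd b 0 = 0 := (toOrd_spec hb).2.1

theorem Leading.shift_eq {b m n k r : M} (hb : 2 ≤ b) (h : Leading b m n k r) (c : M) :
    shift b c m = pw c (shift b c n) * k + shift b c r := (shift_spec hb c).2.2 m n k r h

theorem Leading.toOrd_eq {b m n k r : M} (hb : 2 ≤ b) (h : Leading b m n k r) :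
    toOrd b m = ocons (toOrd b n) k (toOrd b r) := (toOrd_spec hb).2.2 m n k r h

/-- The change of base is strictly increasing. -/
theorem shift_lt_shift {b c : M} (hb : 2 ≤ b) (hc : b ≤ c) :
    ∀ m' m, m < m' → shift b c m < shift b c m' := by
  have hc2 := hb.trans hc
  refine pa_strong_induction fun m' ih m hm => ?_
  rcases exists_leading hb m' with rfl | ⟨n', k', r', h'⟩
  · exact (not_lt_zero hm).elim
  have hpos : pw c (shift b c n') ≤ shift b c m' := by
    rw [h'.shift_eq hb]
    exact (le_mul_of_one_le_right zero_le (pos_iff_one_le.1 h'.pos)).trans le_self_add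
  rcases exists_leading hb m with rfl | ⟨n, k, r, h⟩
  · rw [shift_zero hb]
    exact (pw_pos hc2 _).trans_le hpos
  -- `b ^ n` goes to `c ^ shift n`, so that remainders stay remainders
  have hpow : shift b c (pw b n) = pw c (shift b c n) := by
    have : Leading b (pw b n) n 1 0 := ⟨one_pos, one_lt_of_two_le hb, pw_pos hb n, by ring⟩
    rw [this.shift_eq hb, shift_zero hb]; ring
  have hr : shift b c r < pw c (shift b c n) := by
    rw [← hpow]
    exact ih _ (h.pw_le.trans_lt hm) r h.rest
  have hL : Leading c (shift b c m) (shift b c n) k (shift b c r) :=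
    ⟨h.pos, h.lt.trans_le hc, hr, h.shift_eq hb c⟩
  rcases h.lex_of_lt hb h' hm with hn | ⟨rfl, hk | ⟨rfl, hr'⟩⟩
  · exact hL.lt_pw_succ.trans_le
      ((pw_succ_le hc2 (ih n' (h'.exponent_lt hb) n hn)).trans hpos)
  · refine hL.lt_mul_succ.trans_le ?_
    rw [h'.shift_eq hb]
    exact (mul_le_mul_right (add_one_le_iff.2 hk) _).trans le_self_add
  · rw [h'.shift_eq hb, h.shift_eq hb]
    exact add_lt_add_right (ih r' h'.rest_lt r hr') _

theorem shift_le_shift {b c : M} (hb : 2 ≤ b) (hc : b ≤ c) {m m' : M} (h : m ≤ m') :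
    shift b c m ≤ shift b c m' := by
  rcases h.eq_or_lt with rfl | h
  exacts [le_rfl, (shift_lt_shift hb hc _ _ h).le]

/-- The change of base takes the leading term to the leading term. -/
theorem Leading.shift {b c m n k r : M} (hb : 2 ≤ b) (hc : b ≤ c) (h : Leading b m n k r) :
    Leading c (shift b c m) (shift b c n) k (shift b c r) := by
  refine ⟨h.pos, h.lt.trans_le hc, ?_, h.shift_eq hb c⟩
  have : Leading b (pw b n) n 1 0 := ⟨one_pos, one_lt_of_two_le hb, pw_pos hb n, by ring⟩
  have hpow : GoodsteinPA.shift b c (pw b n) = pw c (GoodsteinPA.shift b c n) := by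
    rw [this.shift_eq hb, shift_zero hb]; ring
  rw [← hpow]
  exact shift_lt_shift hb hc _ _ h.rest

/-- A change of base does not affect the ordinal. -/
theorem toOrd_shift {b c : M} (hb : 2 ≤ b) (hc : b ≤ c) :
    ∀ m, toOrd c (shift b c m) = toOrd b m := by
  refine pa_strong_induction fun m ih => ?_
  rcases exists_leading hb m with rfl | ⟨n, k, r, h⟩
  · rw [shift_zero hb, toOrd_zero hb, toOrd_zero (hb.trans hc)]
  · rw [(h.shift hb hc).toOrd_eq (hb.trans hc), h.toOrd_eq hb, ih n (h.exponent_lt hb),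
      ih r h.rest_lt]

/-- The map to the ordinals is strictly increasing. -/
theorem toOrd_lt_toOrd {b : M} (hb : 2 ≤ b) : ∀ m' m, m < m' → OrdLt (toOrd b m) (toOrd b m') := by
  refine pa_strong_induction fun m' ih m hm => ?_
  rcases exists_leading hb m' with rfl | ⟨n', k', r', h'⟩
  · exact (not_lt_zero hm).elim
  rw [h'.toOrd_eq hb]
  rcases exists_leading hb m with rfl | ⟨n, k, r, h⟩
  · rw [toOrd_zero hb]
    exact zero_ordLt _ _ _
  rw [h.toOrd_eq hb, ocons_ordLt]
  rcases h.lex_of_lt hb h' hm with hn | ⟨rfl, hk | ⟨rfl, hr⟩⟩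
  · exact Or.inl (ih n' (h'.exponent_lt hb) n hn)
  · exact Or.inr (Or.inl ⟨rfl, hk⟩)
  · exact Or.inr (Or.inr ⟨rfl, rfl, ih r' h'.rest_lt r hr⟩)

theorem ord_toOrd {b : M} (hb : 2 ≤ b) : ∀ m, Ord (toOrd b m) := by
  refine pa_strong_induction fun m ih => ord_iff.2 ?_
  rcases exists_leading hb m with rfl | ⟨n, k, r, h⟩
  · exact Or.inl (toOrd_zero hb)
  refine Or.inr ⟨_, k, _, ih n (h.exponent_lt hb), h.pos, ih r h.rest_lt, ?_, h.toOrd_eq hb⟩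
  rcases exists_leading hb r with rfl | ⟨n', k', r', h'⟩
  · exact Or.inl (toOrd_zero hb)
  · refine Or.inr ⟨_, _, _, h'.toOrd_eq hb, toOrd_lt_toOrd hb _ _ ?_⟩
    by_contra hn
    exact (h.rest.trans_le (pw_le_pw hb (not_lt.1 hn))).not_ge h'.pw_le

theorem trip_lt_ocons (e k r : M) : e < ocons e k r ∧ k < ocons e k r ∧ r < ocons e k r := by
  simp only [ocons, lt_add_one_iff, trip]
  exact ⟨left_le_pair _ _, (left_le_pair _ _).trans (right_le_pair _ _),
    (right_le_pair _ _).trans (right_le_pair _ _)⟩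

theorem ordLt_asymm : ∀ x y : M, OrdLt x y → ¬ OrdLt y x := by
  refine pa_strong_induction fun x ih y hxy hyx => ?_
  rcases ordLt_rules.1 hxy with ⟨e, k, r, rfl, rfl⟩ | ⟨e, k, r, e', k', r', h, rfl, rfl⟩
  · exact not_ordLt_zero _ hyx
  have ihe := ih e (trip_lt_ocons e k r).1
  have ihr := ih r (trip_lt_ocons e k r).2.2
  rcases h with h | ⟨rfl, h⟩ | ⟨rfl, rfl, h⟩ <;>
    rcases ocons_ordLt.1 hyx with h' | ⟨h₁, h'⟩ | ⟨h₁, h₂, h'⟩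
  · exact ihe _ h h'
  · exact ihe _ h (h₁ ▸ h)
  · exact ihe _ h (h₁ ▸ h)
  · exact ihe _ h' h'
  · exact h.asymm h'
  · exact h.ne' h₂
  · exact ihe _ h' h'
  · exact lt_irrefl _ h'
  · exact ihr _ h h'

theorem lt_of_toOrd_lt {b : M} (hb : 2 ≤ b) {m m' : M} (h : OrdLt (toOrd b m) (toOrd b m')) :
    m < m' := by
  rcases lt_trichotomy m m' with h' | rfl | h'
  · exact h'
  · exact (ordLt_asymm _ _ h h).elim
  · exact (ordLt_asymm _ _ h (toOrd_lt_toOrd hb _ _ h')).elim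

/-- Every ordinal with coefficients below `b` comes from a number.  The code of an ordinal is a
bound for its coefficients. -/
theorem exists_toOrd_eq {b : M} (hb : 2 ≤ b) : ∀ x, Ord x → x < b → ∃ m, toOrd b m = x := by
  refine pa_strong_induction fun x ih hx hxb => ?_
  rcases ord_iff.1 hx with rfl | ⟨e, k, r, he, hk, hr, hr', rfl⟩
  · exact ⟨0, toOrd_zero hb⟩
  obtain ⟨he', hk', hr''⟩ := trip_lt_ocons e k r
  obtain ⟨n, hn⟩ := ih e he' he (he'.trans hxb)
  obtain ⟨s, hs⟩ := ih r hr'' hr (hr''.trans hxb)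
  have hlt : s < pw b n := by
    rcases exists_leading hb s with rfl | ⟨n', k', s', h'⟩
    · exact pw_pos hb n
    have h₁ := h'.toOrd_eq hb
    rw [hs] at h₁
    rcases hr' with rfl | ⟨e', k₁, r₁, rfl, hlt⟩
    · exact (ocons_ne_zero _ _ _ h₁.symm).elim
    · obtain ⟨rfl, -, -⟩ := ocons_inj.1 h₁
      rw [← hn] at hlt
      exact h'.lt_pw_succ.trans_le (pw_succ_le hb (lt_of_toOrd_lt hb hlt))
  refine ⟨pw b n * k + s, ?_⟩
  have hL : Leading b (pw b n * k + s) n k s := ⟨hk, hk'.trans hxb, hlt, rfl⟩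
  rw [hL.toOrd_eq hb, hn, hs]

end Bases

/-! ### Evaluation of codes of primitive recursive functions -/

section Evaluation

variable {M : Type} [PAModel M]

theorem DfnFun.comp {E : Type} [Env M E] {F : M → M} (hF : DfnFun F) (f : E → M) [DfnFun f] :
    DfnFun fun e => F (f e) := by
  have := DfnFun.weaken (M := M) f
  exact ⟨hF.graph.comp₂ (P := fun x y : M => y = F x) (fun p : E × M => f p.1) fun p => p.2⟩

instance Dfn.code {E : Type} [Env M E] (f : E → M) [hf : DfnFun f] :
    Dfn M (no_index (fun e => Code (f e))) :=
  (Dfn.realize codeR ![f] (Fin.forall_fin_one.2 hf)).of_iff fun e => by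
    rw [fun_one fun i => _]; rfl

instance Dfn.natPair {E : Type} [Env M E] (f g h : E → M) [DfnFun f] [DfnFun g] [DfnFun h] :
    Dfn M (no_index (fun e => NatPair (f e) (g e) (h e))) := by
  unfold NatPair; infer_instance

open Classical in
/-- The bijective pairing of Mathlib's `Nat.pair`, in the model. -/
noncomputable def npair (x y : M) : M := if x < y then y * y + x else x * x + x + y

theorem natPair_iff {x y z : M} : NatPair x y z ↔ z = npair x y := by
  unfold NatPair npair
  by_cases h : x < y
  · simp [h, h.not_ge]
  · simp [h, not_lt.1 h]

instance DfnFun.npair {E : Type} [Env M E] (f g : E → M) [DfnFun f] [DfnFun g] :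
    DfnFun (no_index (fun e => npair (f e) (g e))) := by
  have := DfnFun.weaken (M := M) f
  have := DfnFun.weaken (M := M) g
  exact ⟨(inferInstance : Dfn M fun p : E × M => NatPair (f p.1) (g p.1) p.2).of_iff
    fun _ => natPair_iff.symm⟩

theorem exists_npair_eq (w : M) : ∃ x y, w = npair x y := by
  simp only [← natPair_iff]
  refine pa_induction (P := fun w : M => ∃ x y, NatPair x y w) ⟨0, 0, Or.inr ⟨le_rfl, by ring⟩⟩
    (fun w ih => ?_) w
  rcases ih with ⟨x, y, ⟨h, rfl⟩ | ⟨h, rfl⟩⟩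
  · rcases (add_one_le_iff.2 h).lt_or_eq with h' | rfl
    · exact ⟨x + 1, y, Or.inl ⟨h', by ring⟩⟩
    · exact ⟨x + 1, 0, Or.inr ⟨zero_le, by ring⟩⟩
  · rcases h.lt_or_eq with h' | rfl
    · exact ⟨x, y + 1, Or.inr ⟨add_one_le_iff.2 h', by ring⟩⟩
    · exact ⟨0, y + 1, Or.inl ⟨by simp, by ring⟩⟩

theorem NatPair.inj {x y x' y' z : M} (h : NatPair x y z) (h' : NatPair x' y' z) :
    x = x' ∧ y = y' := by
  -- `z` lies in the interval from `s ^ 2` to `(s + 1) ^ 2`, where `s` is the maximum of the pair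
  have gap : ∀ {s s' t t' : M}, s < s' → t ≤ s + s → s * s + t ≠ s' * s' + t' := by
    intro s s' t t' hs ht he
    obtain ⟨u, rfl⟩ := lt_def.1 hs
    simp only [toDiff] at *
    nlinarith [ofM_nonneg u, ofM_nonneg s, ofM_nonneg t', mul_nonneg (ofM_nonneg u) (ofM_nonneg s),
      mul_nonneg (ofM_nonneg u) (ofM_nonneg u)]
  rcases h with ⟨h, rfl⟩ | ⟨h, rfl⟩ <;> rcases h' with ⟨h', e⟩ | ⟨h', e⟩
  · rcases lt_trichotomy y y' with hy | rfl | hy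
    · exact (gap hy (h.le.trans le_self_add) e).elim
    · exact ⟨add_left_cancel e, rfl⟩
    · exact (gap hy (h'.le.trans le_self_add) e.symm).elim
  · rw [add_assoc] at e
    rcases lt_trichotomy y x' with hy | rfl | hy
    · exact (gap hy (h.le.trans le_self_add) e).elim
    · exact ((add_left_cancel e).not_lt (h.trans_le le_self_add)).elim
    · exact (gap hy (add_le_add_right h' _) e.symm).elim
  · rw [add_assoc] at e
    rcases lt_trichotomy x y' with hy | rfl | hy
    · exact (gap hy (add_le_add_right h _) e).elim
    · exact ((add_left_cancel e).not_gt (h'.trans_le le_self_add)).elim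
    · exact (gap hy (h'.le.trans le_self_add) e.symm).elim
  · rw [add_assoc, add_assoc] at e
    rcases lt_trichotomy x x' with hy | rfl | hy
    · exact (gap hy (add_le_add_right h _) e).elim
    · exact ⟨rfl, add_left_cancel (add_left_cancel e)⟩
    · exact (gap hy (add_le_add_right h' _) e.symm).elim

/-- The first component of a pair. -/
noncomputable def unl (w : M) : M := (exists_npair_eq w).choose

/-- The second component of a pair. -/
noncomputable def unr (w : M) : M := (exists_npair_eq w).choose_spec.choose

theorem npair_unl_unr (w : M) : npair (unl w) (unr w) = w :=
  (exists_npair_eq w).choose_spec.choose_spec.symm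

theorem npair_inj {x y x' y' : M} (h : npair x y = npair x' y') : x = x' ∧ y = y' :=
  (natPair_iff.2 rfl).inj (natPair_iff.2 h)

@[simp] theorem unl_npair (x y : M) : unl (npair x y) = x := (npair_inj (npair_unl_unr _)).1

@[simp] theorem unr_npair (x y : M) : unr (npair x y) = y := (npair_inj (npair_unl_unr _)).2

/-- The code `e` computes the function `F`. -/
def Computes (e : M) (F : M → M) : Prop := ∀ x y, Eval e x y ↔ y = F x

/-- The rules of evaluation in terms of the pairing functions. -/
theorem eval_cases {e x y : M} : Eval e x y ↔
    (e = trip 0 0 0 ∧ y = 0) ∨ (e = trip 1 0 0 ∧ y = x + 1) ∨ (e = trip 2 0 0 ∧ y = unl x) ∨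
    (e = trip 3 0 0 ∧ y = unr x) ∨
    (∃ f g u v, e = trip 4 f g ∧ Eval f x u ∧ Eval g x v ∧ y = npair u v) ∨
    (∃ f g u, e = trip 5 f g ∧ Eval g x u ∧ Eval f u y) ∨
    ∃ f g, e = trip 6 f g ∧ ((∃ z, x = npair z 0 ∧ Eval f z y) ∨
      ∃ z n i, x = npair z (n + 1) ∧ Eval e (npair z n) i ∧
        Eval g (npair z (npair n i)) y) := by
  have h : ∀ e x y : M, (∃ e' x' y', trip e x y = trip e' x' y' ∧ Eval e' x' y') ↔ Eval e x y :=
    fun e x y => ⟨by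
      rintro ⟨e', x', y', h, h'⟩
      obtain ⟨rfl, rfl, rfl⟩ := trip_inj.1 h
      exact h', fun h => ⟨e, x, y, rfl, h⟩⟩
  rw [eval_iff]
  simp only [EvalRules, h, trip_inj (x := e), natPair_iff]
  constructor
  · rintro (⟨_, rfl, rfl, rfl⟩ | ⟨_, rfl, rfl, rfl⟩ |
      ⟨_, _, _, rfl, ⟨rfl, rfl, rfl⟩ | ⟨rfl, rfl, rfl⟩⟩ |
      ⟨f, g, _, u, v, _, h₁, h₂, rfl, rfl, rfl, rfl⟩ | ⟨f, g, _, u, _, h₁, h₂, rfl, rfl, rfl⟩ |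
      ⟨f, g, z, _, _, rfl, h₁, rfl, rfl, rfl⟩ |
      ⟨f, g, z, n, _, _, i, _, _, _, rfl, rfl, h₁, rfl, rfl, h₂, rfl, rfl, rfl⟩)
    · exact Or.inl ⟨rfl, rfl⟩
    · exact Or.inr (Or.inl ⟨rfl, rfl⟩)
    · exact Or.inr (Or.inr (Or.inl ⟨rfl, (unl_npair _ _).symm⟩))
    · exact Or.inr (Or.inr (Or.inr (Or.inl ⟨rfl, (unr_npair _ _).symm⟩)))
    · exact Or.inr (Or.inr (Or.inr (Or.inr (Or.inl ⟨f, g, u, v, rfl, h₁, h₂, rfl⟩))))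
    · exact Or.inr (Or.inr (Or.inr (Or.inr (Or.inr (Or.inl ⟨f, g, u, rfl, h₁, h₂⟩)))))
    · exact Or.inr (Or.inr (Or.inr (Or.inr (Or.inr (Or.inr
        ⟨f, g, rfl, Or.inl ⟨z, rfl, h₁⟩⟩)))))
    · exact Or.inr (Or.inr (Or.inr (Or.inr (Or.inr (Or.inr
        ⟨f, g, rfl, Or.inr ⟨z, n, i, rfl, h₁, h₂⟩⟩)))))
  · rintro (⟨rfl, rfl⟩ | ⟨rfl, rfl⟩ | ⟨rfl, rfl⟩ | ⟨rfl, rfl⟩ | ⟨f, g, u, v, rfl, h₁, h₂, rfl⟩ |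
      ⟨f, g, u, rfl, h₁, h₂⟩ | ⟨f, g, rfl, ⟨z, rfl, h₁⟩ | ⟨z, n, i, rfl, h₁, h₂⟩⟩)
    · exact Or.inl ⟨_, rfl, rfl, rfl⟩
    · exact Or.inr (Or.inl ⟨_, rfl, rfl, rfl⟩)
    · exact Or.inr (Or.inr (Or.inl
        ⟨_, _, _, (npair_unl_unr _).symm, Or.inl ⟨rfl, rfl, rfl⟩⟩))
    · exact Or.inr (Or.inr (Or.inl
        ⟨_, _, _, (npair_unl_unr _).symm, Or.inr ⟨rfl, rfl, rfl⟩⟩))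
    · exact Or.inr (Or.inr (Or.inr (Or.inl ⟨f, g, _, u, v, _, h₁, h₂, rfl, rfl, rfl, rfl⟩)))
    · exact Or.inr (Or.inr (Or.inr (Or.inr (Or.inl ⟨f, g, _, u, _, h₁, h₂, rfl, rfl, rfl⟩))))
    · exact Or.inr (Or.inr (Or.inr (Or.inr (Or.inr (Or.inl
        ⟨f, g, z, _, _, rfl, h₁, rfl, rfl, rfl⟩)))))
    · exact Or.inr (Or.inr (Or.inr (Or.inr (Or.inr (Or.inr
        ⟨f, g, z, n, _, _, i, _, _, _, rfl, rfl, h₁, rfl, rfl, h₂, rfl, rfl, rfl⟩)))))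

theorem computes_zero : Computes (trip 0 0 0 : M) fun _ => 0 := fun x y => by
  rw [eval_cases]; simp [trip_inj]

theorem computes_succ : Computes (trip 1 0 0 : M) fun x => x + 1 := fun x y => by
  rw [eval_cases]; simp [trip_inj]

theorem computes_unl : Computes (trip 2 0 0 : M) unl := fun x y => by
  rw [eval_cases]; simp [trip_inj]

theorem computes_unr : Computes (trip 3 0 0 : M) unr := fun x y => by
  rw [eval_cases]; simp [trip_inj]

theorem Computes.pair {f g : M} {F G : M → M} (hf : Computes f F) (hg : Computes g G) :
    Computes (trip 4 f g) fun x => npair (F x) (G x) := fun x y => by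
  rw [eval_cases]
  simp only [trip_inj]
  simp [← and_assoc]
  simp [and_assoc, hf _ _, hg _ _]

theorem Computes.comp {f g : M} {F G : M → M} (hf : Computes f F) (hg : Computes g G) :
    Computes (trip 5 f g) fun x => F (G x) := fun x y => by
  rw [eval_cases]
  simp only [trip_inj]
  simp [hf _ _, hg _ _]

theorem eval_recursion {f g x y : M} : Eval (trip 6 f g) x y ↔ (∃ z, x = npair z 0 ∧ Eval f z y) ∨
    ∃ z n i, x = npair z (n + 1) ∧ Eval (trip 6 f g) (npair z n) i ∧
      Eval g (npair z (npair n i)) y := by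
  rw [eval_cases]
  simp [trip_inj]

/-- The values of a primitive recursion exist by induction on its last argument. -/
theorem Computes.prec {f g : M} {F G : M → M} (hf : Computes f F) (hg : Computes g G) :
    ∃ H : M → M, Computes (trip 6 f g) H ∧ (∀ z, H (npair z 0) = F z) ∧
      ∀ z n, H (npair z (n + 1)) = G (npair z (npair n (H (npair z n)))) := by
  have h0 : ∀ z y, Eval (trip 6 f g) (npair z 0) y ↔ y = F z := fun z y => by
    rw [eval_recursion, ← hf]
    constructor
    · rintro (⟨z', h, h'⟩ | ⟨z', n, i, h, -⟩)
      · rwa [(npair_inj h).1]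
      · exact (add_one_ne_zero' _ (npair_inj h).2.symm).elim
    · exact fun h => Or.inl ⟨z, rfl, h⟩
  have hs : ∀ z n y, Eval (trip 6 f g) (npair z (n + 1)) y ↔
      ∃ i, Eval (trip 6 f g) (npair z n) i ∧ y = G (npair z (npair n i)) := fun z n y => by
    rw [eval_recursion]
    simp only [← hg _ _]
    constructor
    · rintro (⟨z', h, h'⟩ | ⟨z', n', i, h, h'⟩)
      · exact (add_one_ne_zero' _ (npair_inj h).2).elim
      · obtain ⟨rfl, hn⟩ := npair_inj h
        obtain rfl := add_right_cancel hn
        exact ⟨i, h'⟩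
    · exact fun ⟨i, h⟩ => Or.inr ⟨z, n, i, rfl, h⟩
  have key : ∀ x, ∃ y, ∀ y', Eval (trip 6 f g) x y' ↔ y' = y := by
    intro x
    obtain ⟨z, n, rfl⟩ := exists_npair_eq x
    refine pa_induction (P := fun n => ∃ y, ∀ y', Eval (trip 6 f g) (npair z n) y' ↔ y' = y)
      ⟨F z, h0 z⟩ (fun n ⟨y, hy⟩ => ⟨G (npair z (npair n y)), fun y' => ?_⟩) n
    simp [hs, hy]
  choose H hH using key
  refine ⟨H, hH, fun z => ((h0 _ _).1 ((hH _ _).2 rfl)), fun z n => ?_⟩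
  obtain ⟨i, hi, h⟩ := (hs z n _).1 ((hH _ _).2 rfl)
  rw [h, (hH _ _).1 hi]

/-- Every code computes a total function. -/
theorem Code.exists_computes : ∀ e : M, Code e → ∃ F, Computes e F := by
  suffices ∀ e : M, Code e → ∀ x, ∃ y, ∀ y', Eval e x y' ↔ y' = y by
    intro e he
    choose F hF using this e he
    exact ⟨F, hF⟩
  have fn : ∀ {e : M} {F : M → M}, Computes e F → ∀ x, ∃ y, ∀ y', Eval e x y' ↔ y' = y :=
    fun {_ F} h x => ⟨F x, h x⟩
  have lt_trip : ∀ {a f g : M}, 0 < a → f < trip a f g ∧ g < trip a f g := fun {a f g} ha => by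
    have h : pair f g < trip a f g := by
      have h₁ : pair f g < a + pair f g := lt_add_of_pos_left _ ha
      exact h₁.trans_le ((le_mul_of_one_le_right zero_le
        (pos_iff_one_le.1 (zero_le.trans_lt h₁))).trans le_self_add)
    exact ⟨(left_le_pair _ _).trans_lt h, (right_le_pair _ _).trans_lt h⟩
  refine pa_strong_induction fun e ih he => ?_
  rcases code_iff.1 he with rfl | rfl | rfl | rfl | ⟨f, g, hf, hg, h⟩
  · exact fn computes_zero
  · exact fn computes_succ
  · exact fn computes_unl
  · exact fn computes_unr
  have key : f < e → g < e → ∃ F G, Computes f F ∧ Computes g G := fun h₁ h₂ => by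
    choose F hF using ih f h₁ hf
    choose G hG using ih g h₂ hg
    exact ⟨F, G, hF, hG⟩
  rcases h with rfl | rfl | rfl
  · obtain ⟨F, G, hF, hG⟩ := key (lt_trip (by simp)).1 (lt_trip (by simp)).2
    exact fn (hF.pair hG)
  · obtain ⟨F, G, hF, hG⟩ := key (lt_trip (by simp)).1 (lt_trip (by simp)).2
    exact fn (hF.comp hG)
  · obtain ⟨F, G, hF, hG⟩ := key (lt_trip (by simp)).1 (lt_trip (by simp)).2
    obtain ⟨H, hH, -⟩ := hF.prec hG
    exact fn hH

end Evaluation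

/-! ### Closure properties of the primitive recursive functions of a model -/

section PrimitiveRecursive

variable {M : Type} [PAModel M]

/-- The function `F` has a code, possibly a nonstandard one.  This is a class in order that
instance search can find codes for explicitly defined functions. -/
class PR (F : M → M) : Prop where
  exists_code : ∃ e, Code e ∧ Computes e F

theorem Code.exists_pr {e : M} (h : Code e) : ∃ F, PR F ∧ Computes e F :=
  let ⟨F, hF⟩ := h.exists_computes
  ⟨F, ⟨e, h, hF⟩, hF⟩

theorem PR.dfnFun {F : M → M} (h : PR F) : DfnFun F := by
  obtain ⟨e, -, he⟩ := h
  exact ⟨(inferInstance : Dfn M fun p : M × M => Eval e p.1 p.2).of_iff fun p => (he _ _).symm⟩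

theorem PR.of_eq {F G : M → M} (h : PR F) (hFG : ∀ t, G t = F t) : PR G := by
  rwa [show G = F from funext hFG]

theorem code_rule {e f g : M} (hf : Code f) (hg : Code g)
    (h : e = trip 4 f g ∨ e = trip 5 f g ∨ e = trip 6 f g) : Code e :=
  code_iff.2 (Or.inr (Or.inr (Or.inr (Or.inr ⟨f, g, hf, hg, h⟩))))

theorem PR.comp {F : M → M} (hF : PR F) (G : M → M) [hG : PR G] : PR fun t => F (G t) := by
  obtain ⟨f, hf, hf'⟩ := hF
  obtain ⟨g, hg, hg'⟩ := hG
  exact ⟨_, code_rule hf hg (Or.inr (Or.inl rfl)), hf'.comp hg'⟩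

theorem pr_succ : PR fun x : M => x + 1 := ⟨_, code_iff.2 (Or.inr (Or.inl rfl)), computes_succ⟩

theorem pr_unl : PR (unl : M → M) :=
  ⟨_, code_iff.2 (Or.inr (Or.inr (Or.inl rfl))), computes_unl⟩

theorem pr_unr : PR (unr : M → M) :=
  ⟨_, code_iff.2 (Or.inr (Or.inr (Or.inr (Or.inl rfl)))), computes_unr⟩

instance PR.unl (F : M → M) [PR F] : PR (no_index (fun t => unl (F t))) := pr_unl.comp F

instance PR.unr (F : M → M) [PR F] : PR (no_index (fun t => unr (F t))) := pr_unr.comp F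

instance PR.npair (F G : M → M) [hF : PR F] [hG : PR G] :
    PR (no_index (fun t => npair (F t) (G t))) := by
  obtain ⟨f, hf, hf'⟩ := hF
  obtain ⟨g, hg, hg'⟩ := hG
  exact ⟨_, code_rule hf hg (Or.inl rfl), hf'.pair hg'⟩

instance PR.id : PR (no_index (fun t : M => t)) := by
  have := pr_unl (M := M)
  have := pr_unr (M := M)
  exact (inferInstance : PR fun t : M => GoodsteinPA.npair (GoodsteinPA.unl t)
    (GoodsteinPA.unr t)).of_eq fun t => (npair_unl_unr t).symm

-- the code for the constant function `a` contains `a` successors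
instance PR.const (a : M) : PR (no_index (fun _ : M => a)) := by
  have key := pa_induction (P := fun a : M => ∃ e, Code e ∧ ∀ x y, Eval e x y ↔ y = a)
    ⟨_, code_iff.2 (Or.inl rfl), computes_zero⟩ (fun a ⟨e, h, h'⟩ =>
      let ⟨f, hf, hf'⟩ := pr_succ (M := M)
      ⟨_, code_rule hf h (Or.inr (Or.inl rfl)),
        hf'.comp (F := fun x => x + 1) (G := fun _ => a) h'⟩) a
  exact ⟨key⟩

theorem PR.comp₂ {h : M → M → M} (hh : PR fun t => h (GoodsteinPA.unl t) (GoodsteinPA.unr t))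
    (A B : M → M) [PR A] [PR B] : PR fun t => h (A t) (B t) :=
  (hh.comp fun t => GoodsteinPA.npair (A t) (B t)).of_eq fun t => by rw [unl_npair, unr_npair]

/-- Primitive recursion with a parameter. -/
theorem PR.exists_rec (f : M → M) (g : M → M → M → M) (hf : PR f)
    (hg : PR fun t => g (GoodsteinPA.unl t) (GoodsteinPA.unl (GoodsteinPA.unr t))
      (GoodsteinPA.unr (GoodsteinPA.unr t))) :
    ∃ h : M → M → M, (PR fun t => h (GoodsteinPA.unl t) (GoodsteinPA.unr t)) ∧
      (∀ x, h x 0 = f x) ∧ ∀ x n, h x (n + 1) = g x n (h x n) := by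
  obtain ⟨a, ha, ha'⟩ := hf
  obtain ⟨b, hb, hb'⟩ := hg
  obtain ⟨H, hH, h0, hs⟩ := ha'.prec hb'
  refine ⟨fun x n => H (GoodsteinPA.npair x n), ⟨_, code_rule ha hb (Or.inr (Or.inr rfl)), ?_⟩, h0,
    fun x n => by simp [hs]⟩
  simpa only [npair_unl_unr] using hH

/-- A definable function that satisfies the equations of a primitive recursion is primitive
recursive. -/
theorem PR.of_rec {h : M → M → M} [hh : DfnFun fun p : M × M => h p.1 p.2] (f : M → M)
    (g : M → M → M → M) (h0 : ∀ x, h x 0 = f x) (hs : ∀ x n, h x (n + 1) = g x n (h x n))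
    (hf : PR f) (hg : PR fun t => g (GoodsteinPA.unl t) (GoodsteinPA.unl (GoodsteinPA.unr t))
      (GoodsteinPA.unr (GoodsteinPA.unr t))) :
    PR fun t => h (GoodsteinPA.unl t) (GoodsteinPA.unr t) := by
  obtain ⟨k, hk, hk0, hks⟩ := PR.exists_rec f g hf hg
  refine hk.of_eq fun t => ?_
  generalize GoodsteinPA.unl t = x
  have h₁ : DfnFun fun n => k x n := (hk.comp₂ (fun _ => x) fun n => n).dfnFun
  have h₂ : DfnFun fun n => h x n :=
    ⟨(hh.graph.comp₃ (P := fun x n y => y = h x n) (fun _ : M × M => x) (fun p => p.1)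
      fun p => p.2)⟩
  exact pa_induction (P := fun n => h x n = k x n) (by rw [h0, hk0])
    (fun n ih => by rw [hs, hks, ih]) (GoodsteinPA.unr t)

instance PR.add (F G : M → M) [PR F] [PR G] : PR (no_index (fun t => F t + G t)) :=
  (PR.of_rec (h := fun x y : M => x + y) (fun x => x) (fun _ _ i => i + 1) add_zero
    (fun x n => (add_assoc x n 1).symm) inferInstance (pr_succ.comp _)).comp₂ F G

instance PR.mul (F G : M → M) [PR F] [PR G] : PR (no_index (fun t => F t * G t)) :=
  (PR.of_rec (h := fun x y : M => x * y) (fun _ => 0) (fun x _ i => i + x) mul_zero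
    (fun x n => by ring) inferInstance inferInstance).comp₂ F G

theorem pr_pred (F : M → M) [PR F] : PR fun t => F t - 1 := by
  have : DfnFun fun p : M × M => p.2 - 1 := inferInstance
  have h := PR.of_rec (h := fun _ y : M => y - 1) (fun _ => 0) (fun _ n _ => n) (by simp)
    (by simp) inferInstance inferInstance
  exact PR.comp₂ (h := fun _ y : M => y - 1) h F F

instance PR.sub (F G : M → M) [PR F] [PR G] : PR (no_index (fun t => F t - G t)) :=
  (PR.of_rec (h := fun x y : M => x - y) (fun x => x) (fun _ _ i => i - 1) (by simp)
    (fun x n => (tsub_tsub x n 1).symm) inferInstance (pr_pred _)).comp₂ F G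

instance PR.pw (F G : M → M) [PR F] [PR G] : PR (no_index (fun t => pw (F t) (G t))) :=
  (PR.of_rec (h := fun x y : M => GoodsteinPA.pw x y) (fun _ => 1) (fun x _ i => i * x) pw_zero
    pw_succ inferInstance inferInstance).comp₂ F G

instance PR.ocons (F G H : M → M) [PR F] [PR G] [PR H] :
    PR (no_index (fun t => ocons (F t) (G t) (H t))) := by
  unfold GoodsteinPA.ocons trip pair; infer_instance

-- `1 - (1 - x)` is `0` or `1` according to whether `x` is zero, subtraction being truncated
instance PR.ite_lt (F G H K : M → M) [PR F] [PR G] [PR H] [PR K] :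
    PR (no_index (fun t => if F t < G t then H t else K t)) := by
  refine (inferInstance : PR fun t => H t * (1 - (1 - (G t - F t))) +
    K t * (1 - (G t - F t))).of_eq fun t => ?_
  split_ifs with h
  · have : 1 ≤ G t - F t := pos_iff_one_le.1 (tsub_pos_of_lt h)
    rw [tsub_eq_zero_of_le this]; simp
  · rw [tsub_eq_zero_of_le (not_lt.1 h)]; simp

/-- The exponent, the coefficient and the rest of the leading term of the `b`-representation of
`m + 1` are primitive recursive in `b` and `m`. -/
theorem exists_pr_leading : ∃ L : M → M → M, (PR fun t => L (unl t) (unr t)) ∧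
    ∀ b m, 2 ≤ b → Leading b (m + 1) (unl (L b m)) (unl (unr (L b m))) (unr (unr (L b m))) := by
  -- the triple of exponent, coefficient and rest is updated in the step from `m` to `m + 1`
  obtain ⟨L, hL, h0, hs⟩ := PR.exists_rec (M := M) (fun _ => npair 0 (npair 1 0)) (fun b _ s =>
    if unr (unr s) + 1 < pw b (unl s) then npair (unl s) (npair (unl (unr s)) (unr (unr s) + 1))
    else if unl (unr s) + 1 < b then npair (unl s) (npair (unl (unr s) + 1) 0)
    else npair (unl s + 1) (npair 1 0)) inferInstance (by infer_instance)
  refine ⟨L, hL, fun b m hb => ?_⟩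
  have h₁ : DfnFun fun m => L b m := (hL.comp₂ (fun _ => b) fun n => n).dfnFun
  have hl := pr_unl (M := M).dfnFun
  have hr := pr_unr (M := M).dfnFun
  have (E : Type) [Env M E] (f : E → M) [DfnFun f] : DfnFun fun e => unl (f e) := hl.comp f
  have (E : Type) [Env M E] (f : E → M) [DfnFun f] : DfnFun fun e => unr (f e) := hr.comp f
  have (E : Type) [Env M E] (f g h k : E → M) [DfnFun f] [DfnFun g] [DfnFun h] [DfnFun k] :
      Dfn M fun e => Leading b (f e) (g e) (h e) (k e) :=
    (inferInstance : Dfn M fun e => (0 < h e ∧ h e < b) ∧ k e < pw b (g e) ∧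
      f e = pw b (g e) * h e + k e).of_iff fun e =>
        ⟨fun h => ⟨⟨h.1, h.2⟩, h.3, h.4⟩, fun h => ⟨h.1.1, h.1.2, h.2.1, h.2.2⟩⟩
  refine pa_induction (P := fun m => Leading b (m + 1) (unl (L b m)) (unl (unr (L b m)))
    (unr (unr (L b m)))) ?_ (fun m ih => ?_) m
  · rw [h0]
    simp only [unl_npair, unr_npair]
    exact ⟨one_pos, one_lt_of_two_le hb, pw_pos hb _, by rw [pw_zero]; ring⟩
  rw [hs]
  generalize L b m = s at ih ⊢
  have he := ih.eq
  split_ifs with h h' <;> simp only [unl_npair, unr_npair]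
  · exact ⟨ih.pos, ih.lt, h, by rw [he]; ring⟩
  · have h₁ := (add_one_le_iff.2 ih.rest).antisymm (not_lt.1 h)
    exact ⟨by simp, h', pw_pos hb _, by rw [he, add_assoc, h₁]; ring⟩
  · have h₁ := (add_one_le_iff.2 ih.rest).antisymm (not_lt.1 h)
    have h₂ := (add_one_le_iff.2 ih.lt).antisymm (not_lt.1 h')
    exact ⟨one_pos, one_lt_of_two_le hb, pw_pos hb _, by
      rw [he, pw_succ, add_assoc, h₁]
      linear_combination pw b (unl s) * h₂⟩

/-- Recursion along the complete base representation leads to primitive recursive functions.  The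
base is `B t`, where `t` is a parameter.  The proof turns the recursion into a primitive recursion
for the history `H t m`, the list of the values at `m, …, 0`. -/
theorem exists_pr_base_recursion (B : M → M) (C : M → M → M → M → M) (hB : PR B)
    (hC : PR fun t => C (unl t) (unl (unr t)) (unl (unr (unr t))) (unr (unr (unr t)))) :
    ∃ F : M → M → M, (PR fun t => F (unl t) (unr t)) ∧ ∀ t, 2 ≤ B t → ∀ G : M → M, DfnFun G →
      G 0 = 0 → (∀ m n k r, Leading (B t) m n k r → G m = C t (G n) k (G r)) →
        ∀ m, F t m = G m := by
  have hC' (A₁ A₂ A₃ A₄ : M → M) [PR A₁] [PR A₂] [PR A₃] [PR A₄] :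
      PR fun t => C (A₁ t) (A₂ t) (A₃ t) (A₄ t) :=
    (hC.comp fun t => npair (A₁ t) (npair (A₂ t) (npair (A₃ t) (A₄ t)))).of_eq fun t => by simp
  have hB' (A : M → M) [PR A] : PR fun t => B (A t) := hB.comp A
  obtain ⟨L, hL, hLead⟩ := exists_pr_leading (M := M)
  have hL' (A₁ A₂ : M → M) [PR A₁] [PR A₂] : PR fun t => L (A₁ t) (A₂ t) := hL.comp₂ A₁ A₂
  -- `D x j` drops the first `j` entries of the list `x`
  obtain ⟨D, hD, hD0, hDs⟩ := PR.exists_rec (M := M) (fun x => x) (fun _ _ i => unr i)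
    inferInstance inferInstance
  have hD' (A₁ A₂ : M → M) [PR A₁] [PR A₂] : PR fun t => D (A₁ t) (A₂ t) := hD.comp₂ A₁ A₂
  obtain ⟨H, hH, hH0, hHs⟩ := PR.exists_rec (M := M) (fun _ => npair 0 0) (fun t m h =>
    npair (C t (unl (D h (m - unl (L (B t) m)))) (unl (unr (L (B t) m)))
      (unl (D h (m - unr (unr (L (B t) m)))))) h) inferInstance inferInstance
  have hH' (A₁ A₂ : M → M) [PR A₁] [PR A₂] : PR fun t => H (A₁ t) (A₂ t) := hH.comp₂ A₁ A₂
  refine ⟨fun t m => unl (H t m), inferInstance, fun t hb G hG hG0 hGs => ?_⟩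
  -- dropping `j` values from the history at `i + j` leads to the history at `i`
  have hdrop : ∀ j i, D (H t (i + j)) j = H t i := by
    have (E : Type) [Env M E] (f g : E → M) [DfnFun f] [DfnFun g] :
        DfnFun fun e => D (f e) (g e) := by
      have h : DfnFun fun w => D (unl w) (unr w) := hD.dfnFun
      exact cast (by simp) (h.comp fun e => npair (f e) (g e))
    have (E : Type) [Env M E] (f : E → M) [DfnFun f] : DfnFun fun e => H t (f e) :=
      DfnFun.comp (F := fun m => H t m) (hH' (fun _ => t) fun m => m).dfnFun f
    refine pa_induction (P := fun j : M => ∀ i, D (H t (i + j)) j = H t i)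
      (fun i => by rw [hD0, add_zero]) fun j ih i => ?_
    rw [hDs, ← add_assoc, add_right_comm, ih, hHs, unr_npair]
  have hlook : ∀ {x m}, x ≤ m → D (H t m) (m - x) = H t x := fun {x m} h => by
    have := hdrop (m - x) x
    rwa [add_sub_of_le' h] at this
  have hF : DfnFun fun m => unl (H t m) := PR.dfnFun inferInstance
  refine pa_strong_induction (P := fun m => unl (H t m) = G m) fun m ih => ?_
  rcases zero_or_succ m with rfl | ⟨m, rfl⟩
  · rw [hH0, hG0, unl_npair]
  have h := hLead (B t) m hb
  rw [hHs, unl_npair, hlook (lt_add_one_iff.1 (h.exponent_lt hb)),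
    hlook (lt_add_one_iff.1 h.rest_lt), ih _ (h.exponent_lt hb), ih _ h.rest_lt, hGs _ _ _ _ h]

end PrimitiveRecursive

/-! ### Goodstein sequences and descending sequences of ordinals in a model -/

section Equivalence

variable {M : Type} [PAModel M]

theorem exists_pr_toOrd : ∃ F : M → M → M, (PR fun t => F (unl t) (unr t)) ∧
    ∀ b, 2 ≤ b → ∀ m, F b m = toOrd b m := by
  obtain ⟨F, hF, h⟩ := exists_pr_base_recursion (M := M) (fun t => t) (fun _ n k r => ocons n k r)
    inferInstance inferInstance
  exact ⟨F, hF, fun b hb => h b hb (toOrd b) inferInstance (toOrd_zero hb)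
    fun m n k r hL => hL.toOrd_eq hb⟩

theorem exists_pr_shift : ∃ F : M → M → M, (PR fun t => F (unl t) (unr t)) ∧
    ∀ b c, 2 ≤ b → ∀ m, F (npair b c) m = shift b c m := by
  obtain ⟨F, hF, h⟩ := exists_pr_base_recursion (M := M) unl
    (fun t n k r => pw (unr t) n * k + r) pr_unl inferInstance
  refine ⟨F, hF, fun b c hb => h _ (by rwa [unl_npair]) (shift b c) inferInstance
    (shift_zero hb c) fun m n k r hL => ?_⟩
  rw [unl_npair] at hL
  rw [unr_npair]
  exact hL.shift_eq hb c

/-- A Goodstein sequence with primitive recursive bases is primitive recursive. -/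
theorem exists_pr_goodstein {e : M} {f : M → M} (hf : PR f) (he : Computes e f)
    (hb : ∀ i, 2 ≤ f i) (m : M) : ∃ g : M → M, PR g ∧ g 0 = m ∧
      (∀ i, g (i + 1) = shift (f i) (f (i + 1)) (g i) - 1) ∧
      ∀ i w, Goodstein e m i w ↔ w = g i := by
  obtain ⟨F, hF, hFs⟩ := exists_pr_shift (M := M)
  have hF' (A B : M → M) [PR A] [PR B] : PR fun t => F (A t) (B t) := hF.comp₂ A B
  have hf' (A : M → M) [PR A] : PR fun t => f (A t) := hf.comp A
  obtain ⟨G, hG, hG0, hGs⟩ := PR.exists_rec (M := M) (fun _ => m)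
    (fun _ n x => F (npair (f n) (f (n + 1))) x - 1) inferInstance (by infer_instance)
  have hg : PR fun i => G 0 i := hG.comp₂ (fun _ => 0) fun i => i
  refine ⟨fun i => G 0 i, hg, hG0 0, fun i => (hGs 0 i).trans (by rw [hFs _ _ (hb i)]), ?_⟩
  have (E : Type) [Env M E] (a : E → M) [DfnFun a] : DfnFun fun x => G 0 (a x) := hg.dfnFun.comp a
  refine pa_induction (P := fun i => ∀ w, Goodstein e m i w ↔ w = G 0 i) (fun w => ?_)
    fun i ih w => ?_
  · rw [goodstein_iff, hG0]
    simp [(add_one_ne_zero' _).symm]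
  rw [goodstein_iff, hGs, hFs _ _ (hb i)]
  constructor
  · rintro (⟨h, -⟩ | ⟨i', x, b, c, z, h₁, h₂, h₃, h₄, h₅, h₆⟩)
    · exact (add_one_ne_zero' _ h).elim
    obtain rfl := add_right_cancel h₆
    rw [he] at h₂ h₃
    subst h₂ h₃
    rw [(shift_spec (hb i) _).1, (ih _).1 h₁] at h₄
    rw [← h₄]
    rcases h₅ with rfl | ⟨rfl, rfl⟩
    exacts [(add_tsub_cancel_right w 1).symm, (zero_tsub 1).symm]
  · rintro rfl
    refine Or.inr ⟨i, _, _, _, _, (ih _).2 rfl, (he _ _).2 rfl, (he _ _).2 rfl,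
      ((shift_spec (hb i) _).1 _ _).2 rfl, ?_, rfl⟩
    rcases zero_or_succ (shift (f i) (f (i + 1)) (G 0 i)) with h | ⟨y, h⟩ <;> rw [h]
    · exact Or.inr ⟨rfl, zero_tsub 1⟩
    · exact Or.inl (by rw [add_tsub_cancel_right])

/-- If there is no primitive recursive descending sequence of ordinals, then the Goodstein
sequences terminate: otherwise the ordinals of the terms of a Goodstein sequence descend. -/
theorem goodstein_terminates (hno : ¬ ∃ e : M, Code e ∧ ∀ n, ∃ x y, Eval e n x ∧ Eval e (n + 1) y ∧
      Ord x ∧ Ord y ∧ OrdLt y x) {e : M} (he : Code e) (h0 : ∀ x, Eval e 0 x → 2 ≤ x)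
    (hmono : ∀ i x y, Eval e i x ∧ Eval e (i + 1) y → x ≤ y) (m : M) :
    ∃ k, ∀ i, k ≤ i → Goodstein e m i 0 := by
  obtain ⟨f, hf, hef⟩ := he.exists_pr
  have hf' := hf.dfnFun
  have hle : ∀ i, f i ≤ f (i + 1) := fun i => hmono i _ _ ⟨(hef _ _).2 rfl, (hef _ _).2 rfl⟩
  have hb : ∀ i, 2 ≤ f i := by
    have (E : Type) [Env M E] (a : E → M) [DfnFun a] : DfnFun fun x => f (a x) := hf'.comp a
    exact pa_induction (P := fun i => 2 ≤ f i) (h0 _ ((hef _ _).2 rfl)) fun i h => h.trans (hle i)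
  obtain ⟨g, hg, -, hgs, hgood⟩ := exists_pr_goodstein hf hef hb m
  simp only [hgood]
  by_contra! hn
  have hpos : ∀ k, g k ≠ 0 := fun k hk => by
    have (E : Type) [Env M E] (a : E → M) [DfnFun a] : DfnFun fun x => g (a x) := hg.dfnFun.comp a
    obtain ⟨i, hi, hi'⟩ := hn k
    obtain ⟨j, rfl⟩ := le_def.1 hi
    -- the sequence stays `0` from `k` on
    refine hi' (pa_induction (P := fun j => 0 = g (k + j)) (by rw [add_zero, hk])
      (fun j ih => ?_) j)
    rw [← add_assoc, hgs, ← ih, shift_zero (hb _), zero_tsub]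
  obtain ⟨F, hF, hFo⟩ := exists_pr_toOrd (M := M)
  obtain ⟨a, ha, ha'⟩ := hF.comp₂ f g
  refine hno ⟨a, ha, fun n => ⟨_, _, (ha' _ _).2 rfl, (ha' _ _).2 rfl, ?_⟩⟩
  simp only [hFo _ (hb _)]
  refine ⟨ord_toOrd (hb _) _, ord_toOrd (hb _) _, ?_⟩
  rw [← toOrd_shift (hb n) (hle n) (g n)]
  refine toOrd_lt_toOrd (hb _) _ _ ?_
  rw [hgs]
  have : 0 < shift (f n) (f (n + 1)) (g n) :=
    zero_le.trans_lt (shift_lt_shift (hb n) (hle n) _ _ (pos_of_ne_zero (hpos n)))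
  exact tsub_lt_self this one_pos

/-- If the Goodstein sequences terminate, then there is no primitive recursive descending sequence
of ordinals `α i`: with the bases `f i = 2 + α 0 + ⋯ + α i` and a suitable start, the term `i` of
the Goodstein sequence is at least the number whose ordinal with respect to `f i` is `α i`. -/
theorem no_descent (hterm : ∀ e : M, Code e → (∀ x, Eval e 0 x → 2 ≤ x) →
      (∀ i x y, Eval e i x ∧ Eval e (i + 1) y → x ≤ y) →
      ∀ m, ∃ k, ∀ i, k ≤ i → Goodstein e m i 0) {e : M} (he : Code e)
    (h : ∀ n, ∃ x y, Eval e n x ∧ Eval e (n + 1) y ∧ Ord x ∧ Ord y ∧ OrdLt y x) : False := by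
  obtain ⟨α, hα, heα⟩ := he.exists_pr
  have hord : ∀ n, Ord (α n) ∧ OrdLt (α (n + 1)) (α n) := fun n => by
    obtain ⟨x, y, hx, hy, h₁, -, h₂⟩ := h n
    rw [heα] at hx hy
    subst hx hy
    exact ⟨h₁, h₂⟩
  have hα' (A : M → M) [PR A] : PR fun t => α (A t) := hα.comp A
  have (E : Type) [Env M E] (a : E → M) [DfnFun a] : DfnFun fun x => α (a x) := hα.dfnFun.comp a
  obtain ⟨B, hB, hB0, hBs⟩ := PR.exists_rec (M := M) (fun _ => 2 + α 0)
    (fun _ n x => x + α (n + 1)) inferInstance (by infer_instance)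
  obtain ⟨f, hf, hf0, hfs⟩ : ∃ f : M → M, PR f ∧ f 0 = 2 + α 0 ∧ ∀ n, f (n + 1) = f n + α (n + 1) :=
    ⟨fun n => B 0 n, hB.comp₂ (fun _ => 0) fun n => n, hB0 0, hBs 0⟩
  have (E : Type) [Env M E] (a : E → M) [DfnFun a] : DfnFun fun x => f (a x) := hf.dfnFun.comp a
  have hle : ∀ i, f i ≤ f (i + 1) := fun i => by rw [hfs]; exact le_self_add
  have hb : ∀ i, 2 ≤ f i := pa_induction (P := fun i => 2 ≤ f i) (by rw [hf0]; exact le_self_add)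
    fun i h => h.trans (hle i)
  have hlt : ∀ i, α i < f i := fun i => by
    rcases zero_or_succ i with rfl | ⟨i, rfl⟩
    · rw [hf0]
      exact lt_add_of_pos_left _ zero_lt_two
    · rw [hfs]
      exact lt_add_of_pos_left _ (pos_of_two_le (hb i))
  have hex : ∀ i, ∃ a, toOrd (f i) a = α i := fun i =>
    exists_toOrd_eq (hb i) _ (hord i).1 (hlt i)
  obtain ⟨c, hc, hcf⟩ := id hf
  obtain ⟨m, hm⟩ := hex 0
  obtain ⟨g, hg, hg0, hgs, hgood⟩ := exists_pr_goodstein hf hcf hb m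
  obtain ⟨k, hk⟩ := hterm c hc (fun x hx => by rw [(hcf _ _).1 hx]; exact hb 0)
    (fun i x y ⟨hx, hy⟩ => by rw [(hcf _ _).1 hx, (hcf _ _).1 hy]; exact hle i) m
  have (E : Type) [Env M E] (a : E → M) [DfnFun a] : DfnFun fun x => g (a x) := hg.dfnFun.comp a
  have key : ∀ i a, toOrd (f i) a = α i → a ≤ g i := by
    refine pa_induction (P := fun i => ∀ a, toOrd (f i) a = α i → a ≤ g i) (fun a ha => ?_)
      fun i ih a' ha' => ?_
    · rw [hg0]
      by_contra hn
      have := toOrd_lt_toOrd (hb 0) _ _ (not_le.1 hn)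
      rw [hm, ha] at this
      exact ordLt_asymm _ _ this this
    obtain ⟨a, ha⟩ := hex i
    have h₁ : a' < shift (f i) (f (i + 1)) a := lt_of_toOrd_lt (hb (i + 1)) (by
      rw [ha', toOrd_shift (hb i) (hle i), ha]
      exact (hord i).2)
    rw [hgs]
    exact le_tsub_of_add_le_right
      (add_one_le_iff.2 (h₁.trans_le (shift_le_shift (hb i) (hle i) (ih a ha))))
  obtain ⟨a, ha⟩ := hex k
  have h₁ := key k a ha
  rw [← (hgood k 0).1 (hk k le_rfl), nonpos_iff_eq_zero] at h₁
  have h₂ := (hord k).2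
  rw [← ha, h₁, toOrd_zero (hb k)] at h₂
  exact not_ordLt_zero _ h₂

theorem realize_goodsteinTermination : M ⊨ goodsteinTermination ↔ ∀ e : M, Code e →
    (∀ x, Eval e 0 x → 2 ≤ x) → (∀ i x y, Eval e i x ∧ Eval e (i + 1) y → x ≤ y) →
      ∀ m, ∃ k, ∀ i, k ≤ i → Goodstein e m i 0 := by
  rw [goodsteinTermination, realize_sentence _ Empty.elim fun _ => 0]
  simp [admissible]

theorem realize_noDescent : M ⊨ noDescent ↔ ¬ ∃ e : M, Code e ∧ ∀ n, ∃ x y, Eval e n x ∧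
    Eval e (n + 1) y ∧ Ord x ∧ Ord y ∧ OrdLt y x := by
  rw [noDescent, realize_sentence _ Empty.elim fun _ => 0]
  simp

end Equivalence

end GoodsteinPA

theorem corollary2p6 :
    GoodsteinPA.Provable GoodsteinPA.PA
      (GoodsteinPA.goodsteinTermination.iff GoodsteinPA.noDescent) := by
  refine GoodsteinPA.provable_of_models fun M _ _ hM => ?_
  let : GoodsteinPA.PAModel M := { models := hM }
  rw [FirstOrder.Language.Sentence.Realize, FirstOrder.Language.Formula.realize_iff]
  exact (GoodsteinPA.realize_goodsteinTermination (M := M)).trans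
    (Iff.trans ⟨fun h ⟨_, he, hd⟩ => GoodsteinPA.no_descent h he hd, fun h _ he h0 hm m =>
      GoodsteinPA.goodstein_terminates h he h0 hm m⟩
        (GoodsteinPA.realize_noDescent (M := M)).symm)
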